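/- **Setting.** A seller offers $n$ items at prices $0\le p_1\le\dots\le p_n$ to one unit-demand buyer with values $v=(v_1,\dots,v_n)$. The null item, item $0$, has price $p_0=0$ and value $0$; buying it means buying nothing. The utility of item $i$ is $u_i=v_i-p_i$ (so $u_0=0$). The buyer buys an item of highest utility. Ties are broken by a fixed consistent rule: for every level $u$ there is a strict total order on the items $0,\dots,n$ that decides between items of utility $u$. Write $(i,x)\prec(j,y)$ if $x<y$, or if $x=y$ and the buyer prefers $j$ to $i$ at utility $x$. Each marginal $F_i$ is a finite distribution, given as a list of pairs $(v_i^\ell,p_i^\ell)$ with distinct real values and nonnegative real (possibly irrational) probabilities of sum $1$; $F_0$ is the point mass at $0$. A probability distribution $F$ on $\mathbb R^n$ is compatible if its marginals are $F_1,\dots,F_n$, and $R(p,F)=\mathbb E_{v\sim F}[p_{j^*(v)}]$, where $j^*(v)$ is the item bought, is its expected revenue. **The water-filling algorithm.** It maintains a coupling $c$, a finite list of chains. A chain consists of a mass and one utility of every item $0,\dots,n$. The rest of the probability mass of each utility is called uncoupled. Start with $c=\emptyset$ and perform, for $i=0,1,\dots,n$: 1. For each utility $a$ of item $i$, from the highest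 to the lowest: as long as $a$ has uncoupled mass and every item $j>i$ has a utility with uncoupled mass that is $\prec(i,a)$, select $a$, the highest such utility of each $j>i$, and an arbitrary utility with uncoupled mass of each $j<i$. Add to $c$ the chain of these utilities, its mass being the lowest of their uncoupled masses. 2. If $i<n$: sort the chains of $c$ by their utility of item $i+1$, in nondecreasing order. For each chain in this order, uncouple its utility of item $i+1$ and couple it instead to the lowest uncoupled mass of item $i+1$. If that mass spans several utilities, split the chain accordingly. Merge chains with the same utilities. The final coupling generates a distribution $F^*$ on $\mathbb R^n$: draw a chain with probability equal to its mass, and let $v_i$ be its utility of item $i$ plus $p_i$. **Theorem.** For all such prices, marginals and tie-breaking rules, and for every resolution of the arbitrary choices: (a) $F^*$ is a compatible probability distribution, and $R(p,F^*)\le R(p,F)$ for *every* compatible joint distribution $F$ (not only for perfect couplings). (b) The algorithm runs in time polynomial in its input size. When each arithmetic operation, comparison and tie-breaking query on real numbers takes one step, the number of steps is bounded by a fixed polynomial in $n$ plus the total number of value–probability pairs. When all prices, values and probabilities are rational, and an operation on two numbers of total bit length $b$ takes $Q(b)$ steps for a polynomial $Q$, the number of steps is bounded by a polynomial, depending only on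 $Q$, in the bit length of the input. -/

import Mathlib

open MeasureTheory

noncomputable section

namespace RobustPricing

/-! ## The model: one unit-demand buyer, `n` priced items, an outside option

Throughout, position `0` is the null item (value `0`, price `0`; buying it means buying nothing)
and item `i : Fin n` has position `i.succ`. -/

/-- A valuation profile of the `n` items. -/
abbrev Profile (n : ℕ) := Fin n → ℝ

/-- The prices with the null item in front. -/
def priceWithNull {n : ℕ} (p : Fin n → ℝ) : Fin (n + 1) → ℝ := Fin.cons 0 p

/-- The utilities `v i - p i`, with the utility `0` of the null item in front. -/
def utility {n : ℕ} (p : Fin n → ℝ) (v : Profile n) : Fin (n + 1) → ℝ :=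
  Fin.cons 0 (fun i => v i - p i)

/-- A tie-breaking rule: `tie u i j` says that between `i` and `j`, both at utility `u`, the buyer
chooses `j`. It is consistent if at each level `u` it is a strict total order of the positions. -/
abbrev TieRule (n : ℕ) := ℝ → Fin (n + 1) → Fin (n + 1) → Prop

def TieRule.Consistent {n : ℕ} (tie : TieRule n) : Prop :=
  ∀ u : ℝ, IsStrictTotalOrder (Fin (n + 1)) (tie u)

/-- Utility `x` of position `i` is dominated by utility `y` of position `j`. -/
def Dominated {n : ℕ} (tie : TieRule n) (i : Fin (n + 1)) (x : ℝ) (j : Fin (n + 1)) (y : ℝ) :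
    Prop :=
  x < y ∨ (x = y ∧ tie y i j)

/-- At the valuation profile `v` the buyer purchases position `j`. -/
def Buys {n : ℕ} (tie : TieRule n) (p : Fin n → ℝ) (v : Profile n) (j : Fin (n + 1)) : Prop :=
  ∀ k, k ≠ j → Dominated tie k (utility p v k) j (utility p v j)

open Classical in
/-- The price paid at the valuation profile `v` (there is exactly one `j` with `Buys tie p v j`). -/
def payment {n : ℕ} (tie : TieRule n) (p : Fin n → ℝ) (v : Profile n) : ℝ :=
  ∑ j : Fin (n + 1), if Buys tie p v j then priceWithNull p j else 0

/-- The expected revenue when the valuation profile has distribution `μ`. -/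
def revenue {n : ℕ} (tie : TieRule n) (p : Fin n → ℝ) (μ : Measure (Profile n)) : ℝ :=
  ∫ v, payment tie p v ∂μ

/-- An explicit list of value-probability pairs is a finite distribution. -/
structure IsMarginal (l : List (ℝ × ℝ)) : Prop where
  nodup : (l.map Prod.fst).Nodup
  nonneg : ∀ a ∈ l, 0 ≤ a.2
  total : (l.map Prod.snd).sum = 1

/-- The distribution described by a list of value-probability pairs. -/
def marginalLaw (l : List (ℝ × ℝ)) : Measure ℝ :=
  (l.map fun a => ENNReal.ofReal a.2 • Measure.dirac a.1).sum

/-- `μ` is a joint distribution of the values with the given marginals. -/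
structure Compatible {n : ℕ} (F : Fin n → List (ℝ × ℝ)) (μ : Measure (Profile n)) : Prop where
  isProbabilityMeasure : IsProbabilityMeasure μ
  marginal : ∀ i, μ.map (fun v => v i) = marginalLaw (F i)

/-- The instances: nonnegative prices in nondecreasing order, explicit finite marginals. -/
structure IsInstance {n : ℕ} (p : Fin n → ℝ) (F : Fin n → List (ℝ × ℝ)) : Prop where
  price_nonneg : ∀ i, 0 ≤ p i
  price_mono : Monotone p
  marginal : ∀ i, IsMarginal (F i)

/-! ## Computations with a step count

Every list cell that is visited or built costs one step. An operation (`+`, `-`, a comparison, a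
query of the buyer's preference) on two numbers `x, y` costs `cost x y` steps. With `cost = 1` this
is the unit-cost real-number model; with `cost` growing with the bit lengths of `x` and `y` it
is the logarithmic-cost model on rational inputs. -/

/-- A value together with the number of steps spent on computing it. -/
structure Timed (α : Type) where
  val : α
  time : ℕ

instance : Monad Timed where
  pure a := ⟨a, 0⟩
  bind x f := ⟨(f x.val).val, x.time + (f x.val).time⟩

/-- Spend one step. -/
def tick : Timed Unit := ⟨(), 1⟩

/-- A cost function for the elementary operations on two numbers. -/
abbrev Cost := ℝ → ℝ → ℕ

def addT (cost : Cost) (x y : ℝ) : Timed ℝ := ⟨x + y, cost x y⟩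

def subT (cost : Cost) (x y : ℝ) : Timed ℝ := ⟨x - y, cost x y⟩

open Classical in
def ltT (cost : Cost) (x y : ℝ) : Timed Bool := ⟨decide (x < y), cost x y⟩

open Classical in
def eqT (cost : Cost) (x y : ℝ) : Timed Bool := ⟨decide (x = y), cost x y⟩

/-! ## The water-filling algorithm -/

/-- A node `(u, r)` of an item: the utility `u`, of which the mass `r` is still uncoupled. -/
abbrev Node := ℝ × ℝ

/-- A chain: its mass, and one utility for every position `0, 1, …, n`. -/
structure Chain where
  mass : ℝ
  utils : List ℝ

/-- The nodes of all positions, each list with nonincreasing utilities, and the coupling `c`. -/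
structure State where
  nodes : List (List Node)
  chains : List Chain

/-- The parameters of a run: the cost function, the relation "utility `x` of position `i` is
dominated by utility `y` of position `j`", and a resolution of the arbitrary choices of the
algorithm (given the present coupling, a position, and its list of uncoupled nodes). -/
structure Params where
  cost : Cost
  dom : ℕ → ℝ → ℕ → ℝ → Prop
  pick : List Chain → ℕ → List Node → Node

variable (P : Params)

open Classical in
/-- The query whether utility `x` of position `i` is dominated by utility `y` of position `j`. -/
def domT (i : ℕ) (x : ℝ) (j : ℕ) (y : ℝ) : Timed Bool :=
  ⟨decide (P.dom i x j y), P.cost x y⟩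

/-! ### Preparation -/

/-- Insertion of a node into a list with nonincreasing utilities. -/
def insertNode (a : Node) : List Node → Timed (List Node)
  | [] => do
      tick
      return [a]
  | b :: l => do
      tick
      if ← ltT P.cost a.1 b.1 then
        let l' ← insertNode a l
        return b :: l'
      else
        return a :: b :: l

/-- The nodes of an item of price `q`: all its utilities, sorted, with their masses uncoupled. -/
def prepareItem (q : ℝ) : List (ℝ × ℝ) → Timed (List Node)
  | [] => do
      tick
      return []
  | a :: l => do
      tick
      let u ← subT P.cost a.1 q
      let l' ← prepareItem q l
      insertNode P (u, a.2) l'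

def prepare : List (ℝ × List (ℝ × ℝ)) → Timed (List (List Node))
  | [] => do
      tick
      return []
  | a :: l => do
      tick
      let L ← prepareItem P a.1 a.2
      let Ls ← prepare l
      return L :: Ls

def countItem : List Node → Timed ℕ
  | [] => do
      tick
      return 0
  | _ :: l => do
      tick
      let m ← countItem l
      return m + 1

/-- The total number of nodes. -/
def countNodes : List (List Node) → Timed ℕ
  | [] => do
      tick
      return 0
  | L :: Ls => do
      tick
      let a ← countItem L
      let b ← countNodes Ls
      return a + b

/-! ### Building chains that are dominated by position `i` -/

/-- The first node with uncoupled mass whose utility passes the test. -/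
def findNode (test : ℝ → Timed Bool) : List Node → Timed (Option Node)
  | [] => do
      tick
      return none
  | a :: l => do
      tick
      if ← ltT P.cost 0 a.2 then
        if ← test a.1 then
          return some a
        else
          findNode test l
      else
        findNode test l

/-- The nodes with uncoupled mass. -/
def uncoupled : List Node → Timed (List Node)
  | [] => do
      tick
      return []
  | a :: l => do
      tick
      let l' ← uncoupled l
      if ← ltT P.cost 0 a.2 then
        return a :: l'
      else
        return l'

/-- An arbitrary node with uncoupled mass. -/
def pickNode (c : List Chain) (j : ℕ) (L : List Node) : Timed (Option Node) := do
  tick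
  let l ← uncoupled P L
  match l with
  | [] => return none
  | b :: l' => return some (P.pick c j (b :: l'))

/-- The node of position `j` for a new chain with utility `a` of position `i`: the node of `a`
itself if `j = i`, the node with the highest uncoupled utility dominated by `a` if `j > i` (it is
the first one, as utilities are listed in nonincreasing order), an arbitrary uncoupled one if
`j < i`. -/
def selectNode (c : List Chain) (i : ℕ) (a : ℝ) (j : ℕ) (L : List Node) : Timed (Option Node) := do
  tick
  if j < i then
    pickNode P c j L
  else if j = i then
    findNode P (fun u => eqT P.cost u a) L
  else
    findNode P (fun u => domT P j u i a) L

/-- The nodes for a new chain, one for each of the positions `j, j + 1, …`, or `none` if for some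
position there is no suitable one. -/
def selectNodes (c : List Chain) (i : ℕ) (a : ℝ) : ℕ → List (List Node) → Timed (Option (List Node))
  | _, [] => do
      tick
      return some []
  | j, L :: Ls => do
      tick
      match ← selectNode P c i a j L with
      | none => return none
      | some b =>
        match ← selectNodes c i a (j + 1) Ls with
        | none => return none
        | some bs => return some (b :: bs)

/-- The lowest mass of a nonempty list of nodes (`m` is the lowest one so far). -/
def lowestMass (m : ℝ) : List Node → Timed ℝ
  | [] => do
      tick
      return m
  | b :: l => do
      tick
      if ← ltT P.cost b.2 m then
        lowestMass b.2 l
      else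
        lowestMass m l

/-- Removes the mass `m` from the uncoupled mass of utility `u`. -/
def removeMass (u m : ℝ) : List Node → Timed (List Node)
  | [] => do
      tick
      return []
  | a :: l => do
      tick
      if ← eqT P.cost a.1 u then
        let r ← subT P.cost a.2 m
        return (a.1, r) :: l
      else
        let l' ← removeMass u m l
        return a :: l'

/-- Removes the mass `m` from each of the selected nodes and lists their utilities. -/
def splitNodes (m : ℝ) : List Node → List (List Node) → Timed (List (List Node) × List ℝ)
  | b :: bs, L :: Ls => do
      tick
      let L' ← removeMass P b.1 m L
      let r ← splitNodes m bs Ls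
      return (L' :: r.1, b.1 :: r.2)
  | _, _ => do
      tick
      return ([], [])

/-- While utility `a` of position `i` has uncoupled mass, and every position `j > i` has an
uncoupled utility dominated by it: couple the selected nodes to a new chain whose mass is
the lowest of their uncoupled masses. Each execution exhausts at least one node, so the bound on the
number of executions (it is called with the number of all nodes plus one) never interrupts the loop. -/
def fillLoop (i : ℕ) (a : ℝ) : ℕ → State → Timed State
  | 0, s => do
      tick
      return s
  | b + 1, s => do
      tick
      match ← selectNodes P s.chains i a 0 s.nodes with
      | none => return s
      | some [] => return s
      | some (x :: xs) => do
          let m ← lowestMass P x.2 xs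
          let r ← splitNodes P m (x :: xs) s.nodes
          fillLoop i a b ⟨r.1, ⟨m, r.2⟩ :: s.chains⟩

/-- The loop over all utilities of position `i`, from the highest to the lowest. -/
def fillAll (i bound : ℕ) : List Node → State → Timed State
  | [], s => do
      tick
      return s
  | a :: l, s => do
      tick
      let s' ← fillLoop P i a.1 bound s
      fillAll i bound l s'

/-! ### The transition stage: recoupling position `j` -/

/-- The utility of position `j`. -/
def getUtil : ℕ → List ℝ → Timed ℝ
  | _, [] => do
      tick
      return 0
  | 0, u :: _ => do
      tick
      return u
  | j + 1, _ :: l => do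
      tick
      getUtil j l

/-- Replaces the utility of position `j` by `x`. -/
def setUtil (x : ℝ) : ℕ → List ℝ → Timed (List ℝ)
  | _, [] => do
      tick
      return []
  | 0, _ :: l => do
      tick
      return x :: l
  | j + 1, u :: l => do
      tick
      let l' ← setUtil x j l
      return u :: l'

def insertChain (j : ℕ) (t : Chain) : List Chain → Timed (List Chain)
  | [] => do
      tick
      return [t]
  | t' :: c => do
      tick
      let x ← getUtil j t'.utils
      let y ← getUtil j t.utils
      if ← ltT P.cost x y then
        let c' ← insertChain j t c
        return t' :: c'
      else
        return t :: t' :: c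

/-- Sorts the chains by their utilities of position `j`, in nondecreasing order. -/
def sortChains (j : ℕ) : List Chain → Timed (List Chain)
  | [] => do
      tick
      return []
  | t :: c => do
      tick
      let c' ← sortChains j c
      insertChain P j t c'

/-- Makes a mass `m` of utility `u` uncoupled again. -/
def restoreMass (u m : ℝ) : List Node → Timed (List Node)
  | [] => do
      tick
      return []
  | a :: l => do
      tick
      if ← eqT P.cost a.1 u then
        let r ← addT P.cost a.2 m
        return (a.1, r) :: l
      else
        let l' ← restoreMass u m l
        return a :: l'

/-- The result of taking uncoupled mass: the pieces `(utility, mass)` that were taken, the mass that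
is still missing, and the nodes that remain. -/
structure Taken where
  pieces : List (ℝ × ℝ)
  missing : ℝ
  nodes : List Node

/-- Takes an amount `m` of the uncoupled mass with the lowest utilities (utilities are listed in
nonincreasing order, so the tail of the list comes first). -/
def takeLowest (m : ℝ) : List Node → Timed Taken
  | [] => do
      tick
      return ⟨[], m, []⟩
  | a :: l => do
      tick
      let t ← takeLowest m l
      if ← ltT P.cost t.missing a.2 then
        if ← ltT P.cost 0 t.missing then
          let r ← subT P.cost a.2 t.missing
          return ⟨(a.1, t.missing) :: t.pieces, 0, (a.1, r) :: t.nodes⟩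
        else
          return ⟨t.pieces, t.missing, a :: t.nodes⟩
      else
        if ← ltT P.cost 0 a.2 then
          let m' ← subT P.cost t.missing a.2
          return ⟨(a.1, a.2) :: t.pieces, m', (a.1, 0) :: t.nodes⟩
        else
          return ⟨t.pieces, t.missing, a :: t.nodes⟩

def sameUtils : List ℝ → List ℝ → Timed Bool
  | [], [] => do
      tick
      return true
  | x :: l, y :: l' => do
      tick
      if ← eqT P.cost x y then
        sameUtils l l'
      else
        return false
  | _, _ => do
      tick
      return false

/-- Adds a chain, merging it with a chain over the same utilities if there is one. -/
def mergeChain (t : Chain) : List Chain → Timed (List Chain)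
  | [] => do
      tick
      return [t]
  | t' :: c => do
      tick
      if ← sameUtils P t'.utils t.utils then
        let m ← addT P.cost t'.mass t.mass
        return ⟨m, t'.utils⟩ :: c
      else
        let c' ← mergeChain t c
        return t' :: c'

/-- Splits the chain `t` into one chain for each piece, which gives the utility of position `j`. -/
def addPieces (j : ℕ) (t : Chain) : List (ℝ × ℝ) → List Chain → Timed (List Chain)
  | [], c => do
      tick
      return c
  | q :: l, c => do
      tick
      let us ← setUtil q.1 j t.utils
      let c' ← mergeChain P ⟨q.2, us⟩ c
      addPieces j t l c'

/-- The loop over the sorted chains: in each of them, the utility of position `j` is replaced by the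
lowest uncoupled mass of position `j` (`done` holds the chains that are already recoupled). -/
def recoupleLoop (j : ℕ) : List Chain → List Node → List Chain → Timed (List Node × List Chain)
  | [], L, done => do
      tick
      return (L, done)
  | t :: c, L, done => do
      tick
      let u ← getUtil j t.utils
      let L' ← restoreMass P u t.mass L
      let r ← takeLowest P t.mass L'
      let done' ← addPieces P j t r.pieces done
      recoupleLoop j c r.nodes done'

def getNodes : ℕ → List (List Node) → Timed (List Node)
  | _, [] => do
      tick
      return []
  | 0, L :: _ => do
      tick
      return L
  | j + 1, _ :: Ls => do
      tick
      getNodes j Ls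

def setNodes (L : List Node) : ℕ → List (List Node) → Timed (List (List Node))
  | _, [] => do
      tick
      return []
  | 0, _ :: Ls => do
      tick
      return L :: Ls
  | j + 1, L' :: Ls => do
      tick
      let Ls' ← setNodes L j Ls
      return L' :: Ls'

def recouple (j : ℕ) (s : State) : Timed State := do
  tick
  let c ← sortChains P j s.chains
  let L ← getNodes j s.nodes
  let r ← recoupleLoop P j c L []
  let Ls ← setNodes r.1 j s.nodes
  return ⟨Ls, r.2⟩

/-! ### The whole algorithm -/

/-- The main loop over the positions `i, i + 1, …`, whose lists of nodes at the start of the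
algorithm are given (from these, only the utilities are used). -/
def mainLoop (bound : ℕ) : ℕ → List (List Node) → State → Timed State
  | _, [], s => do
      tick
      return s
  | i, [L], s => do
      tick
      fillAll P i bound L s
  | i, L :: L' :: Ls, s => do
      tick
      let s' ← fillAll P i bound L s
      let s'' ← recouple P (i + 1) s'
      mainLoop bound (i + 1) (L' :: Ls) s''

/-- The algorithm, on the list of the items' prices and value-probability pairs. The null item
is put in front. -/
def waterFilling (input : List (ℝ × List (ℝ × ℝ))) : Timed (List Chain) := do
  tick
  let Ls ← prepare P ((0, [(0, 1)]) :: input)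
  let b ← countNodes Ls
  let s ← mainLoop P (b + 1) 0 Ls ⟨Ls, []⟩
  return s.chains

end RobustPricing

namespace RobustPricing

/-- A resolution of the algorithm's arbitrary choices that chooses from the nodes on offer. -/
def IsChoice (pick : List Chain → ℕ → List Node → Node) : Prop :=
  ∀ c j l, l ≠ [] → pick c j l ∈ l

/-- The run of the algorithm on an instance; ties are broken as the buyer does. -/
def run {n : ℕ} (cost : Cost) (tie : TieRule n) (pick : List Chain → ℕ → List Node → Node)
    (p : Fin n → ℝ) (F : Fin n → List (ℝ × ℝ)) : Timed (List Chain) :=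
  waterFilling
    { cost := cost
      dom := fun i x j y =>
        ∃ (hi : i < n + 1) (hj : j < n + 1), Dominated tie ⟨i, hi⟩ x ⟨j, hj⟩ y
      pick := pick }
    (List.ofFn fun i => (p i, F i))

/-- The valuation profile of a chain: the value of item `i` is its utility plus its price. -/
def chainProfile {n : ℕ} (p : Fin n → ℝ) (t : Chain) : Profile n :=
  fun i => t.utils.getD (i + 1) 0 + p i

/-- The distribution of the valuation profile when chains are drawn according to their masses. -/
def couplingLaw {n : ℕ} (p : Fin n → ℝ) (c : List Chain) : Measure (Profile n) :=
  (c.map fun t => ENNReal.ofReal t.mass • Measure.dirac (chainProfile p t)).sum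

/-- The joint distribution that the algorithm generates. -/
def outputLaw {n : ℕ} (tie : TieRule n) (pick : List Chain → ℕ → List Node → Node)
    (p : Fin n → ℝ) (F : Fin n → List (ℝ × ℝ)) : Measure (Profile n) :=
  couplingLaw p (run (fun _ _ => 1) tie pick p F).val

/-! ## Input sizes -/

/-- The number of items plus the number of value-probability pairs. -/
def numberSize {n : ℕ} (F : Fin n → List (ℝ × ℝ)) : ℕ :=
  n + ∑ i, (F i).length

open Classical in
/-- The number of bits of a rational number, written as a reduced fraction (with the value `0` for
irrational numbers, where it is not used). -/
def bitLength (x : ℝ) : ℕ :=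
  if h : ∃ q : ℚ, (q : ℝ) = x then h.choose.num.natAbs.size + h.choose.den.size else 0

/-- The number of bits of a rational instance. -/
def bitSize {n : ℕ} (p : Fin n → ℝ) (F : Fin n → List (ℝ × ℝ)) : ℕ :=
  ∑ i, (bitLength (p i) + ((F i).map fun a => bitLength a.1 + bitLength a.2).sum)

/-- All numbers of the instance are rational. -/
def IsRational {n : ℕ} (p : Fin n → ℝ) (F : Fin n → List (ℝ × ℝ)) : Prop :=
  ∀ i, (∃ q : ℚ, (q : ℝ) = p i) ∧
    ∀ a ∈ F i, (∃ q : ℚ, (q : ℝ) = a.1) ∧ (∃ q : ℚ, (q : ℝ) = a.2)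

end RobustPricing

end

/-!
The proof rests on a duality between couplings and thresholds. Summation by parts (`payment_eq`)
writes the price paid as the highest price minus the sum over `i` of the nonnegative price increment
after position `i` times the indicator of "one of the positions `0, …, i` is purchased"
(`BuysUpTo`). Hence it suffices that the output maximizes the probability of each of these events,
simultaneously for all `i`, among all compatible distributions.

For a position `j > i` and a utility `b`, a purchase among the positions up to `i` implies that one
of them exceeds the threshold `(j, b)` in the order of domination, or that the utility of `j` is
below `b` (`indicatorOf_buysUpTo_le`). The probabilities of the latter events are determined by the
marginals, so that their sum bounds the probability of a purchase up to `i` for every coupling.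

The algorithm attains such a bound at the end of each stage `i` (`stageOptimal_of_phaseInv`), and
later stages only lower utilities of positions after `i` in the chains that exist by then, so that
they keep the purchase up to `i`. The threshold is the highest among the lowest uncoupled utilities
of the positions after `i`. Every chain counts at most once, for three reasons. A chain created for
position `k` has, at each later position that has not been recoupled yet, the highest available
utility below that of `k`. Its utilities at the positions before `k`, like all uncoupled mass of the
positions up to `i`, are `Barred`: they are dominated by all uncoupled mass of some later position.
This persists since filling only removes uncoupled mass, and recoupling never frees mass below all
the mass that was uncoupled before. Finally, recoupling in the order of utilities leaves the coupled
mass of a position below its uncoupled mass, which is expressed by the level `w` of `RecoupleInv`.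
These properties form the invariant `PhaseInv`.

The level is also what bounds the number of steps: a chain is split into at most one piece more
than the number of utilities by which the level rises, so that recoupling a position adds at most as
many chains as the position has utilities, instead of multiplying their number. The sizes of numbers
are controlled because all masses lie in `[0, 1]` and are multiples of the reciprocal of a common
denominator of the given probabilities (`massGroup`), additions and subtractions being the only
operations on them. Both cost models are instances of one bound, `time_waterFilling`, for costs that
are bounded on a set that contains these numbers.
-/

namespace RobustPricing

/-! ### Values of timed computations -/

section TimedBasics

variable {α β : Type}

@[simp] theorem Timed.val_pure (a : α) : (pure a : Timed α).val = a := rfl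

@[simp] theorem Timed.time_pure (a : α) : (pure a : Timed α).time = 0 := rfl

@[simp] theorem Timed.val_bind (x : Timed α) (f : α → Timed β) :
    (x >>= f).val = (f x.val).val := rfl

@[simp] theorem Timed.time_bind (x : Timed α) (f : α → Timed β) :
    (x >>= f).time = x.time + (f x.val).time := rfl

@[simp] theorem time_tick : tick.time = 1 := rfl

@[simp] theorem val_addT (cost : Cost) (x y : ℝ) : (addT cost x y).val = x + y := rfl

@[simp] theorem time_addT (cost : Cost) (x y : ℝ) : (addT cost x y).time = cost x y := rfl

@[simp] theorem val_subT (cost : Cost) (x y : ℝ) : (subT cost x y).val = x - y := rfl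

@[simp] theorem time_subT (cost : Cost) (x y : ℝ) : (subT cost x y).time = cost x y := rfl

@[simp] theorem val_ltT (cost : Cost) (x y : ℝ) : (ltT cost x y).val = true ↔ x < y := by
  simp [ltT]

@[simp] theorem time_ltT (cost : Cost) (x y : ℝ) : (ltT cost x y).time = cost x y := rfl

@[simp] theorem val_eqT (cost : Cost) (x y : ℝ) : (eqT cost x y).val = true ↔ x = y := by
  simp [eqT]

@[simp] theorem time_eqT (cost : Cost) (x y : ℝ) : (eqT cost x y).time = cost x y := rfl

@[simp] theorem val_domT (P : Params) (i : ℕ) (x : ℝ) (j : ℕ) (y : ℝ) :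
    (domT P i x j y).val = true ↔ P.dom i x j y := by
  simp [domT]

end TimedBasics

/-! ### Sums over nodes and over chains -/

/-- The integral of `f` against the masses of a list of nodes (or of value-probability pairs). -/
def nodeSum (L : List (ℝ × ℝ)) (f : ℝ → ℝ) : ℝ := (L.map fun a => a.2 * f a.1).sum

/-- The integral of `g` against the masses of a list of chains, where `g` is a function of the list
of utilities. -/
def chainSum (c : List Chain) (g : List ℝ → ℝ) : ℝ := (c.map fun t => t.mass * g t.utils).sum

@[simp] theorem nodeSum_nil (f : ℝ → ℝ) : nodeSum [] f = 0 := rfl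

@[simp] theorem nodeSum_cons (a : ℝ × ℝ) (L : List (ℝ × ℝ)) (f : ℝ → ℝ) :
    nodeSum (a :: L) f = a.2 * f a.1 + nodeSum L f := by
  simp [nodeSum]

@[simp] theorem chainSum_nil (g : List ℝ → ℝ) : chainSum [] g = 0 := rfl

@[simp] theorem chainSum_cons (t : Chain) (c : List Chain) (g : List ℝ → ℝ) :
    chainSum (t :: c) g = t.mass * g t.utils + chainSum c g := by
  simp [chainSum]

theorem nodeSum_perm {L L' : List (ℝ × ℝ)} (h : L.Perm L') (f : ℝ → ℝ) :
    nodeSum L f = nodeSum L' f := (h.map _).sum_eq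

theorem chainSum_perm {c c' : List Chain} (h : c.Perm c') (g : List ℝ → ℝ) :
    chainSum c g = chainSum c' g := (h.map _).sum_eq

theorem nodeSum_nonneg {L : List (ℝ × ℝ)} (hL : ∀ a ∈ L, 0 ≤ a.2) {f : ℝ → ℝ}
    (hf : ∀ x, 0 ≤ f x) : 0 ≤ nodeSum L f := by
  refine List.sum_nonneg fun x hx => ?_
  obtain ⟨a, ha, rfl⟩ := List.mem_map.1 hx
  exact mul_nonneg (hL a ha) (hf _)

theorem chainSum_nonneg {c : List Chain} (hc : ∀ t ∈ c, 0 ≤ t.mass) {g : List ℝ → ℝ}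
    (hg : ∀ x, 0 ≤ g x) : 0 ≤ chainSum c g := by
  refine List.sum_nonneg fun x hx => ?_
  obtain ⟨a, ha, rfl⟩ := List.mem_map.1 hx
  exact mul_nonneg (hc a ha) (hg _)

theorem chainSum_le_of_forall {c : List Chain} (hc : ∀ t ∈ c, 0 ≤ t.mass) {g g' : List ℝ → ℝ}
    (h : ∀ t ∈ c, g t.utils ≤ g' t.utils) : chainSum c g ≤ chainSum c g' :=
  List.sum_le_sum fun t ht => mul_le_mul_of_nonneg_left (h t ht) (hc t ht)

theorem chainSum_congr {c : List Chain} {g g' : List ℝ → ℝ}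
    (h : ∀ t ∈ c, g t.utils = g' t.utils) : chainSum c g = chainSum c g' := by
  unfold chainSum
  congr 1
  exact List.map_congr_left fun t ht => by rw [h t ht]

theorem mass_le_nodeSum {L : List (ℝ × ℝ)} (hL : ∀ a ∈ L, 0 ≤ a.2) {a : ℝ × ℝ} (ha : a ∈ L) :
    a.2 ≤ nodeSum L fun _ => 1 := by
  refine List.single_le_sum (l := L.map fun a => a.2 * 1) (fun x hx => ?_) _
    (List.mem_map.2 ⟨a, ha, mul_one _⟩)
  obtain ⟨b, hb, rfl⟩ := List.mem_map.1 hx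
  simpa using hL b hb

theorem mass_le_chainSum {c : List Chain} (hc : ∀ t ∈ c, 0 ≤ t.mass) {t : Chain} (ht : t ∈ c) :
    t.mass ≤ chainSum c fun _ => 1 := by
  refine List.single_le_sum (l := c.map fun t => t.mass * 1) (fun x hx => ?_) _
    (List.mem_map.2 ⟨t, ht, mul_one _⟩)
  obtain ⟨b, hb, rfl⟩ := List.mem_map.1 hx
  simpa using hc b hb

theorem nodeSum_eq_zero {L : List (ℝ × ℝ)} {f : ℝ → ℝ} (h : ∀ a ∈ L, a.2 = 0 ∨ f a.1 = 0) :
    nodeSum L f = 0 := by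
  refine List.sum_eq_zero fun x hx => ?_
  obtain ⟨a, ha, rfl⟩ := List.mem_map.1 hx
  exact mul_eq_zero.2 (h a ha)

/-! ### What the elementary steps of the algorithm compute -/

section Values

variable (P : Params)

theorem insertNode_perm (a : Node) (l : List Node) : (insertNode P a l).val.Perm (a :: l) := by
  induction l with
  | nil => simp [insertNode]
  | cons b l ih =>
    rw [insertNode]
    simp only [Timed.val_bind, val_ltT]
    split
    · exact (ih.cons b).trans (.swap a b l)
    · exact .refl _

theorem insertNode_sorted (a : Node) {l : List Node} (h : l.Pairwise fun x y => y.1 ≤ x.1) :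
    (insertNode P a l).val.Pairwise fun x y => y.1 ≤ x.1 := by
  induction l with
  | nil => simp [insertNode]
  | cons b l ih =>
    rw [insertNode]
    simp only [Timed.val_bind, val_ltT]
    rw [List.pairwise_cons] at h
    split
    · rename_i hab
      refine List.pairwise_cons.2 ⟨fun c hc => ?_, ih h.2⟩
      rcases List.mem_cons.1 ((insertNode_perm P a l).mem_iff.1 hc) with rfl | hc
      · exact hab.le
      · exact h.1 c hc
    · rename_i hab
      refine List.pairwise_cons.2 ⟨fun c hc => ?_, List.pairwise_cons.2 h⟩
      rcases List.mem_cons.1 hc with rfl | hc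
      · exact not_lt.1 hab
      · exact (h.1 c hc).trans (not_lt.1 hab)

theorem prepareItem_perm (q : ℝ) (l : List (ℝ × ℝ)) :
    (prepareItem P q l).val.Perm (l.map fun a => (a.1 - q, a.2)) := by
  induction l with
  | nil => simp [prepareItem]
  | cons a l ih =>
    rw [prepareItem]
    simp only [Timed.val_bind, val_subT, List.map_cons]
    exact (insertNode_perm P _ _).trans (ih.cons _)

theorem prepareItem_sorted (q : ℝ) (l : List (ℝ × ℝ)) :
    (prepareItem P q l).val.Pairwise fun x y => y.1 ≤ x.1 := by
  induction l with
  | nil => simp [prepareItem]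
  | cons a l ih =>
    rw [prepareItem]
    exact insertNode_sorted P _ ih

theorem val_prepare (l : List (ℝ × List (ℝ × ℝ))) :
    (prepare P l).val = l.map fun a => (prepareItem P a.1 a.2).val := by
  induction l with
  | nil => rfl
  | cons a l ih => simp [prepare, ih]

theorem val_countItem (L : List Node) : (countItem L).val = L.length := by
  induction L with
  | nil => rfl
  | cons a l ih => simp [countItem, ih]

theorem val_countNodes (Ls : List (List Node)) :
    (countNodes Ls).val = (Ls.map List.length).sum := by
  induction Ls with
  | nil => rfl
  | cons a l ih => simp [countNodes, ih, val_countItem]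

/-- In a list with nonincreasing utilities, the first suitable node is the highest one. -/
theorem findNode_eq_some {test : ℝ → Timed Bool} {L : List Node} {b : Node}
    (h : (findNode P test L).val = some b) :
    b ∈ L ∧ 0 < b.2 ∧ (test b.1).val = true ∧
      (L.Pairwise (fun x y => y.1 ≤ x.1) →
        ∀ a ∈ L, 0 < a.2 → (test a.1).val = true → a.1 ≤ b.1) := by
  induction L with
  | nil => simp [findNode] at h
  | cons a l ih =>
    rw [findNode] at h
    simp only [Timed.val_bind, val_ltT] at h
    by_cases ha : 0 < a.2 ∧ (test a.1).val = true
    · simp only [ha.1, ha.2, if_true, Timed.val_bind, Timed.val_pure, Option.some.injEq] at h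
      subst h
      refine ⟨by simp, ha.1, ha.2, fun hs c hc _ _ => ?_⟩
      rcases List.mem_cons.1 hc with rfl | hc
      · exact le_rfl
      · exact (List.pairwise_cons.1 hs).1 c hc
    · have h' : (findNode P test l).val = some b := by
        split at h
        · rename_i h0
          have : (test a.1).val = false := by
            simpa using fun h' => ha ⟨h0, h'⟩
          simpa [this] using h
        · exact h
      obtain ⟨h1, h2, h3, h4⟩ := ih h'
      refine ⟨List.mem_cons_of_mem _ h1, h2, h3, fun hs c hc hc0 hct => ?_⟩
      rcases List.mem_cons.1 hc with rfl | hc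
      · exact absurd ⟨hc0, hct⟩ ha
      · exact h4 (List.pairwise_cons.1 hs).2 c hc hc0 hct

theorem findNode_eq_none {test : ℝ → Timed Bool} {L : List Node}
    (h : (findNode P test L).val = none) :
    ∀ a ∈ L, 0 < a.2 → (test a.1).val = false := by
  induction L with
  | nil => simp
  | cons a l ih =>
    rw [findNode] at h
    simp only [Timed.val_bind, val_ltT] at h
    intro c hc hc0
    split at h
    · rename_i ha
      simp only [Timed.val_bind] at h
      split at h
      · simp at h
      · rename_i hta
        rcases List.mem_cons.1 hc with rfl | hc
        · simpa using hta
        · exact ih h c hc hc0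
    · rename_i ha
      rcases List.mem_cons.1 hc with rfl | hc
      · exact absurd hc0 ha
      · exact ih h c hc hc0

open Classical in
theorem val_uncoupled (L : List Node) :
    (uncoupled P L).val = L.filter fun a => 0 < a.2 := by
  induction L with
  | nil => rfl
  | cons a l ih =>
    rw [uncoupled]
    simp only [Timed.val_bind, val_ltT, ih, List.filter_cons, decide_eq_true_eq]
    split <;> rfl

theorem val_pickNode (hP : IsChoice P.pick) (c : List Chain) (j : ℕ) (L : List Node) :
    (∃ b ∈ L, 0 < b.2 ∧ (pickNode P c j L).val = some b) ∨
      (pickNode P c j L).val = none ∧ ∀ a ∈ L, ¬ 0 < a.2 := by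
  classical
  rw [pickNode]
  simp only [Timed.val_bind, val_uncoupled]
  split
  · rename_i h
    right
    refine ⟨rfl, fun a ha h0 => ?_⟩
    have : a ∈ L.filter fun a => 0 < a.2 := List.mem_filter.2 ⟨ha, by simpa using h0⟩
    simp only [h] at this
    simp at this
  · rename_i b l h
    left
    have hm := hP c j (b :: l) (by simp)
    rw [← h, List.mem_filter] at hm
    exact ⟨_, hm.1, by simpa using hm.2, by rw [h]; rfl⟩

/-- The requirements on the node `b` of position `j`, with list of nodes `L`, in a new chain that
is built around utility `a` of position `i`. -/
structure Suitable (P : Params) (i : ℕ) (a : ℝ) (j : ℕ) (L : List Node) (b : Node) : Prop where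
  mem : b ∈ L
  pos : 0 < b.2
  eq : j = i → b.1 = a
  dom : i < j → P.dom j b.1 i a
  highest : i < j → ∀ b' ∈ L, 0 < b'.2 → P.dom j b'.1 i a → b'.1 ≤ b.1

/-- Position `j`, with list of nodes `L`, has no suitable node for a chain that is built around
utility `a` of position `i`. -/
def Unsuitable (P : Params) (i : ℕ) (a : ℝ) (j : ℕ) (L : List Node) : Prop :=
  ∀ b ∈ L, 0 < b.2 → ¬ j < i ∧ (j = i → b.1 ≠ a) ∧ (i < j → ¬ P.dom j b.1 i a)

theorem val_selectNode (hP : IsChoice P.pick) (c : List Chain) (i : ℕ) (a : ℝ) (j : ℕ)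
    {L : List Node} (hL : L.Pairwise fun x y => y.1 ≤ x.1) :
    (∃ b, Suitable P i a j L b ∧ (selectNode P c i a j L).val = some b) ∨
      (selectNode P c i a j L).val = none ∧ Unsuitable P i a j L := by
  rw [selectNode]
  simp only [Timed.val_bind]
  split
  · rename_i hj
    rcases val_pickNode P hP c j L with ⟨b, hb, h0, h⟩ | ⟨h, h'⟩
    · exact .inl ⟨b, ⟨hb, h0, by omega, by omega, by omega⟩, h⟩
    · exact .inr ⟨h, fun b hb h0 => absurd h0 (h' b hb)⟩
  · rename_i hj
    split
    · rename_i hji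
      cases h : (findNode P (fun u => eqT P.cost u a) L).val with
      | some b =>
        obtain ⟨h1, h2, h3, -⟩ := findNode_eq_some P h
        exact .inl ⟨b, ⟨h1, h2, fun _ => by simpa using h3, by omega, by omega⟩, rfl⟩
      | none =>
        refine .inr ⟨rfl, fun b hb h0 => ⟨hj, fun _ hba => ?_, by omega⟩⟩
        have := findNode_eq_none P h b hb h0
        simp [eqT, hba] at this
    · rename_i hji
      cases h : (findNode P (fun u => domT P j u i a) L).val with
      | some b =>
        obtain ⟨h1, h2, h3, h4⟩ := findNode_eq_some P h
        refine .inl ⟨b, ⟨h1, h2, by omega, fun _ => by simpa using h3, fun _ b' hb' h0 hd => ?_⟩,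
          rfl⟩
        exact h4 hL b' hb' h0 (by simpa using hd)
      | none =>
        refine .inr ⟨rfl, fun b hb h0 => ⟨hj, by omega, fun _ hba => ?_⟩⟩
        have := findNode_eq_none P h b hb h0
        simp [domT, hba] at this

theorem val_selectNodes (hP : IsChoice P.pick) (c : List Chain) (i : ℕ) (a : ℝ) (j : ℕ)
    {Ls : List (List Node)} (hL : ∀ L ∈ Ls, L.Pairwise fun x y => y.1 ≤ x.1) :
    (∃ bs, bs.length = Ls.length ∧
        (∀ r, ∀ (h : r < Ls.length) (h' : r < bs.length), Suitable P i a (j + r) Ls[r] bs[r]) ∧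
        (selectNodes P c i a j Ls).val = some bs) ∨
      (selectNodes P c i a j Ls).val = none ∧
        ∃ r, ∃ h : r < Ls.length, Unsuitable P i a (j + r) Ls[r] := by
  induction Ls generalizing j with
  | nil => exact .inl ⟨[], by simp, by simp, rfl⟩
  | cons L Ls ih =>
    rw [selectNodes]
    simp only [Timed.val_bind]
    rcases val_selectNode P hP c i a j (hL L (by simp)) with ⟨b, hb, h⟩ | ⟨h, h'⟩
    · rw [h]
      simp only [Timed.val_bind]
      rcases ih (j + 1) (fun L' hL' => hL L' (by simp [hL'])) with
        ⟨bs, hlen, hbs, h2⟩ | ⟨h2, r, hr, h3⟩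
      · rw [h2]
        refine .inl ⟨b :: bs, by simp [hlen], fun r h h' => ?_, rfl⟩
        cases r with
        | zero => exact hb
        | succ r =>
          have := hbs r (by simpa using h) (by simpa using h')
          rw [add_right_comm, add_assoc] at this
          simpa using this
      · rw [h2]
        refine .inr ⟨rfl, r + 1, by simpa using hr, ?_⟩
        rw [add_right_comm, add_assoc] at h3
        simpa using h3
    · rw [h]
      exact .inr ⟨rfl, 0, by simp, h'⟩

theorem val_lowestMass (m : ℝ) (l : List Node) :
    (lowestMass P m l).val ≤ m ∧ (∀ b ∈ l, (lowestMass P m l).val ≤ b.2) ∧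
      ((lowestMass P m l).val = m ∨ ∃ b ∈ l, (lowestMass P m l).val = b.2) := by
  induction l generalizing m with
  | nil => simp [lowestMass]
  | cons b l ih =>
    rw [lowestMass]
    simp only [Timed.val_bind, val_ltT]
    split
    · rename_i hb
      obtain ⟨h1, h2, h3⟩ := ih b.2
      refine ⟨h1.trans hb.le, by simpa using ⟨h1, fun x y h => h2 _ h⟩, .inr ?_⟩
      rcases h3 with h3 | ⟨b', hb', h3⟩
      · exact ⟨b, by simp, h3⟩
      · exact ⟨b', by simp [hb'], h3⟩
    · rename_i hb
      obtain ⟨h1, h2, h3⟩ := ih m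
      refine ⟨h1, by simpa using ⟨h1.trans (not_lt.1 hb), fun x y h => h2 _ h⟩, ?_⟩
      rcases h3 with h3 | ⟨b', hb', h3⟩
      · exact .inl h3
      · exact .inr ⟨b', by simp [hb'], h3⟩

/-- The nodes after the uncoupled mass of utility `u` has been increased by `m`. -/
noncomputable def addMass (u m : ℝ) (L : List Node) : List Node :=
  L.map fun a => if a.1 = u then (a.1, a.2 + m) else a

theorem addMass_of_notMem {u : ℝ} (m : ℝ) {L : List Node} (h : ∀ a ∈ L, a.1 ≠ u) :
    addMass u m L = L := by
  classical
  conv_rhs => rw [← List.map_id L]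
  exact List.map_congr_left fun a ha => by simp [h a ha]

theorem val_restoreMass (u m : ℝ) {L : List Node} (hL : L.Pairwise fun x y => y.1 < x.1) :
    (restoreMass P u m L).val = addMass u m L := by
  induction L with
  | nil => rfl
  | cons a l ih =>
    rw [List.pairwise_cons] at hL
    rw [restoreMass]
    simp only [Timed.val_bind, val_eqT]
    split
    · rename_i ha
      have := addMass_of_notMem m (u := u) (L := l) fun b hb => ha ▸ (hL.1 b hb).ne
      rw [addMass] at this
      simp [addMass, ha, this]
    · rename_i ha
      simp [addMass, ha, ih hL.2]

theorem val_removeMass (u m : ℝ) {L : List Node} (hL : L.Pairwise fun x y => y.1 < x.1) :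
    (removeMass P u m L).val = addMass u (-m) L := by
  induction L with
  | nil => rfl
  | cons a l ih =>
    rw [List.pairwise_cons] at hL
    rw [removeMass]
    simp only [Timed.val_bind, val_eqT]
    split
    · rename_i ha
      have := addMass_of_notMem (-m) (u := u) (L := l) fun b hb => ha ▸ (hL.1 b hb).ne
      rw [addMass] at this
      simp [addMass, ha, this, sub_eq_add_neg]
    · rename_i ha
      simp [addMass, ha, ih hL.2]

theorem map_fst_addMass (u m : ℝ) (L : List Node) :
    (addMass u m L).map Prod.fst = L.map Prod.fst := by
  classical
  rw [addMass, List.map_map]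
  exact List.map_congr_left fun a _ => by simp only [Function.comp]; split <;> rfl

theorem mem_addMass {u m : ℝ} {L : List Node} {a : Node} (h : a ∈ addMass u m L) :
    (a ∈ L ∧ a.1 ≠ u) ∨ (a.1 = u ∧ (u, a.2 - m) ∈ L) := by
  classical
  obtain ⟨b, hb, rfl⟩ := List.mem_map.1 h
  split
  · rename_i hbu
    refine .inr ⟨hbu, ?_⟩
    subst hbu
    simpa using hb
  · rename_i hbu
    exact .inl ⟨hb, hbu⟩

theorem nodeSum_addMass {u m : ℝ} {L : List Node} (hL : L.Pairwise fun x y => y.1 < x.1)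
    (hu : u ∈ L.map Prod.fst) (f : ℝ → ℝ) :
    nodeSum (addMass u m L) f = nodeSum L f + m * f u := by
  classical
  induction L with
  | nil => simp at hu
  | cons a l ih =>
    rw [List.pairwise_cons] at hL
    by_cases ha : a.1 = u
    · have := addMass_of_notMem m (u := u) (L := l) fun b hb => ha ▸ (hL.1 b hb).ne
      rw [addMass] at this
      simp only [addMass, List.map_cons, ha, if_true, this, nodeSum_cons]
      ring
    · have hu' : u ∈ l.map Prod.fst := by
        rcases List.mem_cons.1 hu with h | h
        · exact absurd h.symm ha
        · exact h
      have := ih hL.2 hu'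
      rw [addMass] at this
      simp only [addMass, List.map_cons, ha, if_false, this, nodeSum_cons]
      ring

theorem val_splitNodes (m : ℝ) {bs : List Node} {Ls : List (List Node)}
    (h : bs.length = Ls.length) (hL : ∀ L ∈ Ls, L.Pairwise fun x y => y.1 < x.1) :
    (splitNodes P m bs Ls).val =
      (List.zipWith (fun (b : Node) L => addMass b.1 (-m) L) bs Ls, bs.map Prod.fst) := by
  induction bs generalizing Ls with
  | nil =>
    cases Ls with
    | nil => rfl
    | cons L Ls => simp at h
  | cons b bs ih =>
    cases Ls with
    | nil => simp at h
    | cons L Ls =>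
      rw [splitNodes]
      simp only [Timed.val_bind, val_removeMass P _ _ (hL L (by simp)),
        ih (Ls := Ls) (by simpa using h) fun L' hL' => hL L' (by simp [hL'])]
      rfl

theorem val_getUtil (j : ℕ) (l : List ℝ) : (getUtil j l).val = l.getD j 0 := by
  induction l generalizing j with
  | nil => cases j <;> rfl
  | cons u l ih =>
    cases j with
    | zero => rfl
    | succ j => simp [getUtil, ih]

theorem val_setUtil (x : ℝ) (j : ℕ) (l : List ℝ) : (setUtil x j l).val = l.set j x := by
  induction l generalizing j with
  | nil => cases j <;> rfl
  | cons u l ih =>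
    cases j with
    | zero => rfl
    | succ j => simp [setUtil, ih]

theorem val_getNodes (j : ℕ) (l : List (List Node)) : (getNodes j l).val = l.getD j [] := by
  induction l generalizing j with
  | nil => cases j <;> rfl
  | cons u l ih =>
    cases j with
    | zero => rfl
    | succ j => simp [getNodes, ih]

theorem val_setNodes (L : List Node) (j : ℕ) (l : List (List Node)) :
    (setNodes L j l).val = l.set j L := by
  induction l generalizing j with
  | nil => cases j <;> rfl
  | cons u l ih =>
    cases j with
    | zero => rfl
    | succ j => simp [setNodes, ih]

theorem insertChain_perm (j : ℕ) (t : Chain) (c : List Chain) :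
    (insertChain P j t c).val.Perm (t :: c) := by
  induction c with
  | nil => simp [insertChain]
  | cons b l ih =>
    rw [insertChain]
    simp only [Timed.val_bind, val_ltT]
    split
    · exact (ih.cons b).trans (.swap t b l)
    · exact .refl _

theorem insertChain_sorted (j : ℕ) (t : Chain) {c : List Chain}
    (h : c.Pairwise fun x y => x.utils.getD j 0 ≤ y.utils.getD j 0) :
    (insertChain P j t c).val.Pairwise fun x y => x.utils.getD j 0 ≤ y.utils.getD j 0 := by
  induction c with
  | nil => simp [insertChain]
  | cons b l ih =>
    rw [insertChain]
    simp only [Timed.val_bind, val_ltT, val_getUtil]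
    rw [List.pairwise_cons] at h
    split
    · rename_i hab
      refine List.pairwise_cons.2 ⟨fun c hc => ?_, ih h.2⟩
      rcases List.mem_cons.1 ((insertChain_perm P j t l).mem_iff.1 hc) with rfl | hc
      · exact hab.le
      · exact h.1 c hc
    · rename_i hab
      refine List.pairwise_cons.2 ⟨fun c hc => ?_, List.pairwise_cons.2 h⟩
      rcases List.mem_cons.1 hc with rfl | hc
      · exact not_lt.1 hab
      · exact (not_lt.1 hab).trans (h.1 c hc)

theorem sortChains_perm (j : ℕ) (c : List Chain) : (sortChains P j c).val.Perm c := by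
  induction c with
  | nil => simp [sortChains]
  | cons t c ih => exact (insertChain_perm P j t _).trans (ih.cons t)

theorem sortChains_sorted (j : ℕ) (c : List Chain) :
    (sortChains P j c).val.Pairwise fun x y => x.utils.getD j 0 ≤ y.utils.getD j 0 := by
  induction c with
  | nil => simp [sortChains]
  | cons t c ih => exact insertChain_sorted P j t ih

theorem val_sameUtils (l l' : List ℝ) : (sameUtils P l l').val = true ↔ l = l' := by
  induction l generalizing l' with
  | nil => cases l' <;> simp [sameUtils]
  | cons x l ih =>
    cases l' with
    | nil => simp [sameUtils]
    | cons y l' =>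
      rw [sameUtils]
      simp only [Timed.val_bind, val_eqT]
      split
      · rename_i h
        simp [ih, h]
      · rename_i h
        simp [h]

theorem chainSum_mergeChain (t : Chain) (c : List Chain) (g : List ℝ → ℝ) :
    chainSum (mergeChain P t c).val g = t.mass * g t.utils + chainSum c g := by
  induction c with
  | nil => simp [mergeChain]
  | cons t' c ih =>
    rw [mergeChain]
    simp only [Timed.val_bind, val_sameUtils]
    split
    · rename_i h
      simp [h]
      ring
    · simp [ih]
      ring

theorem mem_mergeChain {t : Chain} {c : List Chain} {t' : Chain}
    (h : t' ∈ (mergeChain P t c).val) :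
    t' ∈ c ∨ t' = t ∨ ∃ s ∈ c, s.utils = t.utils ∧ t' = ⟨s.mass + t.mass, t.utils⟩ := by
  induction c with
  | nil => simpa [mergeChain] using h
  | cons s c ih =>
    rw [mergeChain] at h
    simp only [Timed.val_bind, val_sameUtils] at h
    split at h
    · rename_i hst
      simp only [Timed.val_bind, val_addT, Timed.val_pure, List.mem_cons] at h
      rcases h with rfl | h
      · exact .inr (.inr ⟨s, by simp, hst, by rw [hst]⟩)
      · exact .inl (by simp [h])
    · simp only [Timed.val_bind, Timed.val_pure, List.mem_cons] at h
      rcases h with rfl | h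
      · exact .inl (by simp)
      · rcases ih h with h | h | ⟨s', hs', h⟩
        · exact .inl (by simp [h])
        · exact .inr (.inl h)
        · exact .inr (.inr ⟨s', by simp [hs'], h⟩)

theorem length_mergeChain (t : Chain) (c : List Chain) :
    (mergeChain P t c).val.length ≤ c.length + 1 := by
  induction c with
  | nil => simp [mergeChain]
  | cons s c ih =>
    rw [mergeChain]
    simp only [Timed.val_bind, val_sameUtils]
    split
    · simp
    · simpa using ih

theorem addPieces_cons (j : ℕ) (t : Chain) (q : ℝ × ℝ) (l : List (ℝ × ℝ)) (c : List Chain) :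
    (addPieces P j t (q :: l) c).val =
      (addPieces P j t l (mergeChain P ⟨q.2, t.utils.set j q.1⟩ c).val).val := by
  rw [addPieces]
  simp [val_setUtil]

theorem chainSum_addPieces (j : ℕ) (t : Chain) (l : List (ℝ × ℝ)) (c : List Chain)
    (g : List ℝ → ℝ) :
    chainSum (addPieces P j t l c).val g =
      nodeSum l (fun x => g (t.utils.set j x)) + chainSum c g := by
  induction l generalizing c with
  | nil => simp [addPieces]
  | cons q l ih =>
    rw [addPieces_cons, ih, chainSum_mergeChain, nodeSum_cons]
    ring

/-- A property of chains that is kept when the masses of chains with the same utilities are added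
passes to the chains after a chain has been split into pieces. -/
theorem forall_mem_addPieces (j : ℕ) (t : Chain) {l : List (ℝ × ℝ)} {c : List Chain}
    {Q : Chain → Prop} (hadd : ∀ m m' us, Q ⟨m, us⟩ → Q ⟨m', us⟩ → Q ⟨m + m', us⟩)
    (hl : ∀ q ∈ l, Q ⟨q.2, t.utils.set j q.1⟩) (hc : ∀ s ∈ c, Q s) :
    ∀ s ∈ (addPieces P j t l c).val, Q s := by
  induction l generalizing c with
  | nil => simpa [addPieces] using hc
  | cons q l ih =>
    rw [addPieces_cons]
    refine ih (fun q hq => hl q (by simp [hq])) fun s hs => ?_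
    have hq := hl q (by simp)
    rcases mem_mergeChain P hs with h | rfl | ⟨s', hs', hu, rfl⟩
    · exact hc s h
    · exact hq
    · have hu' : s'.utils = t.utils.set j q.1 := hu
      exact hadd s'.mass _ _ (by rw [← hu']; exact hc s' hs') hq

theorem length_addPieces (j : ℕ) (t : Chain) (l : List (ℝ × ℝ)) (c : List Chain) :
    (addPieces P j t l c).val.length ≤ c.length + l.length := by
  induction l generalizing c with
  | nil => simp [addPieces]
  | cons q l ih =>
    rw [addPieces_cons]
    refine (ih _).trans ?_
    have := length_mergeChain P ⟨q.2, t.utils.set j q.1⟩ c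
    simp only [List.length_cons]
    omega

/-- The outcome of taking the mass `m` from the lowest uncoupled utilities of `L`. Mass is missing
only if all nodes are exhausted, and no piece lies above mass that remains. All masses stay in the
additive subgroup `G`. -/
structure TakeSpec (G : AddSubgroup ℝ) (m : ℝ) (L : List Node) (r : Taken) : Prop where
  utils : r.nodes.map Prod.fst = L.map Prod.fst
  mass : ∀ a ∈ r.nodes, 0 ≤ a.2 ∧ a.2 ∈ G ∧ ∃ b ∈ L, b.1 = a.1 ∧ a.2 ≤ b.2
  sum : ∀ f, nodeSum r.nodes f + nodeSum r.pieces f = nodeSum L f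
  total : nodeSum r.pieces (fun _ => 1) + r.missing = m
  missing_nonneg : 0 ≤ r.missing
  missing_mem : r.missing ∈ G
  missing_pos : 0 < r.missing → ∀ a ∈ r.nodes, a.2 = 0
  pieces : ∀ q ∈ r.pieces, 0 < q.2 ∧ q.2 ∈ G ∧ ∃ b ∈ L, b.1 = q.1 ∧ q.2 ≤ b.2
  sublist : (r.pieces.map Prod.fst).Sublist (L.map Prod.fst)
  lowest : ∀ q ∈ r.pieces, ∀ a ∈ r.nodes, 0 < a.2 → q.1 ≤ a.1

theorem takeLowest_spec (G : AddSubgroup ℝ) {m : ℝ} (hm : 0 ≤ m) (hmG : m ∈ G) {L : List Node}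
    (hs : L.Pairwise fun x y => y.1 < x.1) (hL : ∀ a ∈ L, 0 ≤ a.2 ∧ a.2 ∈ G) :
    TakeSpec G m L (takeLowest P m L).val := by
  induction L with
  | nil => constructor <;> simp [takeLowest, hm, hmG]
  | cons a l ih =>
    rw [List.pairwise_cons] at hs
    have IH := ih hs.2 fun b hb => hL b (by simp [hb])
    obtain ⟨ha0, haG⟩ := hL a (by simp)
    rw [takeLowest]
    simp only [Timed.val_bind, val_ltT]
    generalize (takeLowest P m l).val = t at IH
    have hmass : ∀ b ∈ t.nodes, 0 ≤ b.2 ∧ b.2 ∈ G ∧ ∃ b' ∈ a :: l, b'.1 = b.1 ∧ b.2 ≤ b'.2 := by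
      intro b hb
      obtain ⟨h1, h2, b', h3, h4⟩ := IH.mass b hb
      exact ⟨h1, h2, b', by simp [h3], h4⟩
    have hpieces : ∀ q ∈ t.pieces, 0 < q.2 ∧ q.2 ∈ G ∧ ∃ b ∈ a :: l, b.1 = q.1 ∧ q.2 ≤ b.2 := by
      intro b hb
      obtain ⟨h1, h2, b', h3, h4⟩ := IH.pieces b hb
      exact ⟨h1, h2, b', by simp [h3], h4⟩
    have hlow : ∀ q ∈ t.pieces, q.1 ≤ a.1 := by
      intro q hq
      obtain ⟨-, -, b, hb, hbq, -⟩ := IH.pieces q hq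
      exact hbq ▸ (hs.1 b hb).le
    -- if mass is still missing when `a` is reached, the nodes below `a` are exhausted
    have hzero : 0 < t.missing → ∀ b ∈ t.nodes, ¬ 0 < b.2 := fun h b hb => by
      rw [IH.missing_pos h b hb]; exact lt_irrefl _
    have hkeep : (0 < t.missing → a.2 = 0) →
        TakeSpec G m (a :: l) ⟨t.pieces, t.missing, a :: t.nodes⟩ := fun h0 =>
      { utils := by simp [IH.utils]
        mass := by
          simp only [List.forall_mem_cons]
          exact ⟨⟨ha0, haG, a, by simp, rfl, le_rfl⟩, hmass⟩
        sum := fun f => by simp [← IH.sum f]; ring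
        total := IH.total
        missing_nonneg := IH.missing_nonneg
        missing_mem := IH.missing_mem
        missing_pos := fun h => by
          simp only [List.forall_mem_cons]
          exact ⟨h0 h, IH.missing_pos h⟩
        pieces := hpieces
        sublist := IH.sublist.cons _
        lowest := fun q hq => by
          simp only [List.forall_mem_cons]
          exact ⟨fun _ => hlow q hq, IH.lowest q hq⟩ }
    split
    · rename_i hlt
      simp only [Timed.val_bind, val_ltT]
      split
      · rename_i hpos
        exact
          { utils := by simp [IH.utils]
            mass := by
              simp only [Timed.val_bind, val_subT, Timed.val_pure, List.forall_mem_cons]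
              exact ⟨⟨by linarith, G.sub_mem haG IH.missing_mem, a, by simp, rfl, by linarith⟩,
                hmass⟩
            sum := fun f => by simp [← IH.sum f]; ring
            total := by simp [← IH.total]; ring
            missing_nonneg := le_rfl
            missing_mem := G.zero_mem
            missing_pos := fun h => absurd h (lt_irrefl _)
            pieces := by
              simp only [Timed.val_bind, val_subT, Timed.val_pure, List.forall_mem_cons]
              exact ⟨⟨hpos, IH.missing_mem, a, by simp, rfl, hlt.le⟩, hpieces⟩
            sublist := by simpa using IH.sublist
            lowest := by
              simp only [Timed.val_bind, val_subT, Timed.val_pure, List.forall_mem_cons]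
              exact ⟨⟨fun _ => le_rfl, fun b hb h => absurd h (hzero hpos b hb)⟩,
                fun q hq => ⟨fun _ => hlow q hq, IH.lowest q hq⟩⟩ }
      · rename_i hpos
        exact hkeep fun h => absurd h hpos
    · rename_i hlt
      simp only [Timed.val_bind, val_ltT]
      split
      · rename_i hpos
        have hmis : 0 < t.missing := hpos.trans_le (not_lt.1 hlt)
        exact
          { utils := by simp [IH.utils]
            mass := by
              simp only [Timed.val_bind, val_subT, Timed.val_pure, List.forall_mem_cons]
              exact ⟨⟨le_rfl, G.zero_mem, a, by simp, rfl, ha0⟩, hmass⟩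
            sum := fun f => by simp [← IH.sum f]; ring
            total := by simp [← IH.total]; ring
            missing_nonneg := by simpa using hlt
            missing_mem := G.sub_mem IH.missing_mem haG
            missing_pos := fun h => by
              simp only [Timed.val_bind, val_subT, Timed.val_pure, List.forall_mem_cons]
              exact ⟨trivial, IH.missing_pos hmis⟩
            pieces := by
              simp only [Timed.val_bind, val_subT, Timed.val_pure, List.forall_mem_cons]
              exact ⟨⟨hpos, haG, a, by simp, rfl, le_rfl⟩, hpieces⟩
            sublist := by simpa using IH.sublist
            lowest := by
              simp only [Timed.val_bind, val_subT, Timed.val_pure, List.forall_mem_cons]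
              exact ⟨⟨fun _ => le_rfl, fun b hb h => absurd h (hzero hmis b hb)⟩,
                fun q hq => ⟨fun _ => hlow q hq, IH.lowest q hq⟩⟩ }
      · rename_i hpos
        exact hkeep fun _ => le_antisymm (not_lt.1 hpos) ha0

end Values

/-! ### Recoupling one position -/

theorem nodeSum_congr {L : List (ℝ × ℝ)} {f g : ℝ → ℝ} (h : ∀ a ∈ L, f a.1 = g a.1) :
    nodeSum L f = nodeSum L g := by
  unfold nodeSum
  congr 1
  exact List.map_congr_left fun a ha => by rw [h a ha]

theorem nodeSum_le_of_forall {L : List (ℝ × ℝ)} (hL : ∀ a ∈ L, 0 ≤ a.2) {f g : ℝ → ℝ}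
    (h : ∀ a ∈ L, f a.1 ≤ g a.1) : nodeSum L f ≤ nodeSum L g :=
  List.sum_le_sum fun a ha => mul_le_mul_of_nonneg_left (h a ha) (hL a ha)

theorem nodeSum_lt_of_mem {L : List (ℝ × ℝ)} (hL : ∀ a ∈ L, 0 ≤ a.2) {f g : ℝ → ℝ}
    (h : ∀ a ∈ L, f a.1 ≤ g a.1) {a : ℝ × ℝ} (ha : a ∈ L) (h0 : 0 < a.2) (hlt : f a.1 < g a.1) :
    nodeSum L f < nodeSum L g :=
  List.sum_lt_sum _ _ (fun a ha => mul_le_mul_of_nonneg_left (h a ha) (hL a ha))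
    ⟨a, ha, mul_lt_mul_of_pos_left hlt h0⟩

theorem countP_le_eq_add (l : List ℝ) {w w' : ℝ} (h : w ≤ w') :
    l.countP (fun u => decide (w ≤ u)) =
      l.countP (fun u => decide (w ≤ u ∧ u < w')) + l.countP (fun u => decide (w' ≤ u)) := by
  induction l with
  | nil => rfl
  | cons a l ih =>
    simp only [List.countP_cons, ih, decide_eq_true_eq]
    by_cases h1 : w' ≤ a
    · simp [h1, h.trans h1, add_assoc]
    · simp [h1, not_le.1 h1]
      ring

/-- The situation in the middle of the recoupling of position `j`, whose utilities are `Us`: the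
chains `c` are still to be recoupled, the chains `done` have been recoupled. The level `w` separates
the utilities that have been recoupled from all that are still to be used. -/
structure RecoupleInv (G : AddSubgroup ℝ) (Us : List ℝ) (j : ℕ) (w : ℝ) (c : List Chain)
    (L : List Node) (done : List Chain) : Prop where
  utils : L.map Prod.fst = Us
  node : ∀ a ∈ L, 0 ≤ a.2 ∧ a.2 ∈ G
  rest : ∀ t ∈ c, 0 < t.mass ∧ t.mass ∈ G ∧ j < t.utils.length ∧ t.utils.getD j 0 ∈ Us ∧
    w ≤ t.utils.getD j 0
  sorted : c.Pairwise fun x y => x.utils.getD j 0 ≤ y.utils.getD j 0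
  recoupled : ∀ t ∈ done, 0 < t.mass ∧ t.mass ∈ G ∧ j < t.utils.length ∧ t.utils.getD j 0 ∈ Us ∧
    t.utils.getD j 0 ≤ w
  level : ∀ a ∈ L, 0 < a.2 → w ≤ a.1

/-- The effect of recoupling the chain `t` to the pieces `r.pieces`: the level rises from `w` to
`w'`, by at least as many utilities as there are pieces, minus one. No mass is freed below all the
mass that was uncoupled before. -/
structure RecoupleStep (G : AddSubgroup ℝ) (Us : List ℝ) (j : ℕ) (w : ℝ) (t : Chain)
    (c : List Chain) (L : List Node) (done : List Chain) (r : Taken) (w' : ℝ) (done' : List Chain) :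
    Prop where
  inv : RecoupleInv G Us j w' c r.nodes done'
  length : r.pieces.length + Us.countP (fun u => decide (w' ≤ u)) ≤
    1 + Us.countP (fun u => decide (w ≤ u))
  piece : ∀ q ∈ r.pieces, 0 < q.2 ∧ q.1 ∈ Us ∧ q.1 ≤ t.utils.getD j 0
  mass : nodeSum r.pieces (fun _ => 1) = t.mass
  sum : ∀ f, nodeSum r.nodes f + nodeSum r.pieces f = nodeSum L f + t.mass * f (t.utils.getD j 0)
  barrier : ∀ a ∈ r.nodes, 0 < a.2 → ∃ b ∈ L, 0 < b.2 ∧ b.1 ≤ a.1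

variable (P : Params)

theorem pairwise_of_map_fst {L : List Node} {Us : List ℝ} (hUs : Us.Pairwise fun x y => y < x)
    (h : L.map Prod.fst = Us) : L.Pairwise fun x y => y.1 < x.1 := by
  rw [← h, List.pairwise_map] at hUs
  exact hUs

/-- One execution of the recoupling loop. The new level is the highest utility that is taken; it is
at most the utility `u` that has just been freed, and therefore at most the utilities of all later
chains, as these are sorted. -/
theorem recouple_step {G : AddSubgroup ℝ} {Us : List ℝ} (hUs : Us.Pairwise fun x y => y < x)
    {j : ℕ} {w : ℝ} {t : Chain} {c : List Chain} {L : List Node} {done : List Chain}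
    (h : RecoupleInv G Us j w (t :: c) L done) {r : Taken}
    (hr : r = (takeLowest P t.mass (addMass (t.utils.getD j 0) t.mass L)).val) :
    TakeSpec G t.mass (addMass (t.utils.getD j 0) t.mass L) r ∧
    ∃ w', RecoupleStep G Us j w t c L done r w' (addPieces P j t r.pieces done).val := by
  obtain ⟨hm, hmG, hj, hu, hw⟩ := h.rest t (by simp)
  set u := t.utils.getD j 0 with hudef
  have hs := pairwise_of_map_fst hUs h.utils
  have hL0 : ∀ a ∈ L, 0 ≤ a.2 := fun a ha => (h.node a ha).1
  have hL1 : ∀ a ∈ addMass u t.mass L, 0 ≤ a.2 ∧ a.2 ∈ G := by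
    intro a ha
    rcases mem_addMass ha with ⟨ha, -⟩ | ⟨-, ha⟩
    · exact h.node a ha
    · obtain ⟨h1, h2⟩ := h.node _ ha
      exact ⟨by simp only at h1; linarith, by simpa using G.add_mem h2 hmG⟩
  have hu1 : (addMass u t.mass L).map Prod.fst = Us := (map_fst_addMass _ _ _).trans h.utils
  have T := takeLowest_spec P G hm.le hmG (pairwise_of_map_fst hUs hu1) hL1
  rw [← hr] at T
  refine ⟨T, ?_⟩
  have hsum1 : ∀ f, nodeSum (addMass u t.mass L) f = nodeSum L f + t.mass * f u :=
    fun f => nodeSum_addMass hs (h.utils ▸ hu) f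
  have hr0 : ∀ a ∈ r.nodes, 0 ≤ a.2 := fun a ha => (T.mass a ha).1
  have hp0 : ∀ q ∈ r.pieces, 0 ≤ q.2 := fun q hq => (T.pieces q hq).1.le
  have hmis : r.missing = 0 := by
    refine le_antisymm (not_lt.1 fun hlt => ?_) T.missing_nonneg
    have h1 : nodeSum r.nodes (fun _ => 1) = 0 :=
      nodeSum_eq_zero fun a ha => .inl (T.missing_pos hlt a ha)
    have h2 := T.sum fun _ => 1
    have h3 := hsum1 fun _ => 1
    have h4 := nodeSum_nonneg hL0 (f := fun _ => 1) fun _ => zero_le_one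
    have h5 := T.total
    linarith
  have hmass : nodeSum r.pieces (fun _ => 1) = t.mass := by
    have := T.total
    rwa [hmis, add_zero] at this
  -- the mass of utility `u` that has just been uncoupled suffices
  have hle : ∀ q ∈ r.pieces, q.1 ≤ u := by
    intro q hq
    by_contra hlt
    classical
    have h1 : nodeSum r.nodes (fun x => if x = u then 1 else 0) = 0 := by
      refine nodeSum_eq_zero fun a ha => ?_
      by_cases hau : a.1 = u
      · refine .inl (le_antisymm (not_lt.1 fun h0 => hlt ?_) (hr0 a ha))
        exact hau ▸ T.lowest q hq a ha h0
      · simp [hau]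
    have h2 := T.sum fun x => if x = u then 1 else 0
    have h3 := hsum1 fun x => if x = u then 1 else 0
    have h4 := nodeSum_nonneg hL0 (f := fun x => if x = u then 1 else 0)
      fun _ => by split <;> simp
    have h5 : nodeSum r.pieces (fun x => if x = u then 1 else 0) < nodeSum r.pieces fun _ => 1 := by
      refine nodeSum_lt_of_mem hp0 (fun a _ => ?_) hq (T.pieces q hq).1 ?_
      · split <;> simp
      · rw [if_neg fun h => hlt h.le]
        exact zero_lt_one
    simp only [if_true] at h3
    linarith
  have hge : ∀ q ∈ r.pieces, w ≤ q.1 ∧ q.1 ∈ Us := by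
    intro q hq
    obtain ⟨hq0, -, b, hb, hbq, hqb⟩ := T.pieces q hq
    refine ⟨?_, hu1 ▸ List.mem_map.2 ⟨b, hb, hbq⟩⟩
    rcases mem_addMass hb with ⟨hb, -⟩ | ⟨hb, -⟩
    · exact hbq ▸ h.level b hb (hq0.trans_le hqb)
    · exact hbq ▸ hb ▸ hw
  have hbar : ∀ a ∈ r.nodes, 0 < a.2 → ∃ b ∈ L, 0 < b.2 ∧ b.1 ≤ a.1 := by
    intro a ha h0
    by_contra! hb
    -- the taken mass and that of `a` would exceed the mass available up to the utility of `a`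
    set f : ℝ → ℝ := fun x => if x ≤ a.1 then 1 else 0 with hf
    have hf0 : ∀ x, 0 ≤ f x := fun x => by simp only [hf]; split <;> simp
    have hf1 : f u ≤ 1 := by simp only [hf]; split <;> simp
    have h1 : nodeSum L f = 0 := by
      refine nodeSum_eq_zero fun a ha => ?_
      rcases (hL0 a ha).eq_or_lt with h | h
      · exact .inl h.symm
      · exact .inr (if_neg (not_le.2 (hb a ha h)))
    have h2 : nodeSum r.pieces f = t.mass := by
      rw [← hmass]
      exact nodeSum_congr fun q hq => if_pos (T.lowest q hq a ha h0)
    have h3 : nodeSum r.nodes (fun _ => 0) < nodeSum r.nodes f :=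
      nodeSum_lt_of_mem hr0 (fun a _ => hf0 _) ha h0 (by simp [hf])
    rw [nodeSum_eq_zero fun a _ => .inr rfl] at h3
    have h4 := T.sum f
    have h5 := hsum1 f
    have h6 := mul_le_mul_of_nonneg_left hf1 hm.le
    linarith
  cases hp : r.pieces with
  | nil =>
    rw [hp] at hmass
    simp only [nodeSum_nil] at hmass
    exact absurd hmass hm.ne
  | cons q l =>
    have hpw : (r.pieces.map Prod.fst).Pairwise fun x y => y < x :=
      List.Pairwise.sublist T.sublist (hu1 ▸ hUs)
    rw [hp, List.map_cons, List.pairwise_cons] at hpw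
    have hq : q ∈ r.pieces := by simp [hp]
    rw [← hp]
    have hmax : ∀ q' ∈ r.pieces, q'.1 ≤ q.1 := by
      rw [hp]
      simp only [List.forall_mem_cons]
      exact ⟨le_rfl, fun q' hq' => (hpw.1 _ (List.mem_map_of_mem hq')).le⟩
    refine ⟨q.1, ⟨⟨T.utils.trans hu1, fun a ha => ⟨(T.mass a ha).1, (T.mass a ha).2.1⟩, ?_,
      h.sorted.of_cons, ?_, fun a ha h0 => T.lowest q hq a ha h0⟩, ?_,
      fun q hq => ⟨(T.pieces q hq).1, (hge q hq).2, hle q hq⟩, hmass,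
      fun f => by rw [T.sum, hsum1], hbar⟩⟩
    · intro t' ht'
      obtain ⟨h1, h2, h3, h4, -⟩ := h.rest t' (by simp [ht'])
      exact ⟨h1, h2, h3, h4, (hle q hq).trans ((List.pairwise_cons.1 h.sorted).1 t' ht')⟩
    · refine forall_mem_addPieces P j t (fun m m' us h1 h2 => ?_) (fun q' hq' => ?_)
        fun s hs => ?_
      · exact ⟨add_pos h1.1 h2.1, G.add_mem h1.2.1 h2.2.1, h1.2.2⟩
      · obtain ⟨h1, h2, -⟩ := T.pieces q' hq'
        refine ⟨h1, h2, by simpa using hj, ?_⟩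
        simp only [List.getD_eq_getElem?_getD, List.getElem?_set_self hj, Option.getD_some]
        exact ⟨(hge q' hq').2, hmax q' hq'⟩
      · obtain ⟨h1, h2, h3, h4, h5⟩ := h.recoupled s hs
        exact ⟨h1, h2, h3, h4, h5.trans (hge q hq).1⟩
    · rw [countP_le_eq_add Us (hge q hq).1, hp, List.length_cons]
      have h1 : (l.map Prod.fst).Sublist Us := by
        refine .trans (List.sublist_cons_self q.1 _) ?_
        have := T.sublist
        rwa [hu1, hp, List.map_cons] at this
      have h2 := h1.countP_le (p := fun u => decide (w ≤ u ∧ u < q.1))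
      rw [List.countP_eq_length.2, List.length_map] at h2
      · omega
      · intro x hx
        obtain ⟨q', hq', rfl⟩ := List.mem_map.1 hx
        simpa using ⟨(hge q' (by simp [hp, hq'])).1, hpw.1 _ (List.mem_map_of_mem hq')⟩

theorem recoupleLoop_cons {Us : List ℝ} (hUs : Us.Pairwise fun x y => y < x)
    (j : ℕ) (t : Chain) (c : List Chain) {L : List Node} (hL : L.map Prod.fst = Us)
    (done : List Chain) {r : Taken}
    (hr : r = (takeLowest P t.mass (addMass (t.utils.getD j 0) t.mass L)).val) :
    (recoupleLoop P j (t :: c) L done).val =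
      (recoupleLoop P j c r.nodes (addPieces P j t r.pieces done).val).val := by
  subst hr
  rw [recoupleLoop]
  simp only [Timed.val_bind, val_getUtil, val_restoreMass P _ _ (pairwise_of_map_fst hUs hL)]

/-- The effect of the whole recoupling of position `j`, with final nodes `L'` and chains `c'`. Since
each utility of position `j` is replaced by lower ones, integrals of functions that grow when
this utility is lowered do not decrease (`mono`). -/
structure RecoupleResult (G : AddSubgroup ℝ) (Us : List ℝ) (j : ℕ) (w : ℝ)
    (c : List Chain) (L : List Node) (done : List Chain) (L' : List Node) (c' : List Chain) :
    Prop where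
  inv : ∃ w', RecoupleInv G Us j w' [] L' c'
  length : c'.length ≤ done.length + c.length + Us.countP (fun u => decide (w ≤ u))
  sum : ∀ f, nodeSum L' f + chainSum c' (fun us => f (us.getD j 0)) =
    nodeSum L f + chainSum c (fun us => f (us.getD j 0)) + chainSum done (fun us => f (us.getD j 0))
  mono : ∀ g : List ℝ → ℝ,
    (∀ t ∈ c, ∀ x ∈ Us, x ≤ t.utils.getD j 0 → g t.utils ≤ g (t.utils.set j x)) →
    chainSum c g + chainSum done g ≤ chainSum c' g
  forall_chain : ∀ Q : List ℝ → Prop,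
    (∀ t ∈ c, ∀ x ∈ Us, x ≤ t.utils.getD j 0 → Q (t.utils.set j x)) → (∀ t ∈ done, Q t.utils) →
    ∀ t ∈ c', Q t.utils
  barrier : ∀ a ∈ L', 0 < a.2 → ∃ b ∈ L, 0 < b.2 ∧ b.1 ≤ a.1

theorem recoupleLoop_result {G : AddSubgroup ℝ} {Us : List ℝ}
    (hUs : Us.Pairwise fun x y => y < x) {j : ℕ} {w : ℝ} {c : List Chain} {L : List Node}
    {done : List Chain} (h : RecoupleInv G Us j w c L done) :
    RecoupleResult G Us j w c L done (recoupleLoop P j c L done).val.1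
      (recoupleLoop P j c L done).val.2 := by
  induction c generalizing w L done with
  | nil =>
    exact ⟨⟨w, h⟩, by simp [recoupleLoop], fun f => by simp [recoupleLoop],
      fun g _ => by simp [recoupleLoop], fun Q _ hQ => hQ,
      fun a ha h0 => ⟨a, ha, h0, le_rfl⟩⟩
  | cons t c ih =>
    obtain ⟨r, hr⟩ : ∃ r, r = (takeLowest P t.mass (addMass (t.utils.getD j 0) t.mass L)).val :=
      ⟨_, rfl⟩
    rw [recoupleLoop_cons P hUs j t c h.utils done hr]
    obtain ⟨-, w', S⟩ := recouple_step P hUs h hr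
    have IH := ih S.inv
    obtain ⟨hm, -, hj, -, -⟩ := h.rest t (by simp)
    have hp0 : ∀ q ∈ r.pieces, 0 ≤ q.2 := fun q hq => (S.piece q hq).1.le
    refine ⟨IH.inv, ?_, fun f => ?_, fun g hg => ?_, fun Q hQ hd => ?_,
      fun a ha h0 => ?_⟩
    · have h1 := IH.length
      have h2 := S.length
      have h3 := length_addPieces P j t r.pieces done
      simp only [List.length_cons]
      omega
    · rw [IH.sum, chainSum_addPieces, chainSum_cons]
      have h1 := S.sum f
      have h2 : nodeSum r.pieces (fun x => f ((t.utils.set j x).getD j 0)) = nodeSum r.pieces f :=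
        nodeSum_congr fun q _ => by simp [List.getD_eq_getElem?_getD, List.getElem?_set_self hj]
      linarith
    · refine le_trans ?_ (IH.mono g fun t' ht' => hg t' (by simp [ht']))
      rw [chainSum_addPieces, chainSum_cons]
      have h1 : nodeSum r.pieces (fun _ => g t.utils) ≤
          nodeSum r.pieces (fun x => g (t.utils.set j x)) :=
        nodeSum_le_of_forall hp0 fun q hq =>
          hg t (by simp) q.1 (S.piece q hq).2.1 (S.piece q hq).2.2
      have h2 : nodeSum r.pieces (fun _ => g t.utils) = t.mass * g t.utils := by
        rw [← S.mass]
        simp [nodeSum, List.sum_map_mul_right]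
      linarith
    · refine IH.forall_chain Q (fun t' ht' => hQ t' (by simp [ht'])) ?_
      exact forall_mem_addPieces P j t (Q := fun s => Q s.utils) (fun _ _ _ h _ => h)
        (fun q hq => hQ t (by simp) q.1 (S.piece q hq).2.1 (S.piece q hq).2.2) hd
    · obtain ⟨b, hb, hb0, hba⟩ := IH.barrier a ha h0
      obtain ⟨b', hb', hb0', hbb⟩ := S.barrier b hb hb0
      exact ⟨b', hb', hb0', hbb.trans hba⟩

/-! ### Invariants of the coupling -/

/-- The properties of the relation "utility `x` of position `i` is dominated by utility `y` of
position `j`" on the positions `0, …, n`: it is a strict linear order of the pairs of a position and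
a utility, which refines the order of the utilities. -/
structure IsDomOrder (n : ℕ) (dom : ℕ → ℝ → ℕ → ℝ → Prop) : Prop where
  trans : ∀ {i j k x y z}, dom i x j y → dom j y k z → dom i x k z
  same : ∀ {i x y}, i ≤ n → (dom i x i y ↔ x < y)
  total : ∀ {i j}, i ≤ n → j ≤ n → i ≠ j → ∀ x y, dom i x j y ∨ dom j y i x

theorem IsDomOrder.asymm {n : ℕ} {dom : ℕ → ℝ → ℕ → ℝ → Prop} (h : IsDomOrder n dom) {i j : ℕ}
    {x y : ℝ} (hi : i ≤ n) (hxy : dom i x j y) : ¬ dom j y i x := fun hyx =>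
  lt_irrefl x ((h.same hi).1 (h.trans hxy hyx))

theorem IsDomOrder.mono_left {n : ℕ} {dom : ℕ → ℝ → ℕ → ℝ → Prop} (h : IsDomOrder n dom) {i j : ℕ}
    {x x' y : ℝ} (hi : i ≤ n) (hx : x' ≤ x) (hxy : dom i x j y) : dom i x' j y := by
  rcases hx.eq_or_lt with rfl | hx
  · exact hxy
  · exact h.trans ((h.same hi).2 hx) hxy

theorem IsDomOrder.mono_right {n : ℕ} {dom : ℕ → ℝ → ℕ → ℝ → Prop} (h : IsDomOrder n dom)
    {i j : ℕ} {x y y' : ℝ} (hj : j ≤ n) (hy : y ≤ y') (hxy : dom i x j y) : dom i x j y' := by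
  rcases hy.eq_or_lt with rfl | hy
  · exact hxy
  · exact h.trans hxy ((h.same hj).2 hy)

/-- Sorted lists of nodes for the positions `0, …, n`, the masses of each position adding up to `1`
and lying in the additive subgroup `G`. -/
structure IsPrepared (G : AddSubgroup ℝ) (n : ℕ) (Ls : List (List Node)) : Prop where
  length : Ls.length = n + 1
  sorted : ∀ j, (Ls.getD j []).Pairwise fun x y => y.1 < x.1
  mass : ∀ j, ∀ a ∈ Ls.getD j [], 0 ≤ a.2 ∧ a.2 ∈ G
  total : ∀ j ≤ n, nodeSum (Ls.getD j []) (fun _ => 1) = 1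

/-- The state `s` partitions the masses of the prepared nodes `Ls` into uncoupled masses and masses
of chains. -/
structure StateInv (G : AddSubgroup ℝ) (n : ℕ) (Ls : List (List Node)) (s : State) : Prop where
  length : s.nodes.length = n + 1
  utils : ∀ j, (s.nodes.getD j []).map Prod.fst = (Ls.getD j []).map Prod.fst
  mass : ∀ j, ∀ a ∈ s.nodes.getD j [], 0 ≤ a.2 ∧ a.2 ∈ G
  chain : ∀ t ∈ s.chains, 0 < t.mass ∧ t.mass ∈ G ∧ t.utils.length = n + 1 ∧
    ∀ j ≤ n, t.utils.getD j 0 ∈ (Ls.getD j []).map Prod.fst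
  conserve : ∀ j ≤ n, ∀ f, nodeSum (s.nodes.getD j []) f +
    chainSum s.chains (fun us => f (us.getD j 0)) = nodeSum (Ls.getD j []) f

/-- Utility `u` of position `j` has uncoupled mass. -/
def HasMass (s : State) (j : ℕ) (u : ℝ) : Prop :=
  ∃ r, 0 < r ∧ (u, r) ∈ s.nodes.getD j []

theorem hasMass_of_mem {s : State} {j : ℕ} {a : Node} (ha : a ∈ s.nodes.getD j []) (h : 0 < a.2) :
    HasMass s j a.1 := ⟨a.2, h, ha⟩

section StateInv

variable {G : AddSubgroup ℝ} {n : ℕ} {Ls : List (List Node)} {s : State}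

theorem StateInv.sorted (hs : StateInv G n Ls s) (hLs : IsPrepared G n Ls) (j : ℕ) :
    (s.nodes.getD j []).Pairwise fun x y => y.1 < x.1 :=
  pairwise_of_map_fst (List.pairwise_map.2 (hLs.sorted j)) (hs.utils j)

theorem StateInv.mem_utils (hs : StateInv G n Ls s) {j : ℕ} {u : ℝ} (h : HasMass s j u) :
    u ∈ (Ls.getD j []).map Prod.fst := by
  obtain ⟨r, -, hr⟩ := h
  rw [← hs.utils j]
  exact List.mem_map.2 ⟨_, hr, rfl⟩

theorem StateInv.chain_nonneg (hs : StateInv G n Ls s) : ∀ t ∈ s.chains, 0 ≤ t.mass :=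
  fun t ht => (hs.chain t ht).1.le

theorem StateInv.nodeSum_eq_zero_of_forall_not (hs : StateInv G n Ls s) {j : ℕ} {f : ℝ → ℝ}
    (h : ∀ u, HasMass s j u → f u = 0) : nodeSum (s.nodes.getD j []) f = 0 := by
  refine nodeSum_eq_zero fun a ha => ?_
  rcases (hs.mass j a ha).1.eq_or_lt with h0 | h0
  · exact .inl h0.symm
  · exact .inr (h _ (hasMass_of_mem ha h0))

/-- As all positions have the same uncoupled mass, either all of them are exhausted or none. -/
theorem StateInv.not_hasMass (hs : StateInv G n Ls s) (hLs : IsPrepared G n Ls) {j : ℕ}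
    (hj : j ≤ n) (h : ∀ u, ¬ HasMass s j u) {k : ℕ} (hk : k ≤ n) (u : ℝ) : ¬ HasMass s k u := by
  rintro ⟨r, hr, hm⟩
  have h1 := hs.conserve j hj fun _ => 1
  rw [hs.nodeSum_eq_zero_of_forall_not fun u hu => absurd hu (h u), hLs.total j hj] at h1
  have h2 := hs.conserve k hk fun _ => 1
  rw [hLs.total k hk] at h2
  have h3 := mass_le_nodeSum (fun a ha => (hs.mass k a ha).1) hm
  simp only at h3
  linarith

theorem StateInv.chainSum_eq_one (hs : StateInv G n Ls s) (hLs : IsPrepared G n Ls)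
    (h : ∀ u, ¬ HasMass s 0 u) : chainSum s.chains (fun _ => 1) = 1 := by
  have h1 := hs.conserve 0 (Nat.zero_le n) fun _ => 1
  rwa [hs.nodeSum_eq_zero_of_forall_not fun u hu => absurd hu (h u), hLs.total 0 (Nat.zero_le n),
    zero_add] at h1

end StateInv

/-- Utility `x` of position `k` is dominated by all uncoupled mass of some position `j ≥ i`. -/
def Barred (n : ℕ) (dom : ℕ → ℝ → ℕ → ℝ → Prop) (pos : ℕ → ℝ → Prop) (i k : ℕ) (x : ℝ) : Prop :=
  ∃ j, i ≤ j ∧ j ≤ n ∧ ∀ b, pos j b → dom k x j b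

/-- The invariant of a chain with utilities `us`, when `pos j b` says that utility `b` of position
`j` has uncoupled mass, the positions up to `i` have been recoupled, and barring is meant with
respect to the positions from `i'` on. The chain has been created for some position `k ≤ i`, whose
utility dominates those of all later positions. At a position after `i`, its utility is at least
every uncoupled one that `k` dominates; at a position between `k` and `i`, it is at most every
uncoupled one; at a position before `k`, it is barred. -/
def ChainInv (n : ℕ) (dom : ℕ → ℝ → ℕ → ℝ → Prop) (pos : ℕ → ℝ → Prop) (i i' : ℕ) (us : List ℝ) :
    Prop :=
  ∃ k ≤ i, (∀ j, k < j → j ≤ n → dom j (us.getD j 0) k (us.getD k 0)) ∧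
    (∀ j, i < j → j ≤ n → ∀ b, pos j b → dom j b k (us.getD k 0) → b ≤ us.getD j 0) ∧
    (∀ j, k < j → j ≤ i → ∀ b, pos j b → us.getD j 0 ≤ b) ∧
    ∀ j, j < k → Barred n dom pos i' j (us.getD j 0)

/-- The invariant of the coupling `c`: every chain satisfies its invariant, and all uncoupled mass
of the positions before `i'` is barred. While position `i` is being filled, it holds with `i' = i`,
and from then on with `i' = i + 1`. -/
structure PhaseInv (n : ℕ) (dom : ℕ → ℝ → ℕ → ℝ → Prop) (i i' : ℕ) (pos : ℕ → ℝ → Prop)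
    (c : List Chain) : Prop where
  chain : ∀ t ∈ c, ChainInv n dom pos i i' t.utils
  node : ∀ k < i', ∀ x, pos k x → Barred n dom pos i' k x

section PhaseInv

variable {n : ℕ} {dom : ℕ → ℝ → ℕ → ℝ → Prop} {pos pos' : ℕ → ℝ → Prop} {i i' : ℕ}

theorem Barred.mono (h : ∀ j u, pos' j u → pos j u) {k : ℕ} {x : ℝ}
    (hb : Barred n dom pos i k x) : Barred n dom pos' i k x := by
  obtain ⟨j, h1, h2, h3⟩ := hb
  exact ⟨j, h1, h2, fun b hb => h3 b (h j b hb)⟩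

theorem ChainInv.mono (h : ∀ j u, pos' j u → pos j u) {us : List ℝ}
    (hc : ChainInv n dom pos i i' us) : ChainInv n dom pos' i i' us := by
  obtain ⟨k, hk, h1, h2, h3, h4⟩ := hc
  exact ⟨k, hk, h1, fun j hj hjn b hb => h2 j hj hjn b (h j b hb),
    fun j hj hji b hb => h3 j hj hji b (h j b hb), fun j hj => (h4 j hj).mono h⟩

end PhaseInv

/-! ### Filling one position -/

/-- The number of nodes with uncoupled mass. -/
noncomputable def massCount (n : ℕ) (s : State) : ℕ :=
  ∑ j ∈ Finset.range (n + 1), (s.nodes.getD j []).countP fun a => decide (0 < a.2)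

theorem countP_lt_countP {α : Type} {p q : α → Bool} {l : List α} (h : ∀ a ∈ l, p a → q a)
    {a : α} (ha : a ∈ l) (hq : q a) (hp : ¬ p a) : l.countP p < l.countP q := by
  induction l with
  | nil => simp at ha
  | cons b l ih =>
    have hl : l.countP p ≤ l.countP q := List.countP_mono_left fun x hx => h x (by simp [hx])
    rw [List.countP_cons, List.countP_cons]
    rcases List.mem_cons.1 ha with rfl | ha
    · simp only [hq, hp, if_true]
      simp
      omega
    · have := ih (fun x hx => h x (by simp [hx])) ha
      have hb := h b (by simp)
      split
      · rename_i hpb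
        simp only [hb hpb, if_true]
        omega
      · omega

theorem eq_of_fst_eq {L : List Node} (hL : L.Pairwise fun x y => y.1 < x.1) {a b : Node}
    (ha : a ∈ L) (hb : b ∈ L) (h : a.1 = b.1) : a = b :=
  List.inj_on_of_nodup_map (f := Prod.fst)
    (List.pairwise_map.2 (hL.imp fun hxy => hxy.ne')) ha hb h

/-- Taking the mass `m` away from a node `b` that has it. -/
theorem addMass_neg_spec {G : AddSubgroup ℝ} {L : List Node}
    (hs : L.Pairwise fun x y => y.1 < x.1) (hL : ∀ a ∈ L, 0 ≤ a.2 ∧ a.2 ∈ G) {b : Node}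
    (hb : b ∈ L) {m : ℝ} (hm : 0 ≤ m) (hmG : m ∈ G) (hmb : m ≤ b.2) :
    (∀ a ∈ addMass b.1 (-m) L, 0 ≤ a.2 ∧ a.2 ∈ G) ∧
      ∀ a ∈ addMass b.1 (-m) L, 0 < a.2 → ∃ a' ∈ L, a'.1 = a.1 ∧ 0 < a'.2 := by
  constructor
  · intro a ha
    rcases mem_addMass ha with ⟨ha, -⟩ | ⟨hab, ha⟩
    · exact hL a ha
    · have := eq_of_fst_eq hs ha hb rfl
      have h2 : b.2 = a.2 - -m := by rw [← this]
      refine ⟨by linarith, ?_⟩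
      have : a.2 = b.2 - m := by linarith
      rw [this]
      exact G.sub_mem (hL b hb).2 hmG
  · intro a ha h0
    rcases mem_addMass ha with ⟨ha, -⟩ | ⟨hab, ha⟩
    · exact ⟨a, ha, rfl, h0⟩
    · exact ⟨_, ha, hab.symm, by simp only; linarith⟩

theorem countP_addMass_neg_le (u : ℝ) {m : ℝ} (hm : 0 ≤ m) (L : List Node) :
    (addMass u (-m) L).countP (fun a => decide (0 < a.2)) ≤
      L.countP fun a => decide (0 < a.2) := by
  rw [addMass, List.countP_map]
  refine List.countP_mono_left fun a _ h => ?_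
  simp only [Function.comp, decide_eq_true_eq] at h ⊢
  split at h
  · simp only at h
    linarith
  · exact h

theorem countP_addMass_neg_lt {b : Node} {L : List Node} (hb : b ∈ L) (h0 : 0 < b.2) :
    (addMass b.1 (-b.2) L).countP (fun a => decide (0 < a.2)) <
      L.countP fun a => decide (0 < a.2) := by
  rw [addMass, List.countP_map]
  refine countP_lt_countP (fun a _ h => ?_) hb (by simpa using h0) ?_
  · simp only [Function.comp, decide_eq_true_eq] at h ⊢
    split at h
    · simp only at h
      linarith
    · exact h
  · simp

/-- Utility `a` of position `i` is exhausted, or cannot be used for a further chain. -/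
def Blocked (n : ℕ) (dom : ℕ → ℝ → ℕ → ℝ → Prop) (pos : ℕ → ℝ → Prop) (i : ℕ) (a : ℝ) : Prop :=
  pos i a → (∃ j < i, ∀ u, ¬ pos j u) ∨ ∃ j, i < j ∧ j ≤ n ∧ ∀ u, pos j u → ¬ dom j u i a

theorem Blocked.mono {n : ℕ} {dom : ℕ → ℝ → ℕ → ℝ → Prop} {pos pos' : ℕ → ℝ → Prop} {i : ℕ}
    {a : ℝ} (h : ∀ j u, pos' j u → pos j u) (hb : Blocked n dom pos i a) :
    Blocked n dom pos' i a := by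
  intro ha
  rcases hb (h i a ha) with ⟨j, hj, hu⟩ | ⟨j, hj, hjn, hu⟩
  · exact .inl ⟨j, hj, fun u hu' => hu u (h j u hu')⟩
  · exact .inr ⟨j, hj, hjn, fun u hu' => hu u (h j u hu')⟩

/-- The state `s'` arises from `s` by adding chains, at most `N`, that are created for position
`i`. -/
structure FillResult (P : Params) (G : AddSubgroup ℝ) (n : ℕ) (Ls : List (List Node)) (i N : ℕ)
    (s s' : State) : Prop where
  inv : StateInv G n Ls s'
  phase : PhaseInv n P.dom i i (HasMass s') s'.chains
  shrink : ∀ j u, HasMass s' j u → HasMass s j u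
  count : massCount n s' ≤ massCount n s
  mono : ∀ g : List ℝ → ℝ, (∀ us, 0 ≤ g us) → chainSum s.chains g ≤ chainSum s'.chains g
  length : s'.chains.length ≤ s.chains.length + N

section Fill

variable (P : Params) {G : AddSubgroup ℝ} {n : ℕ} {Ls : List (List Node)}

theorem FillResult.trans {P : Params} {i N N' : ℕ} {s s' s'' : State}
    (h : FillResult P G n Ls i N s s') (h' : FillResult P G n Ls i N' s' s'') :
    FillResult P G n Ls i (N + N') s s'' where
  inv := h'.inv
  phase := h'.phase
  shrink j u hu := h.shrink j u (h'.shrink j u hu)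
  count := h'.count.trans h.count
  mono g hg := (h.mono g hg).trans (h'.mono g hg)
  length := by have := h.length; have := h'.length; omega

theorem FillResult.refl {P : Params} {i N : ℕ} {s : State} (hs : StateInv G n Ls s)
    (hp : PhaseInv n P.dom i i (HasMass s) s.chains) : FillResult P G n Ls i N s s :=
  ⟨hs, hp, fun _ _ h => h, le_rfl, fun _ _ => le_rfl, by omega⟩

/-- One more chain: the nodes `bs` are those selected for utility `a` of position `i`. -/
theorem fill_step {s : State} (hLs : IsPrepared G n Ls) (hs : StateInv G n Ls s) {i : ℕ} {a : ℝ}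
    (hi : i ≤ n) (hp : PhaseInv n P.dom i i (HasMass s) s.chains) {x : Node} {xs : List Node}
    (hlen : (x :: xs).length = s.nodes.length)
    (hbs : ∀ r, ∀ (h : r < s.nodes.length) (h' : r < (x :: xs).length),
      Suitable P i a (0 + r) s.nodes[r] (x :: xs)[r])
    {m : ℝ} (hm : m = (lowestMass P x.2 xs).val) {s' : State}
    (hs' : s' = ⟨(splitNodes P m (x :: xs) s.nodes).val.1,
      ⟨m, (splitNodes P m (x :: xs) s.nodes).val.2⟩ :: s.chains⟩) :
    FillResult P G n Ls i 1 s s' ∧ massCount n s' < massCount n s := by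
  set bs := x :: xs with hbsdef
  have hlen' : bs.length = n + 1 := hlen.trans hs.length
  have hsuit : ∀ j ≤ n, Suitable P i a j (s.nodes.getD j []) (bs.getD j (0, 0)) := by
    intro j hj
    have h1 : j < s.nodes.length := by rw [hs.length]; omega
    have h2 : j < bs.length := by omega
    have := hbs j h1 h2
    rwa [zero_add, ← List.getD_eq_getElem _ [] h1, ← List.getD_eq_getElem _ (0, 0) h2] at this
  have hsplit := val_splitNodes P m hlen fun L hL => by
    obtain ⟨j, hj, rfl⟩ := List.getElem_of_mem hL
    rw [← List.getD_eq_getElem _ []]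
    exact hs.sorted hLs j
  have hN : ∀ j ≤ n, s'.nodes.getD j [] =
      addMass (bs.getD j (0, 0)).1 (-m) (s.nodes.getD j []) := by
    intro j hj
    have h1 : j < s.nodes.length := by rw [hs.length]; omega
    have h2 : j < bs.length := by omega
    rw [hs', hsplit]
    simp only
    rw [List.getD_eq_getElem _ _ (by simp [List.length_zipWith]; omega), List.getElem_zipWith,
      List.getD_eq_getElem _ _ h1, List.getD_eq_getElem _ _ h2]
  have hlens : s'.nodes.length = n + 1 := by
    rw [hs', hsplit]
    simp [List.length_zipWith, hlen', hs.length]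
  have hN' : ∀ j, n < j → s'.nodes.getD j [] = [] ∧ s.nodes.getD j [] = [] := fun j hj =>
    ⟨List.getD_eq_default _ _ (by omega), List.getD_eq_default _ _ (by have := hs.length; omega)⟩
  have hchains : s'.chains = ⟨m, bs.map Prod.fst⟩ :: s.chains := by rw [hs', hsplit]
  have hu : ∀ j ≤ n, (bs.map Prod.fst).getD j 0 = (bs.getD j (0, 0)).1 := by
    intro j hj
    have h2 : j < bs.length := by omega
    rw [List.getD_eq_getElem _ _ (by simpa using h2), List.getD_eq_getElem _ _ h2,
      List.getElem_map]
  obtain ⟨hm1, hm2, hm3⟩ := val_lowestMass P x.2 xs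
  rw [← hm] at hm1 hm2 hm3
  have hmle : ∀ j ≤ n, m ≤ (bs.getD j (0, 0)).2 := by
    intro j hj
    have h2 : j < bs.length := by omega
    rw [List.getD_eq_getElem _ _ h2]
    have : ∀ b ∈ bs, m ≤ b.2 := by
      rw [hbsdef, List.forall_mem_cons]
      exact ⟨hm1, hm2⟩
    exact this _ (List.getElem_mem h2)
  obtain ⟨j₀, hj₀, hmj₀⟩ : ∃ j ≤ n, m = (bs.getD j (0, 0)).2 := by
    have : ∃ b ∈ bs, m = b.2 := by
      rcases hm3 with h | ⟨b, hb, h⟩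
      · exact ⟨x, by simp [hbsdef], h⟩
      · exact ⟨b, by simp [hbsdef, hb], h⟩
    obtain ⟨b, hb, h⟩ := this
    obtain ⟨j, hj, rfl⟩ := List.getElem_of_mem hb
    exact ⟨j, by omega, by rw [List.getD_eq_getElem _ _ hj]; exact h⟩
  have hm0 : 0 < m := hmj₀ ▸ (hsuit j₀ hj₀).pos
  have hmG : m ∈ G := hmj₀ ▸ (hs.mass j₀ _ (hsuit j₀ hj₀).mem).2
  have hspec := fun j hj => addMass_neg_spec (hs.sorted hLs j) (hs.mass j) (hsuit j hj).mem hm0.le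
    hmG (hmle j hj)
  have hmem : ∀ j ≤ n, (bs.getD j (0, 0)).1 ∈ (Ls.getD j []).map Prod.fst := fun j hj => by
    rw [← hs.utils j]
    exact List.mem_map_of_mem (hsuit j hj).mem
  have hshrink : ∀ j u, HasMass s' j u → HasMass s j u := by
    rintro j u ⟨r, hr, hmr⟩
    rcases le_or_gt j n with hj | hj
    · rw [hN j hj] at hmr
      obtain ⟨a', ha', h1, h2⟩ := (hspec j hj).2 _ hmr hr
      have h1' : a'.1 = u := h1
      exact ⟨a'.2, h2, by rw [← h1']; exact ha'⟩
    · rw [(hN' j hj).1] at hmr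
      simp at hmr
  have hcount : massCount n s' < massCount n s := by
    refine Finset.sum_lt_sum (fun j hj => ?_) ⟨j₀, by simp; omega, ?_⟩
    · rw [hN j (by simp at hj; omega)]
      exact countP_addMass_neg_le _ hm0.le _
    · rw [hN j₀ hj₀, hmj₀]
      exact countP_addMass_neg_lt (hsuit j₀ hj₀).mem (hsuit j₀ hj₀).pos
  refine ⟨⟨⟨hlens, fun j => ?_, fun j => ?_, ?_, fun j hj f => ?_⟩, ⟨?_, fun k hk y hy => ?_⟩,
    hshrink, hcount.le, fun g hg => ?_, by simp [hchains]⟩, hcount⟩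
  · rcases le_or_gt j n with hj | hj
    · rw [hN j hj, map_fst_addMass, hs.utils]
    · rw [(hN' j hj).1, ← hs.utils j, (hN' j hj).2]
  · rcases le_or_gt j n with hj | hj
    · rw [hN j hj]
      exact (hspec j hj).1
    · rw [(hN' j hj).1]
      simp
  · rw [hchains, List.forall_mem_cons]
    exact ⟨⟨hm0, hmG, by simpa using hlen', fun j hj => by rw [hu j hj]; exact hmem j hj⟩, hs.chain⟩
  · rw [hN j hj, hchains, chainSum_cons, nodeSum_addMass (hs.sorted hLs j)
      (List.mem_map_of_mem (hsuit j hj).mem), hu j hj, ← hs.conserve j hj f]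
    ring
  · rw [hchains, List.forall_mem_cons]
    refine ⟨⟨i, le_rfl, fun j hij hj => ?_, fun j hij hj b hb hd => ?_, fun j h1 h2 => by omega,
      fun j hj => ?_⟩, fun t ht => (hp.chain t ht).mono hshrink⟩
    · rw [hu j hj, hu i hi, (hsuit i hi).eq rfl]
      exact (hsuit j hj).dom hij
    · obtain ⟨r, hr, hmr⟩ := hshrink j b hb
      rw [hu i hi, (hsuit i hi).eq rfl] at hd
      rw [hu j hj]
      exact (hsuit j hj).highest hij _ hmr hr hd
    · have hjn : j ≤ n := by omega
      rw [hu j hjn]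
      exact (hp.node j hj _ (hasMass_of_mem (hsuit j hjn).mem (hsuit j hjn).pos)).mono hshrink
  · exact (hp.node k hk y (hshrink k y hy)).mono hshrink
  · rw [hchains, chainSum_cons]
    have := mul_nonneg hm0.le (hg (bs.map Prod.fst))
    simp only
    linarith

theorem fillLoop_result (hP : IsChoice P.pick) (hLs : IsPrepared G n Ls) {i : ℕ} (hi : i ≤ n)
    (a : ℝ) (b : ℕ) {s : State} (hs : StateInv G n Ls s)
    (hp : PhaseInv n P.dom i i (HasMass s) s.chains) :
    FillResult P G n Ls i b s (fillLoop P i a b s).val ∧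
      (massCount n s < b → Blocked n P.dom (HasMass (fillLoop P i a b s).val) i a) := by
  induction b generalizing s with
  | zero => exact ⟨.refl hs hp, fun h => absurd h (Nat.not_lt_zero _)⟩
  | succ b ih =>
    rw [fillLoop]
    simp only [Timed.val_bind]
    have hsort : ∀ L ∈ s.nodes, L.Pairwise fun x y => y.1 ≤ x.1 := fun L hL => by
      obtain ⟨j, hj, rfl⟩ := List.getElem_of_mem hL
      rw [← List.getD_eq_getElem _ []]
      exact (hs.sorted hLs j).imp le_of_lt
    rcases val_selectNodes P hP s.chains i a 0 hsort with ⟨bs, hlen, hbs, h⟩ | ⟨h, r, hr, hun⟩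
    · rw [h]
      match bs, hlen, hbs with
      | [], hlen, _ =>
        have := hs.length
        simp at hlen
        omega
      | x :: xs, hlen, hbs =>
        simp only [Timed.val_bind]
        obtain ⟨h1, h2⟩ := fill_step P hLs hs hi hp hlen hbs rfl rfl
        obtain ⟨h3, h4⟩ := ih h1.inv h1.phase
        have := h1.trans h3
        rw [add_comm] at this
        exact ⟨this, fun hb => h4 (by omega)⟩
    · rw [h]
      refine ⟨.refl hs hp, fun _ ha => ?_⟩
      rw [zero_add, ← List.getD_eq_getElem _ [] hr] at hun
      have hr' : r ≤ n := by have := hs.length; omega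
      rcases lt_trichotomy r i with hri | hri | hri
      · refine .inl ⟨r, hri, ?_⟩
        rintro u ⟨y, hy, hmy⟩
        exact (hun _ hmy hy).1 hri
      · subst hri
        obtain ⟨y, hy, hmy⟩ := ha
        exact absurd rfl ((hun _ hmy hy).2.1 rfl)
      · refine .inr ⟨r, hri, hr', ?_⟩
        rintro u ⟨y, hy, hmy⟩
        exact (hun _ hmy hy).2.2 hri

theorem fillAll_result (hP : IsChoice P.pick) (hLs : IsPrepared G n Ls) {i : ℕ} (hi : i ≤ n)
    (b : ℕ) (l : List Node) {s : State} (hs : StateInv G n Ls s)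
    (hp : PhaseInv n P.dom i i (HasMass s) s.chains) :
    FillResult P G n Ls i (l.length * b) s (fillAll P i b l s).val ∧
      (massCount n s < b →
        ∀ a ∈ l, Blocked n P.dom (HasMass (fillAll P i b l s).val) i a.1) := by
  induction l generalizing s with
  | nil => exact ⟨.refl hs hp, by simp⟩
  | cons a l ih =>
    rw [fillAll]
    simp only [Timed.val_bind]
    obtain ⟨h1, h2⟩ := fillLoop_result P hP hLs hi a.1 b hs hp
    obtain ⟨h3, h4⟩ := ih h1.inv h1.phase
    refine ⟨?_, fun hb => ?_⟩
    · have := h1.trans h3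
      rwa [List.length_cons, add_mul, one_mul, add_comm]
    · rw [List.forall_mem_cons]
      exact ⟨(h2 hb).mono h3.shrink, h4 (h1.count.trans_lt hb)⟩

end Fill

/-! ### From one position to the next -/

section Transition

variable {G : AddSubgroup ℝ} {n : ℕ} {Ls : List (List Node)} {dom : ℕ → ℝ → ℕ → ℝ → Prop}

/-- Once position `i < n` has been filled, whatever is barred by the positions from `i` on is barred
by the positions after `i`: mass of position `i` that is still uncoupled is barred itself. -/
theorem phaseInv_of_blocked (hdom : IsDomOrder n dom) (hLs : IsPrepared G n Ls) {s : State}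
    (hs : StateInv G n Ls s) {i : ℕ} (hi : i < n) (hp : PhaseInv n dom i i (HasMass s) s.chains)
    (hb : ∀ a, Blocked n dom (HasMass s) i a) : PhaseInv n dom i (i + 1) (HasMass s) s.chains := by
  have hbar : ∀ a, HasMass s i a → Barred n dom (HasMass s) (i + 1) i a := by
    intro a ha
    rcases hb a ha with ⟨j, hj, h⟩ | ⟨j, hj, hjn, h⟩
    · exact absurd ha (hs.not_hasMass hLs (by omega) h hi.le a)
    · exact ⟨j, hj, hjn, fun b hb => (hdom.total hi.le hjn hj.ne a b).resolve_right (h b hb)⟩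
  have hstep : ∀ k x, Barred n dom (HasMass s) i k x → Barred n dom (HasMass s) (i + 1) k x := by
    rintro k x ⟨j, hj, hjn, h⟩
    rcases hj.eq_or_lt with rfl | hj
    · by_cases he : ∃ a, HasMass s i a
      · obtain ⟨a, ha⟩ := he
        obtain ⟨j', hj', hjn', h'⟩ := hbar a ha
        exact ⟨j', hj', hjn', fun b hb => hdom.trans (h a ha) (h' b hb)⟩
      · -- if position `i` is exhausted, so are all others
        push Not at he
        exact ⟨n, hi, le_rfl, fun b hb => absurd hb (hs.not_hasMass hLs hjn he le_rfl b)⟩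
    · exact ⟨j, hj, hjn, h⟩
  refine ⟨fun t ht => ?_, fun k hk x hx => ?_⟩
  · obtain ⟨k, hk, h1, h2, h3, h4⟩ := hp.chain t ht
    exact ⟨k, hk, h1, h2, h3, fun j hj => hstep _ _ (h4 j hj)⟩
  · rcases (Nat.lt_succ_iff.1 hk).eq_or_lt with rfl | hk
    · exact hbar x hx
    · exact hstep k x (hp.node k hk x hx)

/-- In a chain with utilities `us`, some position up to `i` dominates all positions after `i`, so
that the buyer purchases one of the positions up to `i`. -/
def BuysUpTo (n : ℕ) (dom : ℕ → ℝ → ℕ → ℝ → Prop) (i : ℕ) (us : List ℝ) : Prop :=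
  ∃ k ≤ i, ∀ j, i < j → j ≤ n → dom j (us.getD j 0) k (us.getD k 0)

open Classical in
/-- The indicator function of a property of the utilities of a chain. -/
noncomputable def indicatorOf {α : Type*} (p : α → Prop) (x : α) : ℝ := if p x then 1 else 0

theorem indicatorOf_nonneg {α : Type*} (p : α → Prop) (x : α) : 0 ≤ indicatorOf p x := by
  unfold indicatorOf
  split <;> simp

theorem indicatorOf_le_one {α : Type*} (p : α → Prop) (x : α) : indicatorOf p x ≤ 1 := by
  unfold indicatorOf
  split <;> simp

theorem indicatorOf_pos {α : Type*} {p : α → Prop} {x : α} (h : p x) : indicatorOf p x = 1 :=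
  if_pos h

theorem indicatorOf_neg {α : Type*} {p : α → Prop} {x : α} (h : ¬ p x) : indicatorOf p x = 0 :=
  if_neg h

theorem getD_set_ne (us : List ℝ) {j k : ℕ} (h : j ≠ k) (x : ℝ) :
    (us.set k x).getD j 0 = us.getD j 0 := by
  simp [List.getD_eq_getElem?_getD, List.getElem?_set_ne h.symm]

theorem getD_set_self {us : List ℝ} {j : ℕ} (h : j < us.length) (x : ℝ) :
    (us.set j x).getD j 0 = x := by
  simp [List.getD_eq_getElem?_getD, List.getElem?_set_self h]

/-- Lowering the utility of a position after `i` does not make the buyer leave the positions up to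
`i`. -/
theorem BuysUpTo.set (hdom : IsDomOrder n dom) {i j : ℕ} (hij : i < j) {us : List ℝ}
    (hj : j < us.length) {x : ℝ} (hx : x ≤ us.getD j 0) (h : BuysUpTo n dom i us) :
    BuysUpTo n dom i (us.set j x) := by
  obtain ⟨k, hk, h⟩ := h
  refine ⟨k, hk, fun j' hj' hjn => ?_⟩
  rw [getD_set_ne us (by omega : k ≠ j)]
  by_cases hjj : j' = j
  · subst hjj
    rw [getD_set_self hj]
    exact hdom.mono_left hjn hx (h j' hj' hjn)
  · rw [getD_set_ne us hjj]
    exact h j' hj' hjn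

variable (P : Params)

/-- Sorting the chains establishes the invariant of the recoupling loop, at any level `w` below all
utilities of the position. -/
theorem recoupleInv_sort {s : State} (hs : StateInv G n Ls s) {j : ℕ} (hj : j ≤ n) :
    ∃ w, RecoupleInv G ((Ls.getD j []).map Prod.fst) j w (sortChains P j s.chains).val
      (s.nodes.getD j []) [] ∧ ∀ u ∈ (Ls.getD j []).map Prod.fst, w ≤ u := by
  obtain ⟨w, hw⟩ := (((Ls.getD j []).map Prod.fst).toFinset : Set ℝ).toFinite.bddBelow
  have hw' : ∀ u ∈ (Ls.getD j []).map Prod.fst, w ≤ u := fun u hu => hw (by simpa using hu)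
  refine ⟨w, ⟨hs.utils j, hs.mass j, fun t ht => ?_, sortChains_sorted P j _, by simp,
    fun a ha h0 => hw' _ ?_⟩, hw'⟩
  · obtain ⟨h1, h2, h3, h4⟩ := hs.chain t ((sortChains_perm P j _).mem_iff.1 ht)
    exact ⟨h1, h2, by omega, h4 j hj, hw' _ (h4 j hj)⟩
  · rw [← hs.utils j]
    exact List.mem_map_of_mem ha

theorem IsPrepared.utils_sorted (hLs : IsPrepared G n Ls) (j : ℕ) :
    ((Ls.getD j []).map Prod.fst).Pairwise fun x y => y < x :=
  List.pairwise_map.2 (hLs.sorted j)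

theorem chainSum_neg (c : List Chain) (g : List ℝ → ℝ) :
    chainSum c (fun us => - g us) = - chainSum c g := by
  induction c with
  | nil => simp
  | cons t c ih => simp only [chainSum_cons, ih]; ring

/-- The effect of recoupling position `i + 1` on the state `s`. -/
structure TransitionResult (P : Params) (G : AddSubgroup ℝ) (n : ℕ) (Ls : List (List Node)) (i : ℕ)
    (s s' : State) : Prop where
  inv : StateInv G n Ls s'
  phase : PhaseInv n P.dom (i + 1) (i + 1) (HasMass s') s'.chains
  mono : ∀ k ≤ i, chainSum s.chains (indicatorOf (BuysUpTo n P.dom k)) ≤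
    chainSum s'.chains (indicatorOf (BuysUpTo n P.dom k))
  length : s'.chains.length ≤ s.chains.length + (Ls.getD (i + 1) []).length

theorem recouple_result (hdom : IsDomOrder n P.dom) (hLs : IsPrepared G n Ls) {s : State}
    (hs : StateInv G n Ls s) {i : ℕ} (hi : i < n)
    (hp : PhaseInv n P.dom i (i + 1) (HasMass s) s.chains) :
    TransitionResult P G n Ls i s (recouple P (i + 1) s).val := by
  obtain ⟨s', hs'⟩ : ∃ s', s' = (recouple P (i + 1) s).val := ⟨_, rfl⟩
  rw [← hs']
  obtain ⟨w, hw, hwU⟩ := recoupleInv_sort P hs (Nat.succ_le_of_lt hi)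
  have R := recoupleLoop_result P (hLs.utils_sorted (i + 1)) hw
  set c := (sortChains P (i + 1) s.chains).val with hc
  have hcp : c.Perm s.chains := sortChains_perm P _ _
  rw [recouple] at hs'
  simp only [Timed.val_bind, val_getNodes, val_setNodes, Timed.val_pure, ← hc] at hs'
  generalize (recoupleLoop P (i + 1) c (s.nodes.getD (i + 1) []) []).val = r at R hs'
  obtain ⟨w', hw'⟩ := R.inv
  have hlen : i + 1 < s.nodes.length := by rw [hs.length]; omega
  have hNi : s'.nodes.getD (i + 1) [] = r.1 := by
    simp [hs', List.getD_eq_getElem?_getD, List.getElem?_set_self hlen]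
  have hNj : ∀ j, j ≠ i + 1 → s'.nodes.getD j [] = s.nodes.getD j [] := fun j hj => by
    simp [hs', List.getD_eq_getElem?_getD, List.getElem?_set_ne hj.symm]
  have hch : s'.chains = r.2 := by rw [hs']
  have hmass : ∀ j u, j ≠ i + 1 → (HasMass s' j u ↔ HasMass s j u) := fun j u hj => by
    simp only [HasMass, hNj j hj]
  have hbarrier : ∀ u, HasMass s' (i + 1) u → ∃ u' ≤ u, HasMass s (i + 1) u' := by
    rintro u ⟨x, hx, hm⟩
    rw [hNi] at hm
    obtain ⟨b, hb, hb0, hbu⟩ := R.barrier _ hm hx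
    exact ⟨b.1, hbu, hasMass_of_mem hb hb0⟩
  have hbarred : ∀ k x, Barred n P.dom (HasMass s) (i + 1) k x →
      Barred n P.dom (HasMass s') (i + 1) k x := by
    rintro k x ⟨j, hj, hjn, h⟩
    refine ⟨j, hj, hjn, fun b hb => ?_⟩
    by_cases hji : j = i + 1
    · subst hji
      obtain ⟨b', hb', hm⟩ := hbarrier b hb
      exact hdom.mono_right hjn hb' (h b' hm)
    · exact h b ((hmass j b hji).1 hb)
  have hcmem : ∀ t ∈ c, 0 < t.mass ∧ t.mass ∈ G ∧ t.utils.length = n + 1 ∧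
      ∀ j ≤ n, t.utils.getD j 0 ∈ (Ls.getD j []).map Prod.fst :=
    fun t ht => hs.chain t (hcp.mem_iff.1 ht)
  -- the properties of a chain that do not depend on the outcome of the loop
  have hQ := R.forall_chain (fun us => (us.length = n + 1 ∧
      ∀ j ≤ n, us.getD j 0 ∈ (Ls.getD j []).map Prod.fst) ∧
      ∃ k ≤ i, (∀ j, k < j → j ≤ n → P.dom j (us.getD j 0) k (us.getD k 0)) ∧
        (∀ j, i + 1 < j → j ≤ n → ∀ b, HasMass s' j b → P.dom j b k (us.getD k 0) →
          b ≤ us.getD j 0) ∧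
        (∀ j, k < j → j ≤ i → ∀ b, HasMass s' j b → us.getD j 0 ≤ b) ∧
        ∀ j, j < k → Barred n P.dom (HasMass s') (i + 1) j (us.getD j 0))
    (fun t ht x hx hxu => by
      obtain ⟨-, -, h3, h4⟩ := hcmem t ht
      have hl : i + 1 < t.utils.length := by omega
      obtain ⟨k, hk, h5, h6, h7, h8⟩ := hp.chain t (hcp.mem_iff.1 ht)
      refine ⟨⟨by simpa using h3, fun j hj => ?_⟩, k, hk, fun j hkj hjn => ?_,
        fun j hij hjn b hb hd => ?_, fun j hkj hji b hb => ?_, fun j hjk => ?_⟩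
      · by_cases hji : j = i + 1
        · subst hji
          rw [getD_set_self hl]
          exact hx
        · rw [getD_set_ne _ hji]
          exact h4 j hj
      · rw [getD_set_ne _ (by omega : k ≠ i + 1)]
        by_cases hji : j = i + 1
        · subst hji
          rw [getD_set_self hl]
          exact hdom.mono_left hjn hxu (h5 _ hkj hjn)
        · rw [getD_set_ne _ hji]
          exact h5 j hkj hjn
      · rw [getD_set_ne _ (by omega : k ≠ i + 1)] at hd
        rw [getD_set_ne _ (by omega : j ≠ i + 1)]
        exact h6 j (by omega) hjn b ((hmass j b (by omega)).1 hb) hd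
      · rw [getD_set_ne _ (by omega : j ≠ i + 1)]
        exact h7 j hkj hji b ((hmass j b (by omega)).1 hb)
      · rw [getD_set_ne _ (by omega : j ≠ i + 1)]
        exact hbarred j _ (h8 j hjk)) (by simp)
  refine ⟨⟨?_, fun j => ?_, fun j => ?_, fun t ht => ?_, fun j hj f => ?_⟩, ⟨fun t ht => ?_,
    fun k hk x hx => ?_⟩, fun k hk => ?_, ?_⟩
  · rw [hs', ← hs.length]
    simp
  · by_cases hji : j = i + 1
    · subst hji
      rw [hNi]
      exact hw'.utils
    · rw [hNj j hji, hs.utils]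
  · by_cases hji : j = i + 1
    · subst hji
      rw [hNi]
      exact hw'.node
    · rw [hNj j hji]
      exact hs.mass j
  · rw [hch] at ht
    obtain ⟨h1, h2, -⟩ := hw'.recoupled t ht
    exact ⟨h1, h2, (hQ t ht).1⟩
  · by_cases hji : j = i + 1
    · subst hji
      have h1 := R.sum f
      rw [hNi, hch, h1, chainSum_perm hcp, ← hs.conserve (i + 1) hj f]
      simp
    · -- the utilities of position `j` are untouched
      rw [hNj j hji, hch, ← hs.conserve j hj f]
      have h1 := R.mono (fun us => f (us.getD j 0)) fun t _ x _ _ => by rw [getD_set_ne _ hji]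
      have h2 := R.mono (fun us => - f (us.getD j 0)) fun t _ x _ _ => by rw [getD_set_ne _ hji]
      rw [chainSum_neg c, chainSum_neg r.2, chainSum_perm hcp, chainSum_nil] at h2
      rw [chainSum_perm hcp, chainSum_nil] at h1
      linarith
  · rw [hch] at ht
    obtain ⟨-, k, hk, h1, h2, h3, h4⟩ := hQ t ht
    refine ⟨k, by omega, h1, h2, fun j hkj hji b hb => ?_, h4⟩
    rcases hji.eq_or_lt with rfl | hji
    · obtain ⟨-, -, -, -, h5⟩ := hw'.recoupled t ht
      obtain ⟨x, hx, hm⟩ := hb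
      rw [hNi] at hm
      exact h5.trans (hw'.level _ hm hx)
    · exact h3 j hkj (by omega) b hb
  · exact hbarred k x (hp.node k hk x ((hmass k x (by omega)).1 hx))
  · rw [hch, ← chainSum_perm hcp]
    have h1 := R.mono (indicatorOf (BuysUpTo n P.dom k)) fun t ht x _ hxu => by
      by_cases hb : BuysUpTo n P.dom k t.utils
      · have hl : i + 1 < t.utils.length := by have := (hcmem t ht).2.2.1; omega
        rw [indicatorOf_pos hb, indicatorOf_pos (hb.set hdom (by omega) hl hxu)]
      · rw [indicatorOf_neg hb]
        exact indicatorOf_nonneg _ _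
    simpa using h1
  · rw [hch, ← hcp.length_eq]
    have h1 := R.length
    have h2 := List.countP_le_length (p := fun u => decide (w ≤ u))
      (l := (Ls.getD (i + 1) []).map Prod.fst)
    simp only [List.length_nil, List.length_map] at h1 h2
    omega

end Transition

/-! ### Optimality of the coupling at the end of a stage -/


/-- The probability that the buyer purchases one of the positions up to `i` is at least `1`, or at
least one of the upper bounds that hold for all couplings: for some position `j > i` and some
utility `b`, the sum of the probabilities that the positions up to `i` exceed `(j, b)`, plus the
probability that the utility of `j` is below `b`. -/
def StageOptimal (n : ℕ) (dom : ℕ → ℝ → ℕ → ℝ → Prop) (Ls : List (List Node)) (i : ℕ)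
    (c : List Chain) : Prop :=
  1 ≤ chainSum c (indicatorOf (BuysUpTo n dom i)) ∨
    ∃ j b, i < j ∧ j ≤ n ∧
      ∑ k ∈ Finset.range (i + 1), nodeSum (Ls.getD k []) (indicatorOf (dom j b k)) +
        nodeSum (Ls.getD j []) (indicatorOf (· < b)) ≤
      chainSum c (indicatorOf (BuysUpTo n dom i))

theorem StageOptimal.mono {n : ℕ} {dom : ℕ → ℝ → ℕ → ℝ → Prop} {Ls : List (List Node)} {i : ℕ}
    {c c' : List Chain} (h : StageOptimal n dom Ls i c)
    (hc : chainSum c (indicatorOf (BuysUpTo n dom i)) ≤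
      chainSum c' (indicatorOf (BuysUpTo n dom i))) : StageOptimal n dom Ls i c' := by
  rcases h with h | ⟨j, b, h1, h2, h3⟩
  · exact .inl (h.trans hc)
  · exact .inr ⟨j, b, h1, h2, h3.trans hc⟩

theorem chainSum_sum {ι : Type} (S : Finset ι) (c : List Chain) (g : ι → List ℝ → ℝ) :
    ∑ k ∈ S, chainSum c (g k) = chainSum c fun us => ∑ k ∈ S, g k us := by
  induction c with
  | nil => simp
  | cons t c ih => simp [Finset.sum_add_distrib, ih, Finset.mul_sum]

theorem chainSum_add (c : List Chain) (g g' : List ℝ → ℝ) :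
    chainSum c g + chainSum c g' = chainSum c fun us => g us + g' us := by
  induction c with
  | nil => simp
  | cons t c ih => simp [← ih]; ring

/-- A linear order has a largest element among the `β j` with `i ≤ j ≤ m`. -/
theorem IsDomOrder.exists_max {n : ℕ} {dom : ℕ → ℝ → ℕ → ℝ → Prop} (hdom : IsDomOrder n dom)
    (β : ℕ → ℝ) {i m : ℕ} (him : i ≤ m) (hm : m ≤ n) :
    ∃ j, i ≤ j ∧ j ≤ m ∧ ∀ j', i ≤ j' → j' ≤ m → j' = j ∨ dom j' (β j') j (β j) := by
  induction m, him using Nat.le_induction with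
  | base => exact ⟨i, le_rfl, le_rfl, fun j' h1 h2 => .inl (by omega)⟩
  | succ m him ih =>
    obtain ⟨j, h1, h2, h3⟩ := ih (by omega)
    rcases hdom.total (by omega : j ≤ n) hm (by omega) (β j) (β (m + 1)) with h | h
    · refine ⟨m + 1, by omega, le_rfl, fun j' h4 h5 => ?_⟩
      rcases h5.eq_or_lt with rfl | h5
      · exact .inl rfl
      · rcases h3 j' h4 (by omega) with rfl | h6
        · exact .inr h
        · exact .inr (hdom.trans h6 h)
    · refine ⟨j, h1, by omega, fun j' h4 h5 => ?_⟩
      rcases h5.eq_or_lt with rfl | h5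
      · exact .inr h
      · exact h3 j' h4 (by omega)

/-- At the end of the stage of position `i`, the coupling attains the threshold bound: the threshold
is the highest among the lowest uncoupled utilities of the positions after `i`. Uncoupled mass is on
the side of the threshold that does not count, and every chain is counted at most once. -/
theorem stageOptimal_of_phaseInv {G : AddSubgroup ℝ} {n : ℕ} {Ls : List (List Node)}
    {dom : ℕ → ℝ → ℕ → ℝ → Prop} (hdom : IsDomOrder n dom) (hLs : IsPrepared G n Ls) {s : State}
    (hs : StateInv G n Ls s) {i : ℕ} (hi : i < n)
    (hp : PhaseInv n dom i (i + 1) (HasMass s) s.chains) : StageOptimal n dom Ls i s.chains := by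
  have hall : chainSum s.chains (indicatorOf (BuysUpTo n dom i)) =
      chainSum s.chains fun _ => 1 := by
    refine chainSum_congr fun t ht => indicatorOf_pos ?_
    obtain ⟨k, hk, h1, -⟩ := hp.chain t ht
    exact ⟨k, hk, fun j hj hjn => h1 j (by omega) hjn⟩
  by_cases he : ∃ j ≤ n, ∀ u, ¬ HasMass s j u
  · obtain ⟨j, hj, h⟩ := he
    left
    rw [hall, hs.chainSum_eq_one hLs fun u => hs.not_hasMass hLs hj h (Nat.zero_le n) u]
  · right
    push Not at he
    have hlow : ∀ j, ∃ b, j ≤ n → HasMass s j b ∧ ∀ x, HasMass s j x → b ≤ x := by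
      intro j
      by_cases hj : j ≤ n
      · have hfin : {u | HasMass s j u}.Finite :=
          (((Ls.getD j []).map Prod.fst).toFinset.finite_toSet).subset fun u hu => by
            simpa using hs.mem_utils hu
        obtain ⟨b, hb, hb'⟩ := Set.exists_min_image _ id hfin (he j hj)
        exact ⟨b, fun _ => ⟨hb, fun x hx => hb' x hx⟩⟩
      · exact ⟨0, fun h => absurd h hj⟩
    choose β hβ using hlow
    obtain ⟨j, hij, hjn, hmax⟩ := hdom.exists_max β hi le_rfl
    have hbarred : ∀ k x, Barred n dom (HasMass s) (i + 1) k x → dom k x j (β j) := by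
      rintro k x ⟨j', h1, h2, h3⟩
      have := h3 _ (hβ j' h2).1
      rcases hmax j' h1 h2 with rfl | h
      · exact this
      · exact hdom.trans this h
    refine ⟨j, β j, hij, hjn, ?_⟩
    have hk : ∀ k ∈ Finset.range (i + 1), nodeSum (Ls.getD k []) (indicatorOf (dom j (β j) k)) =
        chainSum s.chains fun us => indicatorOf (dom j (β j) k) (us.getD k 0) := by
      intro k hk
      have hki : k < i + 1 := Finset.mem_range.1 hk
      rw [← hs.conserve k (by omega), hs.nodeSum_eq_zero_of_forall_not, zero_add]
      intro u hu
      exact indicatorOf_neg (hdom.asymm (by omega) (hbarred k u (hp.node k hki u hu)))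
    rw [Finset.sum_congr rfl hk, ← hs.conserve j hjn, hs.nodeSum_eq_zero_of_forall_not, zero_add,
      chainSum_sum, chainSum_add, hall]
    · refine chainSum_le_of_forall hs.chain_nonneg fun t ht => ?_
      obtain ⟨k, hki, h1, h2, h3, h4⟩ := hp.chain t ht
      rw [Finset.sum_eq_single_of_mem k (by simp; omega)]
      · by_cases hd : dom j (β j) k (t.utils.getD k 0)
        · rw [indicatorOf_neg (p := (· < β j))
            (not_lt.2 (h2 j hij hjn _ (hβ j hjn).1 hd)), add_zero]
          exact indicatorOf_le_one _ _
        · rw [indicatorOf_neg hd, zero_add]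
          exact indicatorOf_le_one _ _
      · intro k' hk' hne
        have hk'i : k' < i + 1 := Finset.mem_range.1 hk'
        refine indicatorOf_neg (hdom.asymm (by omega) ?_)
        rcases lt_or_gt_of_ne hne with hlt | hlt
        · exact hbarred _ _ (h4 k' hlt)
        · obtain ⟨x, hx⟩ := he k' (by omega)
          exact hdom.mono_left (by omega) (h3 k' hlt (by omega) x hx)
            (hbarred _ _ (hp.node k' hk'i x hx))
    · intro u hu
      exact indicatorOf_neg (not_lt.2 ((hβ j hjn).2 u hu))

/-! ### The outcome of the main loop -/

section MainLoop

variable (P : Params) {G : AddSubgroup ℝ} {n : ℕ} {Ls : List (List Node)}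

/-- The outcome of one stage: position `i` is filled, and position `i + 1` is recoupled. -/
theorem stage_result (hP : IsChoice P.pick) (hdom : IsDomOrder n P.dom) (hLs : IsPrepared G n Ls)
    {i b : ℕ} (hi : i < n) {s : State} (hs : StateInv G n Ls s)
    (hp : PhaseInv n P.dom i i (HasMass s) s.chains) (hb : massCount n s < b) {s' : State}
    (hs' : s' = (fillAll P i b (Ls.getD i []) s).val) :
    FillResult P G n Ls i ((Ls.getD i []).length * b) s s' ∧
      StageOptimal n P.dom Ls i s'.chains ∧
      TransitionResult P G n Ls i s' (recouple P (i + 1) s').val := by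
  obtain ⟨h1, h2⟩ := fillAll_result P hP hLs hi.le b (Ls.getD i []) hs hp
  rw [← hs'] at h1 h2
  have h3 : ∀ a, Blocked n P.dom (HasMass s') i a := fun a ha => by
    obtain ⟨x, hx, rfl⟩ := List.mem_map.1 (h1.inv.mem_utils ha)
    exact h2 hb x hx ha
  have h4 := phaseInv_of_blocked hdom hLs h1.inv hi h1.phase h3
  exact ⟨h1, stageOptimal_of_phaseInv hdom hLs h1.inv hi h4, recouple_result P hdom hLs h1.inv hi h4⟩

theorem massCount_le {s : State} (hs : StateInv G n Ls s) (hLs : IsPrepared G n Ls) :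
    massCount n s ≤ (Ls.map List.length).sum := by
  have h : ∀ M : List (List Node),
      (M.map List.length).sum = ∑ j ∈ Finset.range M.length, (M.getD j []).length := by
    intro M
    induction M with
    | nil => simp
    | cons L M ih => simp [Finset.sum_range_succ', ih, add_comm]
  rw [h, hLs.length]
  refine Finset.sum_le_sum fun j _ => ?_
  refine List.countP_le_length.trans (le_of_eq ?_)
  have := congrArg List.length (hs.utils j)
  simpa using this

/-- At the end of the algorithm, no mass is uncoupled, and every stage has remained optimal. -/
theorem mainLoop_result (hP : IsChoice P.pick) (hdom : IsDomOrder n P.dom)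
    (hLs : IsPrepared G n Ls) {b : ℕ} (hb : (Ls.map List.length).sum < b) {i : ℕ} (hi : i ≤ n)
    {M : List (List Node)} (hM : Ls.drop i = M) {s : State} (hs : StateInv G n Ls s)
    (hp : PhaseInv n P.dom i i (HasMass s) s.chains)
    (ho : ∀ k < i, StageOptimal n P.dom Ls k s.chains) :
    StateInv G n Ls (mainLoop P b i M s).val ∧
      (∀ j ≤ n, ∀ u, ¬ HasMass (mainLoop P b i M s).val j u) ∧
      ∀ k < n, StageOptimal n P.dom Ls k (mainLoop P b i M s).val.chains := by
  induction M generalizing i s with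
  | nil =>
    have := hLs.length
    have := List.drop_eq_nil_iff.1 hM
    omega
  | cons L M ih =>
    have hlen := congrArg List.length hM
    rw [List.length_drop, hLs.length, List.length_cons] at hlen
    have hL : L = Ls.getD i [] := by
      have := congrArg (fun l : List (List Node) => l.getD 0 []) hM
      simpa [List.getD_eq_getElem?_getD] using this.symm
    cases M with
    | nil =>
      have hin : i = n := by simp at hlen; omega
      subst hin
      obtain ⟨h1, h2⟩ := fillAll_result P hP hLs le_rfl b L hs hp
      have hval : (mainLoop P b i [L] s).val = (fillAll P i b L s).val := rfl
      rw [hval]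
      have h3 : ∀ u, ¬ HasMass (fillAll P i b L s).val i u := fun u hu => by
        have hu' := h1.inv.mem_utils hu
        rw [← hL] at hu'
        obtain ⟨a, ha, rfl⟩ := List.mem_map.1 hu'
        rcases h2 ((massCount_le hs hLs).trans_lt hb) a ha hu with ⟨j, hj, h⟩ | ⟨j, hj, hjn, -⟩
        · exact h1.inv.not_hasMass hLs hj.le h le_rfl _ hu
        · omega
      exact ⟨h1.inv, fun j hj u => h1.inv.not_hasMass hLs le_rfl h3 hj u,
        fun k hk => (ho k hk).mono (h1.mono _ fun _ => indicatorOf_nonneg _ _)⟩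
    | cons L' M =>
      have hin : i < n := by simp at hlen; omega
      rw [mainLoop]
      simp only [Timed.val_bind]
      subst hL
      obtain ⟨h1, h2, h3⟩ := stage_result P hP hdom hLs hin hs hp
        ((massCount_le hs hLs).trans_lt hb) rfl
      refine ih hin ?_ h3.inv h3.phase fun k hk => ?_
      · rw [Nat.succ_eq_add_one, ← List.tail_drop, hM]
        rfl
      · rcases (Nat.lt_succ_iff.1 hk).eq_or_lt with rfl | hk'
        · exact h2.mono (h3.mono k le_rfl)
        · exact ((ho k hk').mono (h1.mono _ fun _ => indicatorOf_nonneg _ _)).mono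
            (h3.mono k hk'.le)

theorem stateInv_start (hLs : IsPrepared G n Ls) : StateInv G n Ls ⟨Ls, []⟩ :=
  ⟨hLs.length, fun _ => rfl, hLs.mass, by simp, by simp⟩

theorem phaseInv_start {dom : ℕ → ℝ → ℕ → ℝ → Prop} (pos : ℕ → ℝ → Prop) :
    PhaseInv n dom 0 0 pos [] := ⟨by simp, by simp⟩

end MainLoop

/-! ### Finitely supported laws -/

section Laws

variable {α X : Type*} [MeasurableSpace X]

theorem sum_dirac_apply (l : List α) (m : α → ℝ) (h : α → X) (hm : ∀ a ∈ l, 0 ≤ m a) {A : Set X}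
    (hA : MeasurableSet A) :
    (l.map fun a => ENNReal.ofReal (m a) • Measure.dirac (h a)).sum A =
      ENNReal.ofReal (l.map fun a => m a * indicatorOf (fun x : X => x ∈ A) (h a)).sum := by
  induction l with
  | nil => simp
  | cons a l ih =>
    have h0 : 0 ≤ (l.map fun a => m a * indicatorOf (fun x : X => x ∈ A) (h a)).sum := by
      refine List.sum_nonneg fun x hx => ?_
      obtain ⟨b, hb, rfl⟩ := List.mem_map.1 hx
      exact mul_nonneg (hm b (by simp [hb])) (indicatorOf_nonneg _ _)
    have ha := hm a (by simp)
    rw [List.map_cons, List.sum_cons, List.map_cons, List.sum_cons, Measure.add_apply,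
      ih fun b hb => hm b (by simp [hb]), ENNReal.ofReal_add (mul_nonneg ha
        (indicatorOf_nonneg _ _)) h0, Measure.smul_apply, Measure.dirac_apply' _ hA,
      ENNReal.ofReal_mul ha]
    by_cases hA' : h a ∈ A
    · simp [hA', indicatorOf]
    · simp [hA', indicatorOf]

/-- As the law is finitely supported, no measurability of `f` is required. -/
theorem integral_sum_dirac [MeasurableSingletonClass X] (l : List α) (m : α → ℝ) (h : α → X)
    (hm : ∀ a ∈ l, 0 ≤ m a) (f : X → ℝ) :
    Integrable f (l.map fun a => ENNReal.ofReal (m a) • Measure.dirac (h a)).sum ∧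
      ∫ x, f x ∂(l.map fun a => ENNReal.ofReal (m a) • Measure.dirac (h a)).sum =
        (l.map fun a => m a * f (h a)).sum := by
  induction l with
  | nil => simp
  | cons a l ih =>
    obtain ⟨h1, h2⟩ := ih fun b hb => hm b (by simp [hb])
    have h3 : Integrable f (ENNReal.ofReal (m a) • Measure.dirac (h a)) :=
      (integrable_dirac (by simp)).smul_measure ENNReal.ofReal_ne_top
    simp only [List.map_cons, List.sum_cons]
    refine ⟨h3.add_measure h1, ?_⟩
    rw [integral_add_measure h3 h1, h2, integral_smul_measure, integral_dirac,
      ENNReal.toReal_ofReal (hm a (by simp)), smul_eq_mul]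

end Laws

theorem marginalLaw_apply {l : List (ℝ × ℝ)} (hl : ∀ a ∈ l, 0 ≤ a.2) {A : Set ℝ}
    (hA : MeasurableSet A) :
    marginalLaw l A = ENNReal.ofReal (nodeSum l (indicatorOf (· ∈ A))) :=
  sum_dirac_apply l Prod.snd Prod.fst hl hA

theorem integrable_marginalLaw {l : List (ℝ × ℝ)} (hl : ∀ a ∈ l, 0 ≤ a.2) (f : ℝ → ℝ) :
    Integrable f (marginalLaw l) :=
  (integral_sum_dirac l Prod.snd Prod.fst hl f).1

theorem integral_marginalLaw {l : List (ℝ × ℝ)} (hl : ∀ a ∈ l, 0 ≤ a.2) (f : ℝ → ℝ) :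
    ∫ x, f x ∂marginalLaw l = nodeSum l f :=
  (integral_sum_dirac l Prod.snd Prod.fst hl f).2

section Compatible

variable {n : ℕ} {F : Fin n → List (ℝ × ℝ)} {μ : Measure (Profile n)}

/-- A compatible distribution has finite support, whence every function is integrable, however
irregular the tie-breaking rule may be. -/
theorem Compatible.integrable (hμ : Compatible F μ) (hF : ∀ i, IsMarginal (F i))
    (f : Profile n → ℝ) : Integrable f μ := by
  have := hμ.isProbabilityMeasure
  have hS : (Set.univ.pi fun i => {x | x ∈ (F i).map Prod.fst}).Finite :=
    Set.Finite.pi fun i => ((F i).map Prod.fst).finite_toSet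
  have hae : ∀ᵐ v ∂μ, v ∈ Set.univ.pi fun i => {x | x ∈ (F i).map Prod.fst} := by
    simp only [Set.mem_univ_pi]
    rw [ae_all_iff]
    intro i
    have hfin : {x | x ∈ (F i).map Prod.fst}.Finite := ((F i).map Prod.fst).finite_toSet
    have h1 : marginalLaw (F i) {x | x ∈ (F i).map Prod.fst}ᶜ = 0 := by
      rw [marginalLaw_apply (hF i).nonneg hfin.measurableSet.compl, nodeSum_eq_zero,
        ENNReal.ofReal_zero]
      intro a ha
      refine .inr (indicatorOf_neg fun h => h ?_)
      exact List.mem_map_of_mem ha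
    rw [← hμ.marginal i, Measure.map_apply (measurable_pi_apply i) hfin.measurableSet.compl] at h1
    exact h1
  have hf : IntegrableOn f (Set.univ.pi fun i => {x | x ∈ (F i).map Prod.fst}) μ := by
    rw [← hS.coe_toFinset]
    exact .finset
  rwa [IntegrableOn, Measure.restrict_eq_self_of_ae_mem hae] at hf

theorem Compatible.integral_apply (hμ : Compatible F μ) (hF : ∀ i, IsMarginal (F i)) (i : Fin n)
    (f : ℝ → ℝ) : ∫ v, f (v i) ∂μ = nodeSum (F i) f := by
  rw [← integral_marginalLaw (hF i).nonneg, ← hμ.marginal i, integral_map]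
  · exact (measurable_pi_apply i).aemeasurable
  · rw [hμ.marginal i]
    exact (integrable_marginalLaw (hF i).nonneg f).aestronglyMeasurable

end Compatible

/-! ### The buyer's choice -/

section Buyer

variable {n : ℕ}

/-- The domination relation of a tie-breaking rule, on positions given as natural numbers. -/
def domOf (tie : TieRule n) (i : ℕ) (x : ℝ) (j : ℕ) (y : ℝ) : Prop :=
  ∃ (hi : i < n + 1) (hj : j < n + 1), Dominated tie ⟨i, hi⟩ x ⟨j, hj⟩ y

theorem isDomOrder_domOf {tie : TieRule n} (htie : tie.Consistent) :
    IsDomOrder n (domOf tie) where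
  trans := by
    rintro i j k x y z ⟨hi, hj, h⟩ ⟨_, hk, h'⟩
    refine ⟨hi, hk, ?_⟩
    have := htie z
    rcases h with h | ⟨rfl, h⟩ <;> rcases h' with h' | ⟨rfl, h'⟩

    · exact .inl (h.trans h')
    · exact .inl h
    · exact .inl h'
    · exact .inr ⟨rfl, _root_.trans h h'⟩
  same := by
    intro i x y hi
    have := htie y
    refine ⟨?_, fun h => ⟨by omega, by omega, .inl h⟩⟩
    rintro ⟨hi, hj, h | ⟨rfl, h⟩⟩
    · exact h
    · exact absurd h (irrefl _)
  total := by
    intro i j hi hj hij x y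
    have := htie y
    rcases lt_trichotomy x y with h | rfl | h
    · exact .inl ⟨by omega, by omega, .inl h⟩
    · rcases trichotomous_of (tie x) ⟨i, by omega⟩ ⟨j, by omega⟩ with h | h | h
      · exact .inl ⟨by omega, by omega, .inr ⟨rfl, h⟩⟩
      · simp [hij] at h
      · exact .inr ⟨by omega, by omega, .inr ⟨rfl, h⟩⟩
    · exact .inr ⟨by omega, by omega, .inl h⟩

/-- The utilities of all positions at the valuation profile `v`, as a list. -/
noncomputable def utilList (p : Fin n → ℝ) (v : Profile n) : List ℝ := List.ofFn (utility p v)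

theorem utilList_getD (p : Fin n → ℝ) (v : Profile n) (j : Fin (n + 1)) :
    (utilList p v).getD j 0 = utility p v j := by
  have hj : (j : ℕ) < (utilList p v).length := by
    rw [utilList, List.length_ofFn]
    exact j.2
  rw [List.getD_eq_getElem _ _ hj]
  exact List.getElem_ofFn _

/-- The price of position `j`. -/
noncomputable def priceAt (p : Fin n → ℝ) (j : ℕ) : ℝ :=
  if h : j < n + 1 then priceWithNull p ⟨j, h⟩ else 0

/-- Summation by parts: the price of the purchased position is the highest price, minus the
increments of the prices after the purchased position. -/
theorem payment_eq {tie : TieRule n} (htie : tie.Consistent) (p : Fin n → ℝ) (v : Profile n) :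
    payment tie p v = priceAt p n - ∑ i ∈ Finset.range n, (priceAt p (i + 1) - priceAt p i) *
      indicatorOf (BuysUpTo n (domOf tie) i) (utilList p v) := by
  have hdom := isDomOrder_domOf htie
  obtain ⟨j, -, hj, hmax⟩ := hdom.exists_max (fun j => (utilList p v).getD j 0) (Nat.zero_le n)
    le_rfl
  have hmax' : ∀ k ≤ n, k ≠ j →
      domOf tie k ((utilList p v).getD k 0) j ((utilList p v).getD j 0) :=
    fun k hk hne => (hmax k (Nat.zero_le k) hk).resolve_left hne
  have hbuys : ∀ i, BuysUpTo n (domOf tie) i (utilList p v) ↔ j ≤ i := by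
    refine fun i => ⟨fun ⟨k, hk, h⟩ => ?_, fun h => ⟨j, h, fun k hk hkn => hmax' k hkn (by omega)⟩⟩
    by_contra hij
    have h1 := h j (by omega) hj
    exact hdom.asymm hj h1 (hmax' k (by omega) (by omega))
  have hdomFin : ∀ k l : Fin (n + 1), domOf tie k ((utilList p v).getD k 0) l
      ((utilList p v).getD l 0) ↔ Dominated tie k (utility p v k) l (utility p v l) := by
    intro k l
    rw [utilList_getD, utilList_getD]
    exact ⟨fun ⟨_, _, h⟩ => h, fun h => ⟨k.2, l.2, h⟩⟩
  have hB : ∀ l : Fin (n + 1), Buys tie p v l ↔ l = ⟨j, by omega⟩ := by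
    intro l
    constructor
    · intro h
      by_contra hne
      have h1 := (hdomFin _ _).2 (h ⟨j, by omega⟩ (Ne.symm hne))
      exact hdom.asymm hj h1 (hmax' l (by omega) fun h => hne (Fin.ext h))
    · rintro rfl k hk
      exact (hdomFin k ⟨j, by omega⟩).1 (hmax' k (by omega) fun h => hk (Fin.ext h))
  have hpay : payment tie p v = priceAt p j := by
    classical
    rw [payment, Finset.sum_eq_single ⟨j, by omega⟩]
    · rw [if_pos ((hB _).2 rfl), priceAt, dif_pos (by omega)]
    · intro l _ hl
      rw [if_neg fun h => hl ((hB l).1 h)]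
    · simp
  have hsum : ∀ m, j ≤ m → ∑ i ∈ Finset.range m, (priceAt p (i + 1) - priceAt p i) *
      indicatorOf (BuysUpTo n (domOf tie) i) (utilList p v) = priceAt p m - priceAt p j := by
    intro m hm
    induction m, hm using Nat.le_induction with
    | base =>
      rw [sub_self]
      refine Finset.sum_eq_zero fun i hi => ?_
      rw [indicatorOf_neg, mul_zero]
      rw [hbuys]
      have := Finset.mem_range.1 hi
      omega
    | succ m hm ih =>
      rw [Finset.sum_range_succ, ih, indicatorOf_pos ((hbuys m).2 hm)]
      ring
  rw [hpay, hsum n hj]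
  ring

theorem priceAt_mono {p : Fin n → ℝ} (h0 : ∀ i, 0 ≤ p i) (hp : Monotone p) {i : ℕ} (hi : i < n) :
    priceAt p i ≤ priceAt p (i + 1) := by
  rw [priceAt, dif_pos (by omega), priceAt, dif_pos (by omega)]
  have h1 : (⟨i + 1, by omega⟩ : Fin (n + 1)) = Fin.succ ⟨i, hi⟩ := rfl
  rw [h1, priceWithNull, Fin.cons_succ]
  cases i with
  | zero => exact h0 _
  | succ i =>
    have h2 : (⟨i + 1, by omega⟩ : Fin (n + 1)) = Fin.succ ⟨i, by omega⟩ := rfl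
    rw [h2, Fin.cons_succ]
    exact hp (by simp)

/-- The threshold bound: if the buyer purchases one of the positions up to `i`, then its utility
exceeds the threshold `(j, b)`, or the utility of `j` is below the threshold. -/
theorem indicatorOf_buysUpTo_le {dom : ℕ → ℝ → ℕ → ℝ → Prop} (hdom : IsDomOrder n dom) {i j : ℕ}
    (hij : i < j) (hj : j ≤ n) (b : ℝ) (us : List ℝ) :
    indicatorOf (BuysUpTo n dom i) us ≤
      ∑ k ∈ Finset.range (i + 1), indicatorOf (dom j b k) (us.getD k 0) +
        indicatorOf (· < b) (us.getD j 0) := by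
  have hnn : 0 ≤ ∑ k ∈ Finset.range (i + 1), indicatorOf (dom j b k) (us.getD k 0) :=
    Finset.sum_nonneg fun _ _ => indicatorOf_nonneg _ _
  by_cases h : BuysUpTo n dom i us
  · obtain ⟨k, hk, h'⟩ := h
    by_cases hb : us.getD j 0 < b
    · rw [indicatorOf_pos (p := (· < b)) hb]
      have := indicatorOf_le_one (BuysUpTo n dom i) us
      linarith
    · have h1 : dom j b k (us.getD k 0) := hdom.mono_left hj (not_lt.1 hb) (h' j hij hj)
      have h2 := Finset.single_le_sum (f := fun k => indicatorOf (dom j b k) (us.getD k 0))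
        (fun _ _ => indicatorOf_nonneg _ _) (Finset.mem_range.2 (Nat.lt_succ_of_le hk))
      simp only [indicatorOf_pos h1] at h2
      have := indicatorOf_le_one (BuysUpTo n dom i) us
      have := indicatorOf_nonneg (· < b) (us.getD j 0)
      linarith
  · rw [indicatorOf_neg h]
    exact add_nonneg hnn (indicatorOf_nonneg _ _)

end Buyer

/-! ### The prepared nodes of an instance -/

section Instance

variable {n : ℕ} (P : Params) (p : Fin n → ℝ) (F : Fin n → List (ℝ × ℝ))

/-- The prices and value-probability pairs of all positions. -/
def inputList : List (ℝ × List (ℝ × ℝ)) := (0, [(0, 1)]) :: List.ofFn fun i => (p i, F i)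

/-- The nodes with which the algorithm starts. -/
noncomputable def startNodes : List (List Node) := (prepare P (inputList p F)).val

theorem startNodes_zero : (startNodes P p F).getD 0 [] = [(0, 1)] := by
  simp [startNodes, inputList, val_prepare, prepareItem, insertNode]

theorem startNodes_succ (i : Fin n) :
    (startNodes P p F).getD (i + 1) [] = (prepareItem P (p i) (F i)).val := by
  simp [startNodes, inputList, val_prepare, List.getD_eq_getElem?_getD]

theorem nodeSum_startNodes_succ (i : Fin n) (f : ℝ → ℝ) :
    nodeSum ((startNodes P p F).getD (i + 1) []) f = nodeSum (F i) fun x => f (x - p i) := by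
  rw [startNodes_succ, nodeSum_perm (prepareItem_perm P _ _)]
  simp [nodeSum, Function.comp_def]

theorem length_startNodes : (startNodes P p F).length = n + 1 := by
  simp [startNodes, inputList, val_prepare]

theorem exists_fin_of_pos {j : ℕ} (hj : j ≤ n) : j = 0 ∨ ∃ i : Fin n, j = i + 1 := by
  cases j with
  | zero => exact .inl rfl
  | succ j => exact .inr ⟨⟨j, by omega⟩, rfl⟩

theorem isPrepared_startNodes {G : AddSubgroup ℝ} (hF : ∀ i, IsMarginal (F i)) (h1 : (1 : ℝ) ∈ G)
    (hG : ∀ i, ∀ a ∈ F i, a.2 ∈ G) : IsPrepared G n (startNodes P p F) := by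
  have hcase : ∀ j, (startNodes P p F).getD j [] = [] ∨ j = 0 ∨ ∃ i : Fin n, j = i + 1 := by
    intro j
    rcases le_or_gt j n with hj | hj
    · exact .inr (exists_fin_of_pos hj)
    · exact .inl (List.getD_eq_default _ _ (by rw [length_startNodes]; omega))
  refine ⟨length_startNodes P p F, fun j => ?_, fun j => ?_, fun j hj => ?_⟩
  · rcases hcase j with h | rfl | ⟨i, rfl⟩
    · rw [h]
      exact .nil
    · rw [startNodes_zero]
      exact List.pairwise_singleton _ _
    · rw [startNodes_succ]
      have hp := prepareItem_perm P (p i) (F i)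
      have hnd : ((prepareItem P (p i) (F i)).val.map Prod.fst).Nodup := by
        rw [(hp.map Prod.fst).nodup_iff, List.map_map]
        have := (hF i).nodup.map (sub_left_injective (b := p i))
        rwa [List.map_map] at this
      rw [List.Nodup, List.pairwise_map] at hnd
      exact (prepareItem_sorted P (p i) (F i)).imp₂ (fun a b h1 h2 => lt_of_le_of_ne h1 h2.symm) hnd
  · rcases hcase j with h | rfl | ⟨i, rfl⟩
    · rw [h]
      simp
    · rw [startNodes_zero]
      simp [h1]
    · intro a ha
      rw [startNodes_succ, (prepareItem_perm P (p i) (F i)).mem_iff] at ha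
      obtain ⟨b, hb, rfl⟩ := List.mem_map.1 ha
      exact ⟨(hF i).nonneg b hb, hG i b hb⟩
  · rcases exists_fin_of_pos hj with rfl | ⟨i, rfl⟩
    · rw [startNodes_zero]
      simp
    · rw [nodeSum_startNodes_succ]
      simpa [nodeSum] using (hF i).total

theorem waterFilling_result (hP : IsChoice P.pick) (hdom : IsDomOrder n P.dom)
    (hF : ∀ i, IsMarginal (F i)) :
    ∃ s, StateInv ⊤ n (startNodes P p F) s ∧ (∀ j ≤ n, ∀ u, ¬ HasMass s j u) ∧
      (∀ k < n, StageOptimal n P.dom (startNodes P p F) k s.chains) ∧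
      (waterFilling P (List.ofFn fun i => (p i, F i))).val = s.chains := by
  have hLs : IsPrepared ⊤ n (startNodes P p F) :=
    isPrepared_startNodes P p F hF trivial fun _ _ _ => trivial
  obtain ⟨h1, h2, h3⟩ := mainLoop_result P hP hdom hLs (Nat.lt_succ_self _) (Nat.zero_le n) rfl
    (stateInv_start hLs) (phaseInv_start _) (by simp)
  refine ⟨_, h1, h2, h3, ?_⟩
  rw [waterFilling]
  simp only [Timed.val_bind, val_countNodes, Timed.val_pure]
  rfl

end Instance

/-! ### The output is compatible and attains the lowest revenue -/

section Output

variable {n : ℕ} {p : Fin n → ℝ} {F : Fin n → List (ℝ × ℝ)} {P : Params} {s : State}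

theorem chainSum_eq_nodeSum {G : AddSubgroup ℝ} {Ls : List (List Node)} (hs : StateInv G n Ls s)
    (h0 : ∀ j ≤ n, ∀ u, ¬ HasMass s j u) {j : ℕ} (hj : j ≤ n) (f : ℝ → ℝ) :
    chainSum s.chains (fun us => f (us.getD j 0)) = nodeSum (Ls.getD j []) f := by
  rw [← hs.conserve j hj f, hs.nodeSum_eq_zero_of_forall_not fun u hu => absurd hu (h0 j hj u),
    zero_add]

theorem utilList_chainProfile (hs : StateInv ⊤ n (startNodes P p F) s) {t : Chain}
    (ht : t ∈ s.chains) : utilList p (chainProfile p t) = t.utils := by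
  obtain ⟨-, -, h3, h4⟩ := hs.chain t ht
  refine List.ext_getElem (by simp [utilList, h3]) fun j h1 h2 => ?_
  rcases exists_fin_of_pos (by omega : j ≤ n) with rfl | ⟨i, rfl⟩
  · have := h4 0 (Nat.zero_le n)
    rw [startNodes_zero, List.getD_eq_getElem _ _ h2] at this
    simpa [utilList, utility, eq_comm] using this
  · have : (⟨(i : ℕ) + 1, by omega⟩ : Fin (n + 1)) = i.succ := rfl
    simp only [utilList, List.getElem_ofFn, this, utility, Fin.cons_succ, chainProfile]
    rw [List.getD_eq_getElem _ _ h2]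
    ring

theorem integral_couplingLaw (hs : StateInv ⊤ n (startNodes P p F) s) (f : List ℝ → ℝ) :
    ∫ v, f (utilList p v) ∂couplingLaw p s.chains = chainSum s.chains f := by
  rw [couplingLaw, (integral_sum_dirac s.chains Chain.mass (chainProfile p) hs.chain_nonneg
    fun v => f (utilList p v)).2, chainSum]
  congr 1
  exact List.map_congr_left fun t ht => by rw [utilList_chainProfile hs ht]

theorem compatible_couplingLaw (hF : ∀ i, IsMarginal (F i))
    (hs : StateInv ⊤ n (startNodes P p F) s) (h0 : ∀ j ≤ n, ∀ u, ¬ HasMass s j u) :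
    Compatible F (couplingLaw p s.chains) := by
  refine ⟨⟨?_⟩, fun i => ?_⟩
  · rw [couplingLaw, sum_dirac_apply s.chains Chain.mass (chainProfile p) hs.chain_nonneg
      MeasurableSet.univ]
    have h := chainSum_eq_nodeSum hs h0 (Nat.zero_le n) fun _ => 1
    rw [startNodes_zero] at h
    simpa [indicatorOf, chainSum] using h
  · ext A hA
    rw [Measure.map_apply (measurable_pi_apply i) hA, marginalLaw_apply (hF i).nonneg hA,
      couplingLaw, sum_dirac_apply s.chains Chain.mass (chainProfile p) hs.chain_nonneg
      (measurable_pi_apply i hA)]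
    have h := chainSum_eq_nodeSum hs h0 (j := i + 1) (by omega)
      fun u => indicatorOf (· ∈ A) (u + p i)
    rw [nodeSum_startNodes_succ] at h
    simp only [sub_add_cancel] at h
    exact congrArg ENNReal.ofReal h

theorem integral_utility (hF : ∀ i, IsMarginal (F i)) {μ : Measure (Profile n)}
    (hμ : Compatible F μ) {j : ℕ} (hj : j ≤ n) (f : ℝ → ℝ) :
    ∫ v, f ((utilList p v).getD j 0) ∂μ = nodeSum ((startNodes P p F).getD j []) f := by
  have := hμ.isProbabilityMeasure
  rcases exists_fin_of_pos hj with rfl | ⟨i, rfl⟩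
  · rw [startNodes_zero]
    have : ∀ v : Profile n, (utilList p v).getD 0 0 = 0 := fun v => utilList_getD p v 0
    simp only [this]
    simp
  · rw [nodeSum_startNodes_succ, ← hμ.integral_apply hF i fun x => f (x - p i)]
    refine integral_congr_ae (.of_forall fun v => ?_)
    have := utilList_getD p v i.succ
    rw [Fin.val_succ] at this
    simp only [this, utility, Fin.cons_succ]

/-- No compatible distribution makes the buyer purchase one of the positions up to `i` with a
higher probability. -/
theorem integral_buysUpTo_le (hdom : IsDomOrder n P.dom) (hF : ∀ i, IsMarginal (F i))
    {μ : Measure (Profile n)} (hμ : Compatible F μ) {i : ℕ}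
    (ho : StageOptimal n P.dom (startNodes P p F) i s.chains) :
    ∫ v, indicatorOf (BuysUpTo n P.dom i) (utilList p v) ∂μ ≤
      chainSum s.chains (indicatorOf (BuysUpTo n P.dom i)) := by
  have := hμ.isProbabilityMeasure
  rcases ho with h | ⟨j, b, hij, hj, h⟩
  · refine le_trans ?_ h
    calc _ ≤ ∫ _, (1 : ℝ) ∂μ := integral_mono (hμ.integrable hF _) (hμ.integrable hF _)
          fun v => indicatorOf_le_one _ _
      _ = 1 := by simp
  · refine le_trans ?_ h
    calc _ ≤ ∫ v, (∑ k ∈ Finset.range (i + 1),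
            indicatorOf (P.dom j b k) ((utilList p v).getD k 0) +
            indicatorOf (· < b) ((utilList p v).getD j 0)) ∂μ :=
          integral_mono (hμ.integrable hF _) (hμ.integrable hF _)
            fun v => indicatorOf_buysUpTo_le hdom hij hj b _
      _ = _ := by
        rw [integral_add (hμ.integrable hF _) (hμ.integrable hF _),
          integral_finsetSum _ fun k _ => hμ.integrable hF _, integral_utility hF hμ hj]
        congr 1
        refine Finset.sum_congr rfl fun k hk => integral_utility hF hμ ?_ _
        have := Finset.mem_range.1 hk
        omega

end Output

theorem revenue_eq {n : ℕ} {p : Fin n → ℝ} {F : Fin n → List (ℝ × ℝ)} {tie : TieRule n}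
    (htie : tie.Consistent) (hF : ∀ i, IsMarginal (F i)) {μ : Measure (Profile n)}
    (hμ : Compatible F μ) :
    revenue tie p μ = priceAt p n - ∑ i ∈ Finset.range n, (priceAt p (i + 1) - priceAt p i) *
      ∫ v, indicatorOf (BuysUpTo n (domOf tie) i) (utilList p v) ∂μ := by
  have := hμ.isProbabilityMeasure
  rw [revenue]
  simp only [payment_eq htie]
  rw [integral_sub (hμ.integrable hF _) (hμ.integrable hF _),
    integral_finsetSum _ fun k _ => hμ.integrable hF _]
  simp [integral_const_mul]

theorem outputLaw_optimal {n : ℕ} {p : Fin n → ℝ} {F : Fin n → List (ℝ × ℝ)} {tie : TieRule n}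
    {pick : List Chain → ℕ → List Node → Node} (hI : IsInstance p F) (htie : tie.Consistent)
    (hpick : IsChoice pick) :
    Compatible F (outputLaw tie pick p F) ∧
      ∀ μ : Measure (Profile n), Compatible F μ → Integrable (payment tie p) μ ∧
        revenue tie p (outputLaw tie pick p F) ≤ revenue tie p μ := by
  have hdom := isDomOrder_domOf htie
  obtain ⟨s, hs, h0, ho, hval⟩ := waterFilling_result
    { cost := fun _ _ => 1, dom := domOf tie, pick := pick } p F hpick hdom hI.marginal
  have hlaw : outputLaw tie pick p F = couplingLaw p s.chains := congrArg (couplingLaw p) hval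
  have hc := compatible_couplingLaw hI.marginal hs h0
  rw [hlaw]
  refine ⟨hc, fun μ hμ => ⟨hμ.integrable hI.marginal _, ?_⟩⟩
  rw [revenue_eq htie hI.marginal hc, revenue_eq htie hI.marginal hμ]
  refine sub_le_sub_left (Finset.sum_le_sum fun i hi => ?_) _
  have hi := Finset.mem_range.1 hi
  refine mul_le_mul_of_nonneg_left ?_ (sub_nonneg.2 (priceAt_mono hI.price_nonneg hI.price_mono hi))
  rw [integral_couplingLaw hs]
  exact integral_buysUpTo_le hdom hI.marginal hμ (ho i hi)

/-! ### Running times of the elementary steps -/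

/-- Every operation on two numbers in `S` takes at most `K` steps. -/
structure CostBound (P : Params) (S : Set ℝ) (K : ℕ) : Prop where
  zero : 0 ∈ S
  cost : ∀ x ∈ S, ∀ y ∈ S, P.cost x y ≤ K
  one_le : 1 ≤ K

/-- The utilities and masses of a list of nodes belong to `S`. -/
def NodesIn (S : Set ℝ) (L : List (ℝ × ℝ)) : Prop := ∀ a ∈ L, a.1 ∈ S ∧ a.2 ∈ S

section Times

variable {P : Params} {S : Set ℝ} {K : ℕ}

theorem NodesIn.tail {a : ℝ × ℝ} {L : List (ℝ × ℝ)} (h : NodesIn S (a :: L)) : NodesIn S L :=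
  fun b hb => h b (by simp [hb])

theorem NodesIn.head {a : ℝ × ℝ} {L : List (ℝ × ℝ)} (h : NodesIn S (a :: L)) :
    a.1 ∈ S ∧ a.2 ∈ S := h a (by simp)

theorem time_insertNode (hK : CostBound P S K) {a : Node} (ha : a.1 ∈ S) {l : List Node}
    (hl : ∀ b ∈ l, b.1 ∈ S) : (insertNode P a l).time ≤ (l.length + 1) * (2 * K) := by
  have h1 := hK.one_le
  induction l with
  | nil => simp [insertNode]; omega
  | cons b l ih =>
    rw [insertNode]
    simp only [Timed.time_bind, time_tick, time_ltT, List.length_cons]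
    have h2 := hK.cost _ ha _ (hl b (by simp))
    have h3 := ih fun b' hb' => hl b' (by simp [hb'])
    split
    · simp only [Timed.time_bind, Timed.time_pure]
      linarith
    · simp only [Timed.time_pure]
      nlinarith

theorem time_prepareItem (hK : CostBound P S K) {q : ℝ} (hq : q ∈ S) {l : List (ℝ × ℝ)}
    (hl : ∀ a ∈ l, a.1 ∈ S ∧ a.1 - q ∈ S) {X : ℕ} (hX : l.length + 1 ≤ X) :
    (prepareItem P q l).time ≤ (l.length + 1) * (4 * K * X) := by
  have h1 := hK.one_le
  have hKX : K ≤ K * X := Nat.le_mul_of_pos_right _ (by omega)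
  induction l with
  | nil => simp [prepareItem]; nlinarith
  | cons a l ih =>
    rw [prepareItem]
    simp only [List.length_cons] at hX
    simp only [Timed.time_bind, time_tick, time_subT, val_subT, List.length_cons]
    have h2 := hK.cost _ (hl a (by simp)).1 _ hq
    have h3 := ih (fun b hb => hl b (by simp [hb])) (by omega)
    have h4 := time_insertNode hK (a := (a.1 - q, a.2)) (hl a (by simp)).2
      (l := (prepareItem P q l).val) fun b hb => by
        rw [(prepareItem_perm P q l).mem_iff] at hb
        obtain ⟨c, hc, rfl⟩ := List.mem_map.1 hb
        exact (hl c (by simp [hc])).2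
    rw [(prepareItem_perm P q l).length_eq, List.length_map] at h4
    have h5 : (l.length + 1) * (2 * K) ≤ X * (2 * K) := Nat.mul_le_mul_right _ (by omega)
    linarith

theorem time_prepare (hK : CostBound P S K) {l : List (ℝ × List (ℝ × ℝ))} {X : ℕ}
    (hl : ∀ a ∈ l, a.1 ∈ S ∧ a.2.length + 1 ≤ X ∧ ∀ b ∈ a.2, b.1 ∈ S ∧ b.1 - a.1 ∈ S)
    (hX : 1 ≤ X) : (prepare P l).time ≤ (l.length + 1) * (5 * K * X ^ 2) := by
  have h1 := hK.one_le
  have hKX : K ≤ K * X ^ 2 := Nat.le_mul_of_pos_right _ (by positivity)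
  induction l with
  | nil => simp [prepare]; nlinarith
  | cons a l ih =>
    rw [prepare]
    simp only [Timed.time_bind, time_tick, Timed.time_pure, List.length_cons]
    obtain ⟨h2, h3, h4⟩ := hl a (by simp)
    have h5 := time_prepareItem hK h2 h4 h3
    have h6 := ih fun b hb => hl b (by simp [hb])
    have h7 : (a.2.length + 1) * (4 * K * X) ≤ X * (4 * K * X) := Nat.mul_le_mul_right _ h3
    nlinarith

theorem time_countItem (L : List Node) : (countItem L).time = L.length + 1 := by
  induction L with
  | nil => rfl
  | cons a l ih => simp [countItem, ih]; omega

theorem time_countNodes {Ls : List (List Node)} {X : ℕ} (hL : ∀ L ∈ Ls, L.length + 1 ≤ X) :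
    (countNodes Ls).time ≤ (Ls.length + 1) * (X + 1) := by
  induction Ls with
  | nil => simp [countNodes]
  | cons L Ls ih =>
    rw [countNodes]
    simp only [Timed.time_bind, time_tick, Timed.time_pure, time_countItem, List.length_cons]
    have h1 := hL L (by simp)
    have h2 := ih fun L' hL' => hL L' (by simp [hL'])
    linarith

theorem time_findNode (hK : CostBound P S K) {test : ℝ → Timed Bool} {L : List Node}
    (hL : NodesIn S L) (ht : ∀ x ∈ S, (test x).time ≤ K) :
    (findNode P test L).time ≤ (L.length + 1) * (3 * K) := by
  have h1 := hK.one_le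
  induction L with
  | nil => simp [findNode]; omega
  | cons a l ih =>
    rw [findNode]
    simp only [Timed.time_bind, time_tick, time_ltT, List.length_cons]
    have h2 := hK.cost _ hK.zero _ hL.head.2
    have h3 := ih hL.tail
    have h4 := ht _ hL.head.1
    split
    · simp only [Timed.time_bind]
      split
      · simp only [Timed.time_pure]
        nlinarith
      · linarith
    · linarith

theorem time_uncoupled (hK : CostBound P S K) {L : List Node} (hL : NodesIn S L) :
    (uncoupled P L).time ≤ (L.length + 1) * (2 * K) := by
  have h1 := hK.one_le
  induction L with
  | nil => simp [uncoupled]; omega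
  | cons a l ih =>
    rw [uncoupled]
    simp only [Timed.time_bind, time_tick, time_ltT, List.length_cons]
    have h2 := hK.cost _ hK.zero _ hL.head.2
    have h3 := ih hL.tail
    split
    · simp only [Timed.time_pure]
      linarith
    · simp only [Timed.time_pure]
      linarith

theorem time_pickNode (hK : CostBound P S K) (c : List Chain) (j : ℕ) {L : List Node}
    (hL : NodesIn S L) : (pickNode P c j L).time ≤ (L.length + 1) * (3 * K) := by
  have h1 := hK.one_le
  have h2 := time_uncoupled hK hL
  rw [pickNode]
  simp only [Timed.time_bind, time_tick]
  split
  · simp only [Timed.time_pure]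
    nlinarith
  · simp only [Timed.time_pure]
    nlinarith

theorem time_selectNode (hK : CostBound P S K) (c : List Chain) (i : ℕ) {a : ℝ} (ha : a ∈ S)
    (j : ℕ) {L : List Node} (hL : NodesIn S L) :
    (selectNode P c i a j L).time ≤ (L.length + 1) * (4 * K) := by
  have h1 := hK.one_le
  rw [selectNode]
  simp only [Timed.time_bind, time_tick]
  split
  · have := time_pickNode hK c j hL
    nlinarith
  · split
    · have := time_findNode hK (test := fun u => eqT P.cost u a) hL
        fun x hx => hK.cost x hx a ha
      nlinarith
    · have := time_findNode hK (test := fun u => domT P j u i a) hL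
        fun x hx => hK.cost x hx a ha
      nlinarith

theorem time_selectNodes (hK : CostBound P S K) (c : List Chain) (i : ℕ) {a : ℝ} (ha : a ∈ S)
    (j : ℕ) {Ls : List (List Node)} {X : ℕ} (hL : ∀ L ∈ Ls, NodesIn S L ∧ L.length + 1 ≤ X)
    (hX : 1 ≤ X) : (selectNodes P c i a j Ls).time ≤ (Ls.length + 1) * (5 * K * X) := by
  have h1 := hK.one_le
  have hKX : K ≤ K * X := Nat.le_mul_of_pos_right _ hX
  induction Ls generalizing j with
  | nil => simp [selectNodes]; nlinarith
  | cons L Ls ih =>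
    rw [selectNodes]
    simp only [Timed.time_bind, time_tick, List.length_cons]
    obtain ⟨h2, h3⟩ := hL L (by simp)
    have h4 := time_selectNode hK c i ha j h2
    have h5 : (L.length + 1) * (4 * K) ≤ X * (4 * K) := Nat.mul_le_mul_right _ h3
    have h6 := ih (j + 1) fun L' hL' => hL L' (by simp [hL'])
    split
    · simp only [Timed.time_pure]
      nlinarith
    · simp only [Timed.time_bind]
      split
      · simp only [Timed.time_pure]
        linarith
      · simp only [Timed.time_pure]
        linarith

theorem time_lowestMass (hK : CostBound P S K) {m : ℝ} (hm : m ∈ S) {l : List Node}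
    (hl : ∀ b ∈ l, b.2 ∈ S) : (lowestMass P m l).time ≤ (l.length + 1) * (2 * K) := by
  have h1 := hK.one_le
  induction l generalizing m with
  | nil => simp [lowestMass]; omega
  | cons b l ih =>
    rw [lowestMass]
    simp only [Timed.time_bind, time_tick, time_ltT, List.length_cons]
    have hb := hl b (by simp)
    have h2 := hK.cost _ hb _ hm
    have hl' : ∀ b ∈ l, b.2 ∈ S := fun b' hb' => hl b' (by simp [hb'])
    split
    · have := ih hb hl'
      linarith
    · have := ih hm hl'
      linarith

theorem time_removeMass (hK : CostBound P S K) {u m : ℝ} (hu : u ∈ S) (hm : m ∈ S)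
    {L : List Node} (hL : NodesIn S L) : (removeMass P u m L).time ≤ (L.length + 1) * (3 * K) := by
  have h1 := hK.one_le
  induction L with
  | nil => simp [removeMass]; omega
  | cons a l ih =>
    rw [removeMass]
    simp only [Timed.time_bind, time_tick, time_eqT, List.length_cons]
    have h2 := hK.cost _ hL.head.1 _ hu
    have h3 := hK.cost _ hL.head.2 _ hm
    have h4 := ih hL.tail
    split
    · simp only [Timed.time_bind, time_subT, Timed.time_pure]
      nlinarith
    · simp only [Timed.time_bind, Timed.time_pure]
      linarith

theorem time_restoreMass (hK : CostBound P S K) {u m : ℝ} (hu : u ∈ S) (hm : m ∈ S)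
    {L : List Node} (hL : NodesIn S L) :
    (restoreMass P u m L).time ≤ (L.length + 1) * (3 * K) := by
  have h1 := hK.one_le
  induction L with
  | nil => simp [restoreMass]; omega
  | cons a l ih =>
    rw [restoreMass]
    simp only [Timed.time_bind, time_tick, time_eqT, List.length_cons]
    have h2 := hK.cost _ hL.head.1 _ hu
    have h3 := hK.cost _ hL.head.2 _ hm
    have h4 := ih hL.tail
    split
    · simp only [Timed.time_bind, time_addT, Timed.time_pure]
      nlinarith
    · simp only [Timed.time_bind, Timed.time_pure]
      linarith

theorem time_splitNodes (hK : CostBound P S K) {m : ℝ} (hm : m ∈ S) {bs : List Node}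
    (hbs : ∀ b ∈ bs, b.1 ∈ S) {Ls : List (List Node)} {X : ℕ}
    (hL : ∀ L ∈ Ls, NodesIn S L ∧ L.length + 1 ≤ X) (hX : 1 ≤ X) :
    (splitNodes P m bs Ls).time ≤ (Ls.length + 1) * (4 * K * X) := by
  have h1 := hK.one_le
  have hKX : K ≤ K * X := Nat.le_mul_of_pos_right _ hX
  induction bs generalizing Ls with
  | nil => simp [splitNodes]; nlinarith
  | cons b bs ih =>
    cases Ls with
    | nil => simp [splitNodes]; nlinarith
    | cons L Ls =>
      rw [splitNodes]
      simp only [Timed.time_bind, time_tick, Timed.time_pure, List.length_cons]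
      obtain ⟨h2, h3⟩ := hL L (by simp)
      have h4 := time_removeMass hK (hbs b (by simp)) hm h2
      have h5 : (L.length + 1) * (3 * K) ≤ X * (3 * K) := Nat.mul_le_mul_right _ h3
      have h6 := ih (fun b' hb' => hbs b' (by simp [hb'])) (Ls := Ls)
        fun L' hL' => hL L' (by simp [hL'])
      linarith

theorem time_getUtil (j : ℕ) (l : List ℝ) : (getUtil j l).time ≤ l.length + 1 := by
  induction l generalizing j with
  | nil => cases j <;> simp [getUtil]
  | cons u l ih =>
    cases j with
    | zero => simp [getUtil]
    | succ j => simpa [getUtil, add_comm] using ih j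

theorem time_setUtil (x : ℝ) (j : ℕ) (l : List ℝ) : (setUtil x j l).time ≤ l.length + 1 := by
  induction l generalizing j with
  | nil => cases j <;> simp [setUtil]
  | cons u l ih =>
    cases j with
    | zero => simp [setUtil]
    | succ j => simpa [setUtil, add_comm] using ih j

theorem time_getNodes (j : ℕ) (l : List (List Node)) : (getNodes j l).time ≤ l.length + 1 := by
  induction l generalizing j with
  | nil => cases j <;> simp [getNodes]
  | cons u l ih =>
    cases j with
    | zero => simp [getNodes]
    | succ j => simpa [getNodes, add_comm] using ih j

theorem time_setNodes (L : List Node) (j : ℕ) (l : List (List Node)) :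
    (setNodes L j l).time ≤ l.length + 1 := by
  induction l generalizing j with
  | nil => cases j <;> simp [setNodes]
  | cons u l ih =>
    cases j with
    | zero => simp [setNodes]
    | succ j => simpa [setNodes, add_comm] using ih j

theorem time_insertChain (hK : CostBound P S K) {X j : ℕ} {t : Chain}
    (ht : t.utils.length + 1 ≤ X ∧ t.utils.getD j 0 ∈ S) {c : List Chain}
    (hc : ∀ t ∈ c, t.utils.length + 1 ≤ X ∧ t.utils.getD j 0 ∈ S) :
    (insertChain P j t c).time ≤ (c.length + 1) * (4 * K * X) := by
  have h1 := hK.one_le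
  have hKX : K ≤ K * X := Nat.le_mul_of_pos_right _ (by omega)
  have hXK : X ≤ K * X := Nat.le_mul_of_pos_left _ h1
  induction c with
  | nil => simp [insertChain]; nlinarith
  | cons t' c ih =>
    rw [insertChain]
    simp only [Timed.time_bind, time_tick, time_ltT, val_getUtil, List.length_cons]
    obtain ⟨h2, h3⟩ := hc t' (by simp)
    have h4 := hK.cost _ h3 _ ht.2
    have h5 := time_getUtil j t'.utils
    have h6 := time_getUtil j t.utils
    have h7 := ih fun t hm => hc t (by simp [hm])
    split
    · simp only [Timed.time_bind, Timed.time_pure]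
      linarith
    · simp only [Timed.time_pure]
      nlinarith

theorem time_sortChains (hK : CostBound P S K) {X j : ℕ} {c : List Chain}
    (hc : ∀ t ∈ c, t.utils.length + 1 ≤ X ∧ t.utils.getD j 0 ∈ S) (hX : c.length + 1 ≤ X) :
    (sortChains P j c).time ≤ (c.length + 1) * (5 * K * X ^ 2) := by
  have h1 := hK.one_le
  have hKX : K ≤ K * X ^ 2 := Nat.le_mul_of_pos_right _ (by have : 0 < X := by omega
                                                            positivity)
  induction c with
  | nil => simp [sortChains]; nlinarith
  | cons t c ih =>
    rw [sortChains]
    simp only [List.length_cons] at hX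
    simp only [Timed.time_bind, time_tick, List.length_cons]
    have h2 := ih (fun t hm => hc t (by simp [hm])) (by omega)
    have h3 := time_insertChain hK (hc t (by simp)) (c := (sortChains P j c).val)
      fun t hm => hc t (by simp [(sortChains_perm P j c).mem_iff.1 hm])
    rw [(sortChains_perm P j c).length_eq] at h3
    have h4 : (c.length + 1) * (4 * K * X) ≤ X * (4 * K * X) := Nat.mul_le_mul_right _ (by omega)
    nlinarith

theorem time_sameUtils (hK : CostBound P S K) {l l' : List ℝ} (hl : ∀ x ∈ l, x ∈ S)
    (hl' : ∀ x ∈ l', x ∈ S) : (sameUtils P l l').time ≤ (l.length + 1) * (2 * K) := by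
  have h1 := hK.one_le
  induction l generalizing l' with
  | nil => cases l' <;> simp [sameUtils] <;> omega
  | cons x l ih =>
    cases l' with
    | nil => simp [sameUtils]; nlinarith
    | cons y l' =>
      rw [sameUtils]
      simp only [Timed.time_bind, time_tick, time_eqT, List.length_cons]
      have h2 := hK.cost _ (hl x (by simp)) _ (hl' y (by simp))
      have h3 := ih (fun x hx => hl x (by simp [hx])) (l' := l') fun x hx => hl' x (by simp [hx])
      split
      · linarith
      · simp only [Timed.time_pure]
        nlinarith

theorem time_mergeChain (hK : CostBound P S K) {X : ℕ} {t : Chain} (htm : t.mass ∈ S)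
    (htu : ∀ x ∈ t.utils, x ∈ S) {c : List Chain}
    (hc : ∀ t ∈ c, t.mass ∈ S ∧ (∀ x ∈ t.utils, x ∈ S) ∧ t.utils.length + 1 ≤ X) (hX : 1 ≤ X) :
    (mergeChain P t c).time ≤ (c.length + 1) * (4 * K * X) := by
  have h1 := hK.one_le
  have hKX : K ≤ K * X := Nat.le_mul_of_pos_right _ hX
  induction c with
  | nil => simp [mergeChain]; nlinarith
  | cons t' c ih =>
    rw [mergeChain]
    simp only [Timed.time_bind, time_tick, List.length_cons]
    obtain ⟨h2, h3, h4⟩ := hc t' (by simp)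
    have h5 := time_sameUtils hK h3 htu
    have h6 : (t'.utils.length + 1) * (2 * K) ≤ X * (2 * K) := Nat.mul_le_mul_right _ h4
    have h7 := hK.cost _ h2 _ htm
    have h8 := ih fun t hm => hc t (by simp [hm])
    split
    · simp only [Timed.time_bind, time_addT, Timed.time_pure]
      nlinarith
    · simp only [Timed.time_bind, Timed.time_pure]
      linarith

/-- The numbers of a chain that is processed: its mass belongs to `G`, its utilities to `S`. -/
def ChainIn (G : AddSubgroup ℝ) (S : Set ℝ) (X : ℕ) (t : Chain) : Prop :=
  0 ≤ t.mass ∧ t.mass ∈ G ∧ (∀ x ∈ t.utils, x ∈ S) ∧ t.utils.length + 1 ≤ X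

theorem time_addPieces (hK : CostBound P S K) {G : AddSubgroup ℝ}
    (hG : ∀ x ∈ G, 0 ≤ x → x ≤ 1 → x ∈ S) {X j : ℕ} {t : Chain} (htu : ∀ x ∈ t.utils, x ∈ S)
    (htl : t.utils.length + 1 ≤ X) {l : List (ℝ × ℝ)}
    (hl : ∀ q ∈ l, 0 ≤ q.2 ∧ q.2 ∈ G ∧ q.1 ∈ S) {c : List Chain} (hc : ∀ t ∈ c, ChainIn G S X t)
    (hsum : nodeSum l (fun _ => 1) + chainSum c (fun _ => 1) ≤ 1)
    (hX : c.length + l.length + 1 ≤ X) :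
    (addPieces P j t l c).time ≤ (l.length + 1) * (6 * K * X ^ 2) := by
  have h1 := hK.one_le
  have hX2 : X ≤ X ^ 2 := Nat.le_self_pow (by norm_num) _
  have hKX : X ^ 2 ≤ K * X ^ 2 := Nat.le_mul_of_pos_left _ h1
  induction l generalizing c with
  | nil => simp [addPieces]; nlinarith
  | cons q l ih =>
    rw [addPieces]
    simp only [List.length_cons] at hX
    simp only [Timed.time_bind, time_tick, val_setUtil, List.length_cons]
    obtain ⟨h2, h3, h4⟩ := hl q (by simp)
    have hl' : ∀ q ∈ l, 0 ≤ q.2 ∧ q.2 ∈ G ∧ q.1 ∈ S := fun q' hq' => hl q' (by simp [hq'])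
    have hcsum := chainSum_nonneg (fun t ht => (hc t ht).1) (g := fun _ => 1)
      fun _ => zero_le_one
    have hlsum := nodeSum_nonneg (fun q hq => (hl' q hq).1) (f := fun _ => 1)
      fun _ => zero_le_one
    rw [nodeSum_cons] at hsum
    have hset : ∀ x ∈ t.utils.set j q.1, x ∈ S := fun x hx => by
      rcases List.mem_or_eq_of_mem_set hx with hx | rfl
      · exact htu x hx
      · exact h4
    have hnew : ChainIn G S X ⟨q.2, t.utils.set j q.1⟩ := ⟨h2, h3, hset, by simpa using htl⟩
    have hmem : ∀ t' ∈ (mergeChain P ⟨q.2, t.utils.set j q.1⟩ c).val, ChainIn G S X t' := by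
      intro t' ht'
      rcases mem_mergeChain P ht' with h | rfl | ⟨s, hs, -, rfl⟩
      · exact hc t' h
      · exact hnew
      · exact ⟨add_nonneg (hc s hs).1 h2, G.add_mem (hc s hs).2.1 h3, hset, by simpa using htl⟩
    have h5 := time_setUtil q.1 j t.utils
    have h6 := time_mergeChain hK (X := X) (t := ⟨q.2, t.utils.set j q.1⟩)
      (hG _ h3 h2 (by linarith)) hset (c := c)
      (fun t ht => by
        obtain ⟨h7, h8, h9⟩ := hc t ht
        have := mass_le_chainSum (fun t ht => (hc t ht).1) ht
        exact ⟨hG _ h8 h7 (by linarith), h9⟩) (by omega)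
    have h7 : (c.length + 1) * (4 * K * X) ≤ X * (4 * K * X) := Nat.mul_le_mul_right _ (by omega)
    have h8 := length_mergeChain P ⟨q.2, t.utils.set j q.1⟩ c
    have h9 := ih hl' hmem (by rw [chainSum_mergeChain]; simp only; linarith) (by omega)
    nlinarith

theorem time_takeLowest (hK : CostBound P S K) {G : AddSubgroup ℝ}
    (hG : ∀ x ∈ G, 0 ≤ x → x ≤ 1 → x ∈ S) {m : ℝ} (hm : 0 ≤ m) (hm1 : m ≤ 1) (hmG : m ∈ G)
    {L : List Node} (hs : L.Pairwise fun x y => y.1 < x.1) (hL : ∀ a ∈ L, 0 ≤ a.2 ∧ a.2 ∈ G)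
    (hLS : ∀ a ∈ L, a.2 ∈ S) : (takeLowest P m L).time ≤ (L.length + 1) * (4 * K) := by
  have h1 := hK.one_le
  induction L with
  | nil => simp [takeLowest]; omega
  | cons a l ih =>
    rw [takeLowest]
    simp only [Timed.time_bind, time_tick, List.length_cons, time_ltT]
    have hl : ∀ a ∈ l, 0 ≤ a.2 ∧ a.2 ∈ G := fun b hb => hL b (by simp [hb])
    have T := takeLowest_spec P G hm hmG hs.of_cons hl
    have h2 := ih hs.of_cons hl fun b hb => hLS b (by simp [hb])
    have h3 : (takeLowest P m l).val.missing ∈ S := by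
      refine hG _ T.missing_mem T.missing_nonneg ?_
      have h4 := T.total
      have h5 := nodeSum_nonneg (fun q hq => (T.pieces q hq).1.le) (f := fun _ => 1)
        fun _ => zero_le_one
      linarith
    have ha := hLS a (by simp)
    have c1 := hK.cost _ h3 _ ha
    have c2 := hK.cost _ hK.zero _ h3
    have c3 := hK.cost _ hK.zero _ ha
    have c4 := hK.cost _ ha _ h3
    split
    · simp only [Timed.time_bind, time_ltT]
      split
      · simp only [Timed.time_bind, time_subT, Timed.time_pure]
        linarith
      · simp only [Timed.time_pure]
        linarith
    · simp only [Timed.time_bind, time_ltT]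
      split
      · simp only [Timed.time_bind, time_subT, Timed.time_pure]
        linarith
      · simp only [Timed.time_pure]
        linarith

end Times

/-! ### Running time of the algorithm -/

section Times

variable {P : Params} {S : Set ℝ} {K : ℕ} {G : AddSubgroup ℝ}

theorem time_recoupleLoop (hK : CostBound P S K) (hG : ∀ x ∈ G, 0 ≤ x → x ≤ 1 → x ∈ S)
    {Us : List ℝ} (hUs : Us.Pairwise fun x y => y < x) (hUS : ∀ u ∈ Us, u ∈ S) {X j : ℕ}
    (hUX : Us.length + 1 ≤ X) {w : ℝ} {c : List Chain} {L : List Node} {done : List Chain}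
    (h : RecoupleInv G Us j w c L done) (hc : ∀ t ∈ c, ChainIn G S X t)
    (hd : ∀ t ∈ done, ChainIn G S X t)
    (hsum : nodeSum L (fun _ => 1) + chainSum c (fun _ => 1) + chainSum done (fun _ => 1) ≤ 1)
    (hX : done.length + c.length + Us.countP (fun u => decide (w ≤ u)) + 1 ≤ X) :
    (recoupleLoop P j c L done).time ≤ (c.length + 1) * (15 * K * X ^ 3) := by
  have h1 := hK.one_le
  have hX0 : 1 ≤ X := by omega
  have hX2 : X ≤ X ^ 3 := Nat.le_self_pow (by norm_num) _
  have hKX : X ^ 3 ≤ K * X ^ 3 := Nat.le_mul_of_pos_left _ h1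
  induction c generalizing w L done with
  | nil => simp [recoupleLoop]; nlinarith
  | cons t c ih =>
    obtain ⟨hm, hmG, hj, hu, -⟩ := h.rest t (by simp)
    have hs := pairwise_of_map_fst hUs h.utils
    have hL0 : ∀ a ∈ L, 0 ≤ a.2 := fun a ha => (h.node a ha).1
    have hLlen : L.length + 1 ≤ X := by
      have := congrArg List.length h.utils
      rw [List.length_map] at this
      omega
    obtain ⟨r, hr⟩ : ∃ r, r = (takeLowest P t.mass (addMass (t.utils.getD j 0) t.mass L)).val :=
      ⟨_, rfl⟩
    obtain ⟨T, w', R⟩ := recouple_step P hUs h hr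
    rw [chainSum_cons, mul_one] at hsum
    have hLs := nodeSum_nonneg hL0 (f := fun _ => 1) fun _ => zero_le_one
    have hcs := chainSum_nonneg (fun t ht => (hc t (by simp [ht])).1) (c := c) (g := fun _ => 1)
      fun _ => zero_le_one
    have hds := chainSum_nonneg (fun t ht => (hd t ht).1) (g := fun _ => 1) fun _ => zero_le_one
    have hm1 : t.mass ≤ 1 := by linarith
    have hmS : t.mass ∈ S := hG _ hmG hm.le hm1
    have hLS : NodesIn S L := fun a ha => by
      refine ⟨hUS _ (h.utils ▸ List.mem_map_of_mem ha), hG _ (h.node a ha).2 (hL0 a ha) ?_⟩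
      have := mass_le_nodeSum hL0 ha
      linarith
    -- the masses after the utility of `t` has been uncoupled
    have hL1 : ∀ a ∈ addMass (t.utils.getD j 0) t.mass L, (0 ≤ a.2 ∧ a.2 ∈ G) ∧ a.2 ∈ S := by
      have h2 : ∀ a ∈ addMass (t.utils.getD j 0) t.mass L, 0 ≤ a.2 ∧ a.2 ∈ G := by
        intro a ha
        rcases mem_addMass ha with ⟨ha, -⟩ | ⟨-, ha⟩
        · exact h.node a ha
        · obtain ⟨h1, h2⟩ := h.node _ ha
          exact ⟨by simp only at h1; linarith, by simpa using G.add_mem h2 hmG⟩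
      intro a ha
      refine ⟨h2 a ha, hG _ (h2 a ha).2 (h2 a ha).1 ?_⟩
      have h3 := mass_le_nodeSum (fun a ha => (h2 a ha).1) ha
      rw [nodeSum_addMass hs (h.utils ▸ hu), mul_one] at h3
      linarith
    have hs1 := pairwise_of_map_fst hUs ((map_fst_addMass (t.utils.getD j 0) t.mass L).trans h.utils)
    have hlen1 : (addMass (t.utils.getD j 0) t.mass L).length = L.length := by simp [addMass]
    obtain ⟨-, -, htu, htl⟩ := hc t (by simp)
    have hpieces : r.pieces.length ≤ Us.length := by
      have := T.sublist.length_le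
      have h2 := congrArg List.length h.utils
      rw [List.length_map] at h2
      rwa [List.length_map, List.length_map, hlen1, h2] at this
    have hpS : ∀ q ∈ r.pieces, 0 ≤ q.2 ∧ q.2 ∈ G ∧ q.1 ∈ S := fun q hq =>
      ⟨(R.piece q hq).1.le, (T.pieces q hq).2.1, hUS _ (R.piece q hq).2.1⟩
    have hcount := R.length
    have hlenA := length_addPieces P j t r.pieces done
    have hnew : ∀ s ∈ (addPieces P j t r.pieces done).val, ChainIn G S X s := by
      refine forall_mem_addPieces P j t (fun m m' us h1 h2 => ?_) (fun q hq => ?_) hd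
      · exact ⟨add_nonneg h1.1 h2.1, G.add_mem h1.2.1 h2.2.1, h1.2.2⟩
      · refine ⟨(hpS q hq).1, (hpS q hq).2.1, fun x hx => ?_, by simpa using htl⟩
        rcases List.mem_or_eq_of_mem_set hx with hx | rfl
        · exact htu x hx
        · exact (hpS q hq).2.2
    have hsum' := R.sum fun _ => 1
    have hmass := R.mass
    rw [mul_one] at hsum'
    simp only [List.length_cons] at hX
    have t1 := time_getUtil j t.utils
    have t2 := time_restoreMass hK (hUS _ hu) hmS hLS
    have t3 := time_takeLowest hK hG hm.le hm1 hmG hs1 (fun a ha => (hL1 a ha).1)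
      fun a ha => (hL1 a ha).2
    rw [hlen1] at t3
    have t4 := time_addPieces hK hG (X := X) (j := j) (t := t) htu htl hpS hd
      (by rw [hmass]; linarith) (by omega)
    have t5 := ih R.inv (fun t ht => hc t (by simp [ht])) hnew
      (by rw [chainSum_addPieces]; linarith) (by omega)
    rw [recoupleLoop]
    simp only [Timed.time_bind, time_tick, val_getUtil, val_restoreMass P _ _ hs, ← hr,
      List.length_cons]
    have m2 : (L.length + 1) * (3 * K) ≤ X * (3 * K) := Nat.mul_le_mul_right _ hLlen
    have m3 : (L.length + 1) * (4 * K) ≤ X * (4 * K) := Nat.mul_le_mul_right _ hLlen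
    have m4 : (r.pieces.length + 1) * (6 * K * X ^ 2) ≤ X * (6 * K * X ^ 2) :=
      Nat.mul_le_mul_right _ (by omega)
    have m5 : K * X ≤ K * X ^ 3 := Nat.mul_le_mul_left _ hX2
    have m6 : X * (6 * K * X ^ 2) = 6 * (K * X ^ 3) := by ring
    linarith

end Times

section Times

variable {P : Params} {S : Set ℝ} {K : ℕ} {G : AddSubgroup ℝ} {n : ℕ} {Ls : List (List Node)}

/-- The numbers of the algorithm belong to `S`: the utilities, and the elements of `G` between `0`
and `1`. The number `X` exceeds the lengths of all lists of nodes, and their number. -/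
structure NumbersIn (G : AddSubgroup ℝ) (n : ℕ) (Ls : List (List Node)) (S : Set ℝ) (X : ℕ) :
    Prop where
  mass : ∀ x ∈ G, 0 ≤ x → x ≤ 1 → x ∈ S
  utils : ∀ j, ∀ u ∈ (Ls.getD j []).map Prod.fst, u ∈ S
  length : ∀ j, (Ls.getD j []).length + 1 ≤ X
  count : n + 2 ≤ X

theorem StateInv.nodesIn {s : State} (hs : StateInv G n Ls s) (hLs : IsPrepared G n Ls) {X : ℕ}
    (hN : NumbersIn G n Ls S X) : ∀ L ∈ s.nodes, NodesIn S L ∧ L.length + 1 ≤ X := by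
  intro L hL
  obtain ⟨j, hj, rfl⟩ := List.getElem_of_mem hL
  rw [← List.getD_eq_getElem _ []]
  constructor
  · intro a ha
    refine ⟨hN.utils j _ (hs.utils j ▸ List.mem_map_of_mem ha),
      hN.mass _ (hs.mass j a ha).2 (hs.mass j a ha).1 ?_⟩
    have h1 := mass_le_nodeSum (fun a ha => (hs.mass j a ha).1) ha
    have h2 := hs.conserve j (by have := hs.length; omega) fun _ => 1
    rw [hLs.total j (by have := hs.length; omega)] at h2
    have h3 := chainSum_nonneg hs.chain_nonneg (g := fun _ => 1) fun _ => zero_le_one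
    linarith
  · have := congrArg List.length (hs.utils j)
    rw [List.length_map, List.length_map] at this
    rw [this]
    exact hN.length j

theorem StateInv.chainIn {s : State} (hs : StateInv G n Ls s) {X : ℕ}
    (hN : NumbersIn G n Ls S X) : ∀ t ∈ s.chains, ChainIn G S X t := by
  intro t ht
  obtain ⟨h1, h2, h3, h4⟩ := hs.chain t ht
  refine ⟨h1.le, h2, fun x hx => ?_, by have := hN.count; omega⟩
  obtain ⟨j, hj, rfl⟩ := List.getElem_of_mem hx
  rw [← List.getD_eq_getElem _ 0]
  exact hN.utils j _ (h4 j (by omega))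

theorem time_recouple (hK : CostBound P S K) (hLs : IsPrepared G n Ls) {X : ℕ}
    (hN : NumbersIn G n Ls S X) {s : State} (hs : StateInv G n Ls s) {j : ℕ} (hj : j ≤ n)
    (hX : s.chains.length + (Ls.getD j []).length + 1 ≤ X) :
    (recouple P j s).time ≤ 23 * K * X ^ 4 := by
  have h1 := hK.one_le
  have hX0 : 1 ≤ X := by omega
  obtain ⟨w, hw, -⟩ := recoupleInv_sort P hs hj
  have hcp : (sortChains P j s.chains).val.Perm s.chains := sortChains_perm P _ _
  have hchain := hs.chainIn hN
  have hsum := hs.conserve j hj fun _ => 1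
  rw [hLs.total j hj] at hsum
  have hcount := List.countP_le_length (p := fun u => decide (w ≤ u))
    (l := (Ls.getD j []).map Prod.fst)
  rw [List.length_map] at hcount
  have t1 := time_sortChains hK (X := X) (j := j) (c := s.chains) (fun t ht => by
    obtain ⟨h2, h3, h4, h5⟩ := hs.chain t ht
    exact ⟨by have := hN.count; omega, hN.utils j _ (h5 j hj)⟩) (by omega)
  have t2 := time_recoupleLoop hK hN.mass (hLs.utils_sorted j) (hN.utils j) (X := X)
    (by rw [List.length_map]; exact hN.length j) hw (fun t ht => hchain t (hcp.mem_iff.1 ht))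
    (by simp) (by rw [chainSum_perm hcp, chainSum_nil]; linarith)
    (by rw [hcp.length_eq, List.length_nil]; omega)
  rw [hcp.length_eq] at t2
  have t3 := time_getNodes j s.nodes
  rw [recouple]
  simp only [Timed.time_bind, time_tick, Timed.time_pure, val_getNodes]
  generalize (recoupleLoop P j (sortChains P j s.chains).val (s.nodes.getD j []) []).val.1 = L
  have t4 := time_setNodes L j s.nodes
  rw [hs.length] at t3 t4
  have hcount' := hN.count
  have m1 : (s.chains.length + 1) * (5 * K * X ^ 2) ≤ X * (5 * K * X ^ 2) :=
    Nat.mul_le_mul_right _ (by omega)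
  have m2 : (s.chains.length + 1) * (15 * K * X ^ 3) ≤ X * (15 * K * X ^ 3) :=
    Nat.mul_le_mul_right _ (by omega)
  have m3 : X ≤ X ^ 4 := Nat.le_self_pow (by norm_num) _
  have m4 : X ^ 3 ≤ X ^ 4 := Nat.pow_le_pow_right hX0 (by norm_num)
  have m5 : X ^ 4 ≤ K * X ^ 4 := Nat.le_mul_of_pos_left _ h1
  have m6 : K * X ^ 3 ≤ K * X ^ 4 := Nat.mul_le_mul_left _ m4
  have m7 : X * (5 * K * X ^ 2) = 5 * (K * X ^ 3) := by ring
  have m8 : X * (15 * K * X ^ 3) = 15 * (K * X ^ 4) := by ring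
  have m9 : 23 * K * X ^ 4 = 23 * (K * X ^ 4) := by ring
  omega

theorem time_fillLoop (hK : CostBound P S K) (hP : IsChoice P.pick) (hLs : IsPrepared G n Ls)
    {X : ℕ} (hN : NumbersIn G n Ls S X) {i : ℕ} (hi : i ≤ n) {a : ℝ} (ha : a ∈ S) (b : ℕ)
    {s : State} (hs : StateInv G n Ls s) (hp : PhaseInv n P.dom i i (HasMass s) s.chains) :
    (fillLoop P i a b s).time ≤ (b + 1) * (12 * K * X ^ 2) := by
  have h1 := hK.one_le
  have hX := hN.count
  have hX2 : X ≤ X ^ 2 := Nat.le_self_pow (by norm_num) _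
  have hKX : K * X ≤ K * X ^ 2 := Nat.mul_le_mul_left _ hX2
  have hK1 : K ≤ K * X := Nat.le_mul_of_pos_right _ (by omega)
  induction b generalizing s with
  | zero => simp [fillLoop]; linarith
  | succ b ih =>
    rw [fillLoop]
    simp only [Timed.time_bind, time_tick]
    have hnodes := hs.nodesIn hLs hN
    have t1 := time_selectNodes hK s.chains i ha 0 hnodes (by omega)
    have m1 : (s.nodes.length + 1) * (5 * K * X) ≤ X * (5 * K * X) :=
      Nat.mul_le_mul_right _ (by rw [hs.length]; omega)
    have m1' : X * (5 * K * X) = 5 * (K * X ^ 2) := by ring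
    have m0 : (b + 1 + 1) * (12 * K * X ^ 2) = (b + 1) * (12 * K * X ^ 2) + 12 * (K * X ^ 2) := by
      ring
    have hsort : ∀ L ∈ s.nodes, L.Pairwise fun x y => y.1 ≤ x.1 := fun L hL => by
      obtain ⟨j, hj, rfl⟩ := List.getElem_of_mem hL
      rw [← List.getD_eq_getElem _ []]
      exact (hs.sorted hLs j).imp le_of_lt
    rcases val_selectNodes P hP s.chains i a 0 hsort with ⟨bs, hlen, hbs, h⟩ | ⟨h, -⟩
    · rw [h]
      match bs, hlen, hbs with
      | [], hlen, _ =>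
        simp only [Timed.time_pure]
        omega
      | x :: xs, hlen, hbs =>
        simp only [Timed.time_bind]
        have hbS : ∀ b ∈ x :: xs, b.1 ∈ S ∧ b.2 ∈ S := by
          intro b hb
          obtain ⟨r, hr, rfl⟩ := List.getElem_of_mem hb
          have hr' : r < s.nodes.length := hlen ▸ hr
          exact (hnodes _ (List.getElem_mem hr')).1 _ (hbs r hr' hr).mem
        have t2 := time_lowestMass hK (hbS x (by simp)).2 (l := xs)
          fun b hb => (hbS b (by simp [hb])).2
        have hxl : xs.length + 1 ≤ X := by
          have := hs.length
          simp only [List.length_cons] at hlen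
          omega
        have m2 : (xs.length + 1) * (2 * K) ≤ X * (2 * K) := Nat.mul_le_mul_right _ hxl
        have hmS : (lowestMass P x.2 xs).val ∈ S := by
          rcases (val_lowestMass P x.2 xs).2.2 with h | ⟨b, hb, h⟩
          · rw [h]
            exact (hbS x (by simp)).2
          · rw [h]
            exact (hbS b (by simp [hb])).2
        have t3 := time_splitNodes hK hmS (bs := x :: xs) (fun b hb => (hbS b hb).1) hnodes
          (by omega)
        have m3 : (s.nodes.length + 1) * (4 * K * X) ≤ X * (4 * K * X) :=
          Nat.mul_le_mul_right _ (by rw [hs.length]; omega)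
        have m3' : X * (4 * K * X) = 4 * (K * X ^ 2) := by ring
        have m2' : X * (2 * K) = 2 * (K * X) := by ring
        obtain ⟨h3, -⟩ := fill_step P hLs hs hi hp hlen hbs rfl rfl
        have t4 := ih h3.inv h3.phase
        omega
    · rw [h]
      simp only [Timed.time_pure]
      omega

theorem time_fillAll (hK : CostBound P S K) (hP : IsChoice P.pick) (hLs : IsPrepared G n Ls)
    {X : ℕ} (hN : NumbersIn G n Ls S X) {i : ℕ} (hi : i ≤ n) {b : ℕ} (hb : b + 1 ≤ X)
    {l : List Node} (hl : ∀ a ∈ l, a.1 ∈ S) {s : State} (hs : StateInv G n Ls s)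
    (hp : PhaseInv n P.dom i i (HasMass s) s.chains) :
    (fillAll P i b l s).time ≤ (l.length + 1) * (13 * K * X ^ 3) := by
  have h1 := hK.one_le
  have hX3 : 1 ≤ X ^ 3 := Nat.one_le_pow _ _ (by omega)
  have hKX : X ^ 3 ≤ K * X ^ 3 := Nat.le_mul_of_pos_left _ h1
  induction l generalizing s with
  | nil => simp [fillAll]; linarith
  | cons a l ih =>
    rw [fillAll]
    simp only [Timed.time_bind, time_tick, List.length_cons]
    have t1 := time_fillLoop hK hP hLs hN hi (hl a (by simp)) b hs hp
    have m1 : (b + 1) * (12 * K * X ^ 2) ≤ X * (12 * K * X ^ 2) := Nat.mul_le_mul_right _ hb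
    have m1' : X * (12 * K * X ^ 2) = 12 * (K * X ^ 3) := by ring
    have h2 := (fillLoop_result P hP hLs hi a.1 b hs hp).1
    have t2 := ih (fun a ha => hl a (by simp [ha])) h2.inv h2.phase
    linarith

/-- With `D` nodes in total, filling a position creates at most `D * (D + 1)` chains, since each of
its nodes starts at most `D + 1` executions of the filling loop, and recoupling the next position
adds at most `D` chains. This keeps the number of chains below `X` in all remaining stages. -/
theorem time_mainLoop (hK : CostBound P S K) (hP : IsChoice P.pick) (hdom : IsDomOrder n P.dom)
    (hLs : IsPrepared G n Ls) {X : ℕ} (hN : NumbersIn G n Ls S X) {D : ℕ}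
    (hD : (Ls.map List.length).sum = D) (hDX : D + 2 ≤ X) {i : ℕ} (hi : i ≤ n)
    {M : List (List Node)} (hM : Ls.drop i = M) {s : State} (hs : StateInv G n Ls s)
    (hp : PhaseInv n P.dom i i (HasMass s) s.chains)
    (hX : s.chains.length + M.length * (D * (D + 1) + D) + 1 ≤ X) :
    (mainLoop P (D + 1) i M s).time ≤ (M.length + 1) * (37 * K * X ^ 4) := by
  have h1 := hK.one_le
  have hX4 : 1 ≤ X ^ 4 := Nat.one_le_pow _ _ (by omega)
  have hKX : X ^ 4 ≤ K * X ^ 4 := Nat.le_mul_of_pos_left _ h1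
  have hlenD : ∀ j, (Ls.getD j []).length ≤ D := by
    intro j
    rcases lt_or_ge j Ls.length with hj | hj
    · rw [List.getD_eq_getElem _ _ hj, ← hD]
      exact List.single_le_sum (fun _ _ => Nat.zero_le _) _
        (List.mem_map_of_mem (List.getElem_mem hj))
    · rw [List.getD_eq_default _ _ hj]
      exact Nat.zero_le _
  induction M generalizing i s with
  | nil =>
    have := hLs.length
    have := List.drop_eq_nil_iff.1 hM
    omega
  | cons L M ih =>
    have hL : L = Ls.getD i [] := by
      have := congrArg (fun l : List (List Node) => l.getD 0 []) hM
      simpa [List.getD_eq_getElem?_getD] using this.symm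
    have t1 := time_fillAll hK hP hLs hN hi (b := D + 1) hDX (l := L)
      (fun a ha => hN.utils i _ (List.mem_map_of_mem (hL ▸ ha))) hs hp
    have m1 : (L.length + 1) * (13 * K * X ^ 3) ≤ X * (13 * K * X ^ 3) :=
      Nat.mul_le_mul_right _ (hL ▸ hN.length i)
    have m1' : X * (13 * K * X ^ 3) = 13 * (K * X ^ 4) := by ring
    cases M with
    | nil =>
      have hval : (mainLoop P (D + 1) i [L] s).time = 1 + (fillAll P i (D + 1) L s).time := rfl
      rw [hval, List.length_singleton]
      linarith
    | cons L' M =>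
      have hlen := congrArg List.length hM
      rw [List.length_drop, hLs.length, List.length_cons, List.length_cons] at hlen
      have hin : i < n := by omega
      rw [mainLoop]
      simp only [Timed.time_bind, time_tick]
      rw [hL] at t1 m1 ⊢
      obtain ⟨h2, -, h3⟩ := stage_result P hP hdom hLs hin (b := D + 1) hs hp
        (Nat.lt_succ_of_le ((massCount_le hs hLs).trans_eq hD)) rfl
      have l1 := h2.length
      have l2 := h3.length
      have l3 : (Ls.getD i []).length * (D + 1) ≤ D * (D + 1) :=
        Nat.mul_le_mul_right _ (hlenD i)
      have l4 := hlenD (i + 1)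
      simp only [List.length_cons] at hX ⊢
      have l5 : (M.length + 1 + 1) * (D * (D + 1) + D) =
        (M.length + 1) * (D * (D + 1) + D) + (D * (D + 1) + D) := by ring
      have t2 := time_recouple hK hLs hN h2.inv (Nat.succ_le_of_lt hin) (by
        simp only [Nat.succ_eq_add_one]
        omega)
      have t3 := ih hin (by rw [Nat.succ_eq_add_one, ← List.tail_drop, hM]; rfl) h3.inv h3.phase
        (by simp only [List.length_cons]; omega)
      simp only [List.length_cons, Nat.succ_eq_add_one] at t2 t3
      linarith

end Times

section Total

variable {n : ℕ} {P : Params} {S : Set ℝ} {K : ℕ} {G : AddSubgroup ℝ} {p : Fin n → ℝ}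
  {F : Fin n → List (ℝ × ℝ)}

theorem length_startNodes_sum (P : Params) (p : Fin n → ℝ) (F : Fin n → List (ℝ × ℝ)) :
    ((startNodes P p F).map List.length).sum = 1 + ∑ i, (F i).length := by
  have h : ∀ (q : ℝ) (l : List (ℝ × ℝ)), (prepareItem P q l).val.length = l.length :=
    fun q l => by rw [(prepareItem_perm P q l).length_eq, List.length_map]
  simp [startNodes, inputList, val_prepare, List.sum_ofFn, Function.comp_def, h]

/-- A bound for the running time on every instance whose numbers (including the utilities, and all
masses in `[0, 1]` that the operations of the algorithm may produce) belong to a set on which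
operations are cheap. -/
theorem time_waterFilling (hK : CostBound P S K) (hP : IsChoice P.pick)
    (hdom : IsDomOrder n P.dom) (hF : ∀ i, IsMarginal (F i)) (h1 : (1 : ℝ) ∈ G)
    (hGF : ∀ i, ∀ a ∈ F i, a.2 ∈ G) (hG : ∀ x ∈ G, 0 ≤ x → x ≤ 1 → x ∈ S)
    (hp : ∀ i, p i ∈ S) (hv : ∀ i, ∀ a ∈ F i, a.1 ∈ S ∧ a.1 - p i ∈ S) :
    (waterFilling P (List.ofFn fun i => (p i, F i))).time ≤
      45 * K * (2 * (numberSize F + 2) ^ 3 + 1) ^ 5 := by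
  have hLs : IsPrepared G n (startNodes P p F) := isPrepared_startNodes P p F hF h1 hGF
  set Y := numberSize F + 2 with hY
  set X := 2 * Y ^ 3 + 1 with hXdef
  have hn : n + 2 ≤ Y := by rw [hY, numberSize]; omega
  set D := ((startNodes P p F).map List.length).sum with hD
  have hDval : D = 1 + ∑ i, (F i).length := length_startNodes_sum P p F
  have hDY : D + 1 ≤ Y := by rw [hY, numberSize, hDval]; omega
  have hlenF : ∀ i, (F i).length ≤ ∑ i, (F i).length := fun i =>
    Finset.single_le_sum (f := fun i => (F i).length) (fun _ _ => Nat.zero_le _) (Finset.mem_univ i)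
  have hYX : Y + 1 ≤ X := by
    have : Y ≤ Y ^ 3 := Nat.le_self_pow (by norm_num) _
    omega
  have hK1 := hK.one_le
  have hlen : ∀ j, ((startNodes P p F).getD j []).length ≤ D := by
    intro j
    rcases lt_or_ge j (startNodes P p F).length with hj | hj
    · rw [List.getD_eq_getElem _ _ hj, hD]
      exact List.single_le_sum (fun _ _ => Nat.zero_le _) _
        (List.mem_map_of_mem (List.getElem_mem hj))
    · rw [List.getD_eq_default _ _ hj]
      exact Nat.zero_le _
  have hN : NumbersIn G n (startNodes P p F) S X := by
    refine ⟨hG, fun j u hu => ?_, fun j => ?_, by omega⟩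
    · rcases le_or_gt j n with hj | hj
      · rcases exists_fin_of_pos hj with rfl | ⟨i, rfl⟩
        · rw [startNodes_zero] at hu
          have : u = 0 := by simpa using hu
          rw [this]
          exact hK.zero
        · rw [startNodes_succ] at hu
          obtain ⟨b, hb, rfl⟩ := List.mem_map.1 hu
          rw [(prepareItem_perm P _ _).mem_iff] at hb
          obtain ⟨c, hc, rfl⟩ := List.mem_map.1 hb
          exact (hv i c hc).2
      · rw [List.getD_eq_default _ _ (by rw [length_startNodes]; omega)] at hu
        simp at hu
    · have := hlen j
      omega
  -- the number of all chains that may be created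
  have hchains : (n + 1) * (D * (D + 1) + D) + 1 ≤ X := by
    have e1 : D * (D + 1) ≤ Y * Y := Nat.mul_le_mul (by omega) hDY
    have e2 : D ≤ Y * Y := (by omega : D ≤ Y).trans (Nat.le_mul_self Y)
    have e3 : (n + 1) * (D * (D + 1) + D) ≤ Y * (2 * (Y * Y)) :=
      Nat.mul_le_mul (by omega) (by omega)
    have e4 : Y * (2 * (Y * Y)) = 2 * Y ^ 3 := by ring
    omega
  have t1 : (prepare P (inputList p F)).time ≤ ((inputList p F).length + 1) * (5 * K * X ^ 2) := by
    refine time_prepare hK (fun a ha => ?_) (by omega)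
    rcases List.mem_cons.1 ha with rfl | ha
    · exact ⟨hK.zero, by simp only [List.length_singleton]; omega, by simp [hK.zero]⟩
    · obtain ⟨i, rfl⟩ := (List.mem_ofFn' _ _).1 ha
      have := hlenF i
      exact ⟨hp i, by simp only; omega, hv i⟩
  have hlenI : (inputList p F).length = n + 1 := by simp [inputList]
  rw [hlenI] at t1
  have t2 : (countNodes (startNodes P p F)).time ≤ ((startNodes P p F).length + 1) * (X + 1) := by
    refine time_countNodes fun L hL => ?_
    obtain ⟨j, hj, rfl⟩ := List.getElem_of_mem hL
    rw [← List.getD_eq_getElem _ []]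
    exact hN.length j
  rw [length_startNodes] at t2
  have t3 := time_mainLoop hK hP hdom hLs hN hD.symm (by omega) (Nat.zero_le n) rfl
    (stateInv_start hLs) (phaseInv_start _) (by
      rw [List.drop_zero, length_startNodes, List.length_nil]
      omega)
  rw [List.drop_zero, length_startNodes] at t3
  rw [waterFilling]
  simp only [Timed.time_bind, time_tick, Timed.time_pure, val_countNodes]
  change 1 + ((prepare P (inputList p F)).time + ((countNodes (startNodes P p F)).time +
    ((mainLoop P (D + 1) 0 (startNodes P p F) ⟨startNodes P p F, []⟩).time + 0))) ≤ _
  have hX1 : 1 ≤ X := by omega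
  have m1 : (n + 1 + 1) * (5 * K * X ^ 2) ≤ X * (5 * K * X ^ 2) :=
    Nat.mul_le_mul_right _ (by omega)
  have m2 : (n + 1 + 1) * (X + 1) ≤ X * (X + X) := Nat.mul_le_mul (by omega) (by omega)
  have m3 : (n + 1 + 1) * (37 * K * X ^ 4) ≤ X * (37 * K * X ^ 4) :=
    Nat.mul_le_mul_right _ (by omega)
  have p1 : X ^ 3 ≤ X ^ 5 := Nat.pow_le_pow_right hX1 (by norm_num)
  have p2 : X ^ 2 ≤ X ^ 5 := Nat.pow_le_pow_right hX1 (by norm_num)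
  have p3 : 1 ≤ X ^ 5 := Nat.one_le_pow _ _ hX1
  have p4 : X ^ 5 ≤ K * X ^ 5 := Nat.le_mul_of_pos_left _ hK1
  have p5 : K * X ^ 3 ≤ K * X ^ 5 := Nat.mul_le_mul_left _ p1
  have e1 : X * (5 * K * X ^ 2) = 5 * (K * X ^ 3) := by ring
  have e2 : X * (X + X) = 2 * X ^ 2 := by ring
  have e3 : X * (37 * K * X ^ 4) = 37 * (K * X ^ 5) := by ring
  have e4 : 45 * K * X ^ 5 = 45 * (K * X ^ 5) := by ring
  linarith

end Total

/-! ### Bit lengths -/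

theorem bitLength_ratCast (q : ℚ) : bitLength (q : ℝ) = q.num.natAbs.size + q.den.size := by
  have h : ∃ r : ℚ, (r : ℝ) = (q : ℝ) := ⟨q, rfl⟩
  rw [bitLength, dif_pos h, Rat.cast_injective h.choose_spec]

theorem one_le_bitLength {x : ℝ} (hx : ∃ q : ℚ, (q : ℝ) = x) : 1 ≤ bitLength x := by
  obtain ⟨q, rfl⟩ := hx
  rw [bitLength_ratCast]
  have := Nat.size_pos.2 q.den_pos
  omega

/-- Reducing a fraction does not make it longer. -/
theorem bitLength_div_le (a : ℤ) {b : ℕ} (hb : 0 < b) :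
    bitLength ((a : ℝ) / (b : ℝ)) ≤ a.natAbs.size + b.size := by
  have h : ((a : ℝ) / (b : ℝ)) = (((a : ℚ) / ((b : ℤ) : ℚ) : ℚ) : ℝ) := by push_cast; rfl
  have hb' : (b : ℤ) ≠ 0 := by exact_mod_cast hb.ne'
  rw [h, bitLength_ratCast]
  refine Nat.add_le_add ?_ (Nat.size_le_size ?_)
  · rcases eq_or_ne a 0 with rfl | ha
    · simp
    · refine Nat.size_le_size (Nat.le_of_dvd (Int.natAbs_pos.2 ha) (Int.natAbs_dvd_natAbs.2 ?_))
      rw [← Rat.divInt_eq_div]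
      exact Rat.num_dvd a hb'
  · refine Nat.le_of_dvd hb ?_
    have := Rat.den_dvd a b
    rw [Rat.divInt_eq_div] at this
    exact_mod_cast this

theorem bitLength_sub_le (q r : ℚ) :
    bitLength ((q : ℝ) - (r : ℝ)) ≤ 2 * (bitLength (q : ℝ) + bitLength (r : ℝ)) + 1 := by
  have h : (q : ℝ) - (r : ℝ) =
      ((q.num * r.den - r.num * q.den : ℤ) : ℝ) / ((q.den * r.den : ℕ) : ℝ) := by
    have hq : (q.den : ℝ) ≠ 0 := by exact_mod_cast q.den_nz
    have hr : (r.den : ℝ) ≠ 0 := by exact_mod_cast r.den_nz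
    rw [Rat.cast_def q, Rat.cast_def r]
    push_cast
    field_simp
  rw [h]
  refine (bitLength_div_le _ (Nat.mul_pos q.den_pos r.den_pos)).trans ?_
  rw [bitLength_ratCast, bitLength_ratCast]
  have h1 : (q.num * r.den - r.num * q.den : ℤ).natAbs.size ≤
      q.num.natAbs.size + q.den.size + (r.num.natAbs.size + r.den.size) + 1 := by
    rw [Nat.size_le]
    have e1 := Nat.lt_size_self q.num.natAbs
    have e2 := Nat.lt_size_self q.den
    have e3 := Nat.lt_size_self r.num.natAbs
    have e4 := Nat.lt_size_self r.den
    have e5 : (q.num * r.den - r.num * q.den : ℤ).natAbs ≤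
        q.num.natAbs * r.den + r.num.natAbs * q.den := by
      refine (Int.natAbs_sub_le _ _).trans ?_
      simp [Int.natAbs_mul]
    have e6 : q.num.natAbs * r.den < 2 ^ (q.num.natAbs.size + r.den.size) := by
      rw [pow_add]
      exact Nat.mul_lt_mul'' e1 e4
    have e7 : r.num.natAbs * q.den < 2 ^ (r.num.natAbs.size + q.den.size) := by
      rw [pow_add]
      exact Nat.mul_lt_mul'' e3 e2
    have e8 : 2 ^ (q.num.natAbs.size + r.den.size) ≤
        2 ^ (q.num.natAbs.size + q.den.size + (r.num.natAbs.size + r.den.size)) :=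
      Nat.pow_le_pow_right (by norm_num) (by omega)
    have e9 : 2 ^ (r.num.natAbs.size + q.den.size) ≤
        2 ^ (q.num.natAbs.size + q.den.size + (r.num.natAbs.size + r.den.size)) :=
      Nat.pow_le_pow_right (by norm_num) (by omega)
    rw [pow_succ]
    omega
  have h2 : (q.den * r.den).size ≤ q.den.size + r.den.size := by
    rw [Nat.size_le, pow_add]
    exact Nat.mul_lt_mul'' (Nat.lt_size_self _) (Nat.lt_size_self _)
  omega

open Classical in
/-- The denominator of a rational number; the value for irrational numbers is not used. -/
noncomputable def realDen (x : ℝ) : ℕ := if h : ∃ q : ℚ, (q : ℝ) = x then h.choose.den else 1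

theorem realDen_ratCast (q : ℚ) : realDen (q : ℝ) = q.den := by
  have h : ∃ r : ℚ, (r : ℝ) = (q : ℝ) := ⟨q, rfl⟩
  rw [realDen, dif_pos h, Rat.cast_injective h.choose_spec]

theorem realDen_pos (x : ℝ) : 0 < realDen x := by
  rw [realDen]
  split
  · exact Rat.den_pos _
  · exact one_pos

theorem realDen_le (x : ℝ) : realDen x ≤ 2 ^ bitLength x := by
  by_cases hx : ∃ q : ℚ, (q : ℝ) = x
  · obtain ⟨q, rfl⟩ := hx
    rw [realDen_ratCast, bitLength_ratCast]
    exact (Nat.lt_size_self _).le.trans (Nat.pow_le_pow_right (by norm_num) (by omega))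
  · rw [realDen, dif_neg hx]
    exact Nat.one_le_two_pow

section BitSize

variable {n : ℕ} {p : Fin n → ℝ} {F : Fin n → List (ℝ × ℝ)}

/-- A common denominator of all probabilities. -/
noncomputable def commonDen (F : Fin n → List (ℝ × ℝ)) : ℕ :=
  ∏ i, ((F i).map fun a => realDen a.2).prod

theorem commonDen_pos (F : Fin n → List (ℝ × ℝ)) : 0 < commonDen F := by
  refine Finset.prod_pos fun i _ => List.prod_pos fun x hx => ?_
  obtain ⟨a, -, rfl⟩ := List.mem_map.1 hx
  exact realDen_pos _

theorem size_commonDen_le (p : Fin n → ℝ) (F : Fin n → List (ℝ × ℝ)) :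
    (commonDen F).size ≤ bitSize p F + 1 := by
  rw [Nat.size_le]
  have h1 : ∀ l : List (ℝ × ℝ), (l.map fun a => realDen a.2).prod ≤
      2 ^ (l.map fun a => bitLength a.1 + bitLength a.2).sum := by
    intro l
    induction l with
    | nil => simp
    | cons a l ih =>
      rw [List.map_cons, List.prod_cons, List.map_cons, List.sum_cons, pow_add]
      exact Nat.mul_le_mul ((realDen_le _).trans (Nat.pow_le_pow_right (by norm_num) (by omega))) ih
  have h2 : commonDen F ≤ 2 ^ bitSize p F := by
    rw [bitSize, ← Finset.prod_pow_eq_pow_sum]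
    exact Finset.prod_le_prod' fun i _ =>
      (h1 _).trans (Nat.pow_le_pow_right (by norm_num) (by omega))
  exact h2.trans_lt (Nat.pow_lt_pow_right (by norm_num) (by omega))

/-- The multiples of the reciprocal of the common denominator of the probabilities. All masses that
occur in the course of the algorithm belong to this group. -/
noncomputable def massGroup (F : Fin n → List (ℝ × ℝ)) : AddSubgroup ℝ :=
  AddSubgroup.zmultiples (1 / (commonDen F : ℝ))

theorem mem_massGroup {x : ℝ} : x ∈ massGroup F ↔ ∃ k : ℤ, x = k / (commonDen F : ℝ) := by
  rw [massGroup, AddSubgroup.mem_zmultiples_iff]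
  refine exists_congr fun k => ?_
  rw [zsmul_eq_mul, mul_one_div, eq_comm]

theorem one_mem_massGroup (F : Fin n → List (ℝ × ℝ)) : (1 : ℝ) ∈ massGroup F := by
  have : (commonDen F : ℝ) ≠ 0 := by exact_mod_cast (commonDen_pos F).ne'
  exact mem_massGroup.2 ⟨commonDen F, by rw [Int.cast_natCast, div_self this]⟩

theorem prob_mem_massGroup {i : Fin n} {a : ℝ × ℝ} (ha : a ∈ F i)
    (hq : ∃ q : ℚ, (q : ℝ) = a.2) : a.2 ∈ massGroup F := by
  obtain ⟨q, hq⟩ := hq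
  have h1 : realDen a.2 ∣ commonDen F :=
    (List.dvd_prod (List.mem_map_of_mem (f := fun a => realDen a.2) ha)).trans
      (Finset.dvd_prod_of_mem (fun i => ((F i).map fun a => realDen a.2).prod) (Finset.mem_univ i))
  rw [← hq, realDen_ratCast] at h1
  obtain ⟨d, hd⟩ := h1
  have h2 := (commonDen_pos F).ne'
  refine mem_massGroup.2 ⟨q.num * d, ?_⟩
  rw [hd] at h2 ⊢
  have h3 : (q.den : ℝ) ≠ 0 := by exact_mod_cast left_ne_zero_of_mul h2
  have h4 : (d : ℝ) ≠ 0 := by exact_mod_cast right_ne_zero_of_mul h2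
  rw [← hq, Rat.cast_def q]
  push_cast
  field_simp

theorem bitLength_mass_le (p : Fin n → ℝ) {x : ℝ} (hx : x ∈ massGroup F) (h0 : 0 ≤ x)
    (h1 : x ≤ 1) : bitLength x ≤ 2 * (bitSize p F + 1) := by
  obtain ⟨k, rfl⟩ := mem_massGroup.1 hx
  have hD := commonDen_pos F
  have hD' : (0 : ℝ) < commonDen F := by exact_mod_cast hD
  rw [div_le_one hD'] at h1
  have hk0 : 0 ≤ k := by
    by_contra hk
    have : (k : ℝ) < 0 := by exact_mod_cast not_le.1 hk
    exact absurd h0 (not_le.2 (div_neg_of_neg_of_pos this hD'))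
  have hk1 : k ≤ commonDen F := by exact_mod_cast h1
  have h2 : k.natAbs ≤ commonDen F := by omega
  have h3 := bitLength_div_le k hD
  have h4 := Nat.size_le_size h2
  have h5 := size_commonDen_le p F
  omega

theorem bitLength_le_bitSize (i : Fin n) : bitLength (p i) +
    ((F i).map fun a => bitLength a.1 + bitLength a.2).sum ≤ bitSize p F :=
  Finset.single_le_sum
    (f := fun i => bitLength (p i) + ((F i).map fun a => bitLength a.1 + bitLength a.2).sum)
    (fun _ _ => Nat.zero_le _) (Finset.mem_univ i)

theorem bitLength_pair_le {i : Fin n} {a : ℝ × ℝ} (ha : a ∈ F i) :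
    bitLength a.1 + bitLength a.2 ≤
      ((F i).map fun a => bitLength a.1 + bitLength a.2).sum :=
  List.single_le_sum (fun _ _ => Nat.zero_le _) _ (List.mem_map_of_mem ha)

theorem numberSize_le_bitSize (h : IsRational p F) : numberSize F ≤ bitSize p F := by
  have h1 : numberSize F = ∑ i : Fin n, (1 + (F i).length) := by
    rw [Finset.sum_add_distrib]
    simp [numberSize]
  rw [h1, bitSize]
  refine Finset.sum_le_sum fun i _ => Nat.add_le_add (one_le_bitLength (h i).1) ?_
  have h2 : ∀ l : List (ℝ × ℝ), (∀ a ∈ l, ∃ q : ℚ, (q : ℝ) = a.1) →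
      l.length ≤ (l.map fun a => bitLength a.1 + bitLength a.2).sum := by
    intro l hl
    induction l with
    | nil => simp
    | cons a l ih =>
      rw [List.map_cons, List.sum_cons, List.length_cons]
      have := one_le_bitLength (hl a (by simp))
      have := ih fun b hb => hl b (by simp [hb])
      omega
  exact h2 _ fun a ha => ((h i).2 a ha).1

end BitSize

theorem eval_mono_nat (Q : Polynomial ℕ) {x y : ℕ} (h : x ≤ y) : Q.eval x ≤ Q.eval y := by
  rw [Polynomial.eval_eq_sum_range, Polynomial.eval_eq_sum_range]
  exact Finset.sum_le_sum fun i _ => Nat.mul_le_mul_left _ (Nat.pow_le_pow_left h i)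

section RunTime

variable {n : ℕ} {p : Fin n → ℝ} {F : Fin n → List (ℝ × ℝ)} {tie : TieRule n}
  {pick : List Chain → ℕ → List Node → Node}

theorem time_run_unitCost (hI : IsInstance p F) (htie : tie.Consistent) (hpick : IsChoice pick) :
    (run (fun _ _ => 1) tie pick p F).time ≤ 45 * (2 * (numberSize F + 2) ^ 3 + 1) ^ 5 := by
  have h := time_waterFilling (P := { cost := fun _ _ => 1, dom := domOf tie, pick := pick })
    (S := Set.univ) (K := 1) (G := ⊤) (p := p) (F := F)
    ⟨trivial, fun _ _ _ _ => le_rfl, le_rfl⟩ hpick (isDomOrder_domOf htie) hI.marginal trivial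
    (fun _ _ _ => trivial) (fun _ _ _ _ => trivial) (fun _ => trivial)
    fun _ _ _ => ⟨trivial, trivial⟩
  rwa [mul_one] at h

theorem time_run_bitCost (Q : Polynomial ℕ) (hI : IsInstance p F) (hr : IsRational p F)
    (htie : tie.Consistent) (hpick : IsChoice pick) :
    (run (fun x y => Q.eval (bitLength x + bitLength y)) tie pick p F).time ≤
      45 * (Q.eval (8 * bitSize p F + 8) + 1) * (2 * (bitSize p F + 2) ^ 3 + 1) ^ 5 := by
  set B := 4 * bitSize p F + 4 with hB
  have hp : ∀ i, bitLength (p i) ≤ bitSize p F := fun i => by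
    have := bitLength_le_bitSize (p := p) (F := F) i
    omega
  have hv : ∀ i, ∀ a ∈ F i, bitLength a.1 ≤ bitSize p F := fun i a ha => by
    have := bitLength_le_bitSize (p := p) (F := F) i
    have := bitLength_pair_le ha
    omega
  have h := time_waterFilling
    (P := { cost := fun x y => Q.eval (bitLength x + bitLength y), dom := domOf tie, pick := pick })
    (S := {x | bitLength x ≤ B}) (K := Q.eval (8 * bitSize p F + 8) + 1) (G := massGroup F)
    (p := p) (F := F)
    ⟨(bitLength_mass_le (F := F) p (AddSubgroup.zero_mem _) le_rfl zero_le_one).trans (by omega),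
      fun x (hx : bitLength x ≤ B) y (hy : bitLength y ≤ B) =>
        (eval_mono_nat Q (by omega)).trans (Nat.le_succ _), by omega⟩ hpick (isDomOrder_domOf htie) hI.marginal
    (one_mem_massGroup F) (fun i a ha => prob_mem_massGroup ha ((hr i).2 a ha).2)
    (fun x hx h0 h1 => (bitLength_mass_le p hx h0 h1).trans (by omega))
    (fun i => (hp i).trans (by omega)) fun i a ha => ⟨(hv i a ha).trans (by omega), by
      have h1 := hp i
      have h2 := hv i a ha
      obtain ⟨q, hq⟩ := (hr i).1
      obtain ⟨r, hr⟩ := ((hr i).2 a ha).1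
      have h3 := bitLength_sub_le r q
      rw [hr, hq] at h3
      change bitLength (a.1 - p i) ≤ B
      omega⟩
  refine h.trans (Nat.mul_le_mul_left _ (Nat.pow_le_pow_left ?_ 5))
  have := Nat.pow_le_pow_left (Nat.add_le_add_right (numberSize_le_bitSize hr) 2) 3
  omega

end RunTime

end RobustPricing

open RobustPricing in
theorem mainTheorem2 :
    -- the output is compatible and attains the lowest expected revenue
    (∀ (n : ℕ) (p : Fin n → ℝ) (F : Fin n → List (ℝ × ℝ)) (tie : TieRule n)
        (pick : List Chain → ℕ → List Node → Node),
      IsInstance p F → tie.Consistent → IsChoice pick →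
        Compatible F (outputLaw tie pick p F) ∧
        ∀ μ : MeasureTheory.Measure (Profile n), Compatible F μ →
          MeasureTheory.Integrable (payment tie p) μ ∧
          revenue tie p (outputLaw tie pick p F) ≤ revenue tie p μ) ∧
    -- polynomially many steps in the number of items and value-probability pairs
    (∃ T : Polynomial ℕ, ∀ (n : ℕ) (p : Fin n → ℝ) (F : Fin n → List (ℝ × ℝ)) (tie : TieRule n)
        (pick : List Chain → ℕ → List Node → Node),
      IsInstance p F → tie.Consistent → IsChoice pick →
        (run (fun _ _ => 1) tie pick p F).time ≤ T.eval (numberSize F)) ∧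
    -- on rational inputs, polynomial time in the bit size, whenever an operation on numbers
    -- takes time polynomial in their bit lengths
    (∀ Q : Polynomial ℕ, ∃ T : Polynomial ℕ,
      ∀ (n : ℕ) (p : Fin n → ℝ) (F : Fin n → List (ℝ × ℝ)) (tie : TieRule n)
        (pick : List Chain → ℕ → List Node → Node),
      IsInstance p F → IsRational p F → tie.Consistent → IsChoice pick →
        (run (fun x y => Q.eval (bitLength x + bitLength y)) tie pick p F).time
          ≤ T.eval (bitSize p F)) := by
  refine ⟨fun n p F tie pick hI htie hpick => outputLaw_optimal hI htie hpick,
    ⟨45 * (2 * (Polynomial.X + 2) ^ 3 + 1) ^ 5, fun n p F tie pick hI htie hpick => ?_⟩,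
    fun Q => ⟨45 * (Q.comp (8 * Polynomial.X + 8) + 1) * (2 * (Polynomial.X + 2) ^ 3 + 1) ^ 5,
      fun n p F tie pick hI hr htie hpick => ?_⟩⟩
  · simpa using time_run_unitCost hI htie hpick
  · simpa using time_run_bitCost Q hI hr htie hpick
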